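/- Setting. Let $M$ be a $G_2$-manifold: a smooth Riemannian $7$-manifold $(M,g)$ with a vector cross product $\times$ on $TM$ (skew, $u\times v\perp u,v$, $|u\times v|=|u\wedge v|$) whose $3$-form $\Omega(u,v,w)=g(u\times v,w)$ is parallel for the Levi-Civita connection $\nabla$ of $g$. Put $\tau(u,v,w)=-u\times(v\times w)-g(u,v)w+g(u,w)v$, a $TM$-valued $3$-form. Let $C$ be a compact $4$-manifold, $\varepsilon_0>0$, and let $\varphi:[0,\varepsilon_0]\times C\to M$ be a smooth embedding such that every $C_t=\varphi(\{t\}\times C)$ is coassociative ($\Omega|_{C_t}=0$) and $n=\partial_t\varphi|_{t=0}$ is normal to $C_0$ (and, $\varphi$ being an immersion, nowhere zero). Let $\Sigma\subset C_0$ be a compact embedded $J_n$-holomorphic curve, $J_nu=|n|^{-1}n\times u$, and for $0<\varepsilon\le\varepsilon_0$ let $A'_\varepsilon=\varphi([0,\varepsilon]\times\Sigma)$, with normal bundle $N_{A'_\varepsilon/M}$, induced volume form $dvol_{A'_\varepsilon}$ and the orientation given by $dt$ followed by the complex orientation of $\Sigma$. Let $(g_\varepsilon)_{0\le\varepsilon\le\varepsilon_0}$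 be smooth Riemannian metrics on $M$, depending continuously on $\varepsilon\in[0,\varepsilon_0]$ together with all their derivatives on $M$ (locally uniformly), such that $C_0$ and $C_\varepsilon$ are totally geodesic for $g_\varepsilon$, $0<\varepsilon\le\varepsilon_0$. For a small section $V$ of $N_{A'_\varepsilon/M}$ put $$F_\varepsilon(V)=*_{A'_\varepsilon}\circ\bot_{A'_\varepsilon}\bigl(T_V\circ(\exp^{g_\varepsilon}V)^*\tau\bigr),$$ a section of $N_{A'_\varepsilon/M}$: here $(\exp^{g_\varepsilon}V)^*$ pulls back the differential form part of $\tau$ by $p\mapsto\exp_p^{g_\varepsilon}V(p)$; $T_V$ carries the vector part back to $T_pM$ by $g$-parallel transport along $r\mapsto\exp^{g_\varepsilon}_p(rV(p))$, $0\le r\le1$; $\bot_{A'_\varepsilon}$ is the $g$-orthogonal projection $TM|_{A'_\varepsilon}\to N_{A'_\varepsilon/M}$; and $*_{A'_\varepsilon}$ is division by $dvol_{A'_\varepsilon}$. Put $F'_\varepsilon(V_0)V=\frac{d}{dr}\big|_{r=0}F_\varepsilon(V_0+rV)$ (pointwise on $A'_\varepsilon$). Let $0<\alpha<1$. Fix finitely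 many coordinate discs of $\Sigma$ whose interiors cover $\Sigma$ and, over the product of $[0,\varepsilon_0]$ with each of them, a smooth orthonormal frame of the normal bundle; the $C^\alpha$ and $C^{1,\alpha}$ norms of sections of $N_{A'_\varepsilon/M}$ are the maxima over the discs $D$ of the norms $\sup|f|+[f]_\alpha$ and $\sup|f|+\sup|\nabla f|+[\nabla f]_\alpha$ of the component functions $f$ on $[0,\varepsilon]\times D\subset\mathbb R^3$. Proposition. There are $\delta_0>0$ and a constant $B$, both independent of $\varepsilon$, such that for all $0<\varepsilon\le\varepsilon_0$ and all $C^{1,\alpha}$ sections $V_0,V$ of $N_{A'_\varepsilon/M}$ with $\|V_0\|_{C^{1,\alpha}}<\delta_0$ the following hold: $\exp^{g_\varepsilon}V_0$ is defined and differentiable on $A'_\varepsilon$ (so that $F_\varepsilon(V_0)$ is defined), the derivative $F'_\varepsilon(V_0)V$ exists at every point of $A'_\varepsilon$, and $$\|F'_\varepsilon(V_0)V-F'_\varepsilon(0)V\|_{C^\alpha(A'_\varepsilon,N_{A'_\varepsilon/M})}\le B\,\|V_0\|_{C^{1,\alpha}(A'_\varepsilon,N_{A'_\varepsilon/M})}\,\|V\|_{C^{1,\alpha}(A'_\varepsilon,N_{A'_\varepsilon/M})}.$$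 -/

import Mathlib

open Set Filter Topology Manifold
open scoped ContDiff ENNReal NNReal

noncomputable section

namespace ThinInstanton

/-- Euclidean `n`-space. -/
abbrev Eu (n : ℕ) : Type := EuclideanSpace ℝ (Fin n)

/-- The tangent space of an `n`-manifold (without boundary) at `x`. -/
abbrev TS (n : ℕ) {N : Type*} [TopologicalSpace N] [ChartedSpace (Eu n) N] (x : N) : Type :=
  TangentSpace 𝓘(ℝ, Eu n) x

/-- A smooth Riemannian metric on a `7`-manifold. -/
abbrev Metric7 (M : Type*) [TopologicalSpace M] [ChartedSpace (Eu 7) M]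
    [IsManifold 𝓘(ℝ, Eu 7) ∞ M] :=
  Bundle.ContMDiffRiemannianMetric 𝓘(ℝ, Eu 7) ∞ (Eu 7) (fun x : M => TangentSpace 𝓘(ℝ, Eu 7) x)

/-- The model with corners of `ℝ × N`, where `N` is an `n`-manifold. -/
abbrev modelR (n : ℕ) : ModelWithCorners ℝ (ℝ × Eu n) (ModelProd ℝ (Eu n)) :=
  (𝓘(ℝ, ℝ)).prod 𝓘(ℝ, Eu n)

/-- The tangent vector `r ∂/∂t + a` of `ℝ × N`. -/
def tvec {n : ℕ} {N : Type*} [TopologicalSpace N] [ChartedSpace (Eu n) N] (p : ℝ × N)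
    (r : ℝ) (a : TS n p.2) : TangentSpace (modelR n) p :=
  ((r, a) : ℝ × Eu n)

section Riemannian

variable {M : Type*} [TopologicalSpace M] [ChartedSpace (Eu 7) M] [IsManifold 𝓘(ℝ, Eu 7) ∞ M]

/-- The point with coordinates `y` in the preferred chart around `x₀`. -/
def chartPt (x₀ : M) (y : Eu 7) : M := (extChartAt 𝓘(ℝ, Eu 7) x₀).symm y

/-- The tangent vector at `chartPt x₀ y` with components `v` in the chart around `x₀`. -/
def chartVec (x₀ : M) (y : Eu 7) (v : Eu 7) : TS 7 (chartPt x₀ y) :=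
  tangentCoordChange 𝓘(ℝ, Eu 7) x₀ (chartPt x₀ y) (chartPt x₀ y) v

/-- The components, in the chart around `x₀`, of a tangent vector at a point `x` of that chart. -/
def comps (x₀ : M) {x : M} (v : TS 7 x) : Eu 7 :=
  tangentCoordChange 𝓘(ℝ, Eu 7) x x₀ x v

/-- The metric in the chart around `x₀`, as a function of the coordinates with values in the
bilinear forms on `ℝ⁷`. -/
def chartMetric (g : Metric7 M) (x₀ : M) (y : Eu 7) : Eu 7 →L[ℝ] Eu 7 →L[ℝ] ℝ :=
  ContinuousLinearMap.bilinearComp (F := Eu 7) (E := Eu 7) (g.inner (chartPt x₀ y))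
    (tangentCoordChange 𝓘(ℝ, Eu 7) x₀ (chartPt x₀ y) (chartPt x₀ y))
    (tangentCoordChange 𝓘(ℝ, Eu 7) x₀ (chartPt x₀ y) (chartPt x₀ y))

/-- The Christoffel symbols of the Levi-Civita connection in the chart around `x₀`:
`Γ(v, w)` is the vector with
`g(Γ(v, w), z) = (∂_v g(w, z) + ∂_w g(v, z) - ∂_z g(v, w)) / 2` for all `z`. -/
def christoffel (g : Metric7 M) (x₀ : M) (y v w : Eu 7) : Eu 7 :=
  (chartMetric g x₀ y).inverse
    ((1 / 2 : ℝ) • (fderiv ℝ (chartMetric g x₀) y v w + fderiv ℝ (chartMetric g x₀) y w v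
      - ((fderiv ℝ (chartMetric g x₀) y).flip v).flip w))

/-- The velocity of the curve `γ` (on the parameter set `J`) in the chart around `x₀`. -/
def chartVel (γ : ℝ → M) (J : Set ℝ) (x₀ : M) (r : ℝ) : Eu 7 :=
  derivWithin (fun r' => extChartAt 𝓘(ℝ, Eu 7) x₀ (γ r')) J r

/-- `γ` is a geodesic of `g` on the interval `J`: it is continuous and satisfies
`c'' + Γ(c', c') = 0` in all charts. -/
def IsGeodesicOn (g : Metric7 M) (γ : ℝ → M) (J : Set ℝ) : Prop :=
  ContinuousOn γ J ∧ ∀ x₀ : M, ∀ r ∈ J, γ r ∈ (chartAt (Eu 7) x₀).source →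
    DifferentiableWithinAt ℝ (fun r' => extChartAt 𝓘(ℝ, Eu 7) x₀ (γ r')) J r ∧
    HasDerivWithinAt (chartVel γ J x₀)
      (-christoffel g x₀ (extChartAt 𝓘(ℝ, Eu 7) x₀ (γ r)) (chartVel γ J x₀ r)
        (chartVel γ J x₀ r)) J r

/-- The vector field `X` along `γ` is parallel for the Levi-Civita connection of `g`:
`X' + Γ(c', X) = 0` in all charts. -/
def IsParallelOn (g : Metric7 M) (γ : ℝ → M) (X : ∀ r : ℝ, TS 7 (γ r)) (J : Set ℝ) : Prop :=
  ∀ x₀ : M, ∀ r ∈ J, γ r ∈ (chartAt (Eu 7) x₀).source →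
    HasDerivWithinAt (fun r' => comps x₀ (X r'))
      (-christoffel g x₀ (extChartAt 𝓘(ℝ, Eu 7) x₀ (γ r)) (chartVel γ J x₀ r)
        (comps x₀ (X r))) J r

/-- The curve `γ` starts at `p` with velocity `v` (as a curve on the parameter set `J ∋ 0`). -/
def HasInitial (γ : ℝ → M) (J : Set ℝ) (p : M) (v : TS 7 p) : Prop :=
  (⟨γ 0, mfderivWithin 𝓘(ℝ, ℝ) 𝓘(ℝ, Eu 7) γ J 0 (1 : ℝ)⟩ : TangentBundle 𝓘(ℝ, Eu 7) M) = ⟨p, v⟩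

/-- The exponential map of `g` is defined at `v ∈ T_p M`. -/
def ExpDefined (g : Metric7 M) (p : M) (v : TS 7 p) : Prop :=
  ∃ γ : ℝ → M, IsGeodesicOn g γ (Icc 0 1) ∧ HasInitial γ (Icc 0 1) p v

open Classical in
/-- The geodesic `r ↦ exp_p (r v)`, `0 ≤ r ≤ 1`, of the metric `g` (the constant curve if
`exp_p v` is not defined). -/
def expCurve (g : Metric7 M) (p : M) (v : TS 7 p) : ℝ → M :=
  if h : ExpDefined g p v then h.choose else fun _ => p

open Classical in
/-- Parallel transport for `g`, backwards along `γ : [0, 1] → M`, of a tangent vector at `γ 1` to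
a tangent vector at `γ 0`. -/
def transportBack (g : Metric7 M) (γ : ℝ → M) (w : TS 7 (γ 1)) : TS 7 (γ 0) :=
  if h : ∃ X : ∀ r : ℝ, TS 7 (γ r), IsParallelOn g γ X (Icc 0 1) ∧ X 1 = w then h.choose 0 else 0

end Riemannian

/-- A `G₂`-structure on a `7`-manifold: a Riemannian metric and a smooth `2`-fold vector cross
product whose `3`-form `Ω(u, v, w) = g(u × v, w)` is parallel for the Levi-Civita connection. -/
structure G2Structure (M : Type*) [TopologicalSpace M] [ChartedSpace (Eu 7) M]
    [IsManifold 𝓘(ℝ, Eu 7) ∞ M] where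
  /-- the metric -/
  metric : Metric7 M
  /-- the vector cross product -/
  cross : ∀ x : M, TS 7 x →ₗ[ℝ] TS 7 x →ₗ[ℝ] TS 7 x
  cross_skew : ∀ (x : M) (u v : TS 7 x), cross x u v = -cross x v u
  cross_perp_left : ∀ (x : M) (u v : TS 7 x), metric.inner x (cross x u v) u = 0
  cross_perp_right : ∀ (x : M) (u v : TS 7 x), metric.inner x (cross x u v) v = 0
  cross_area : ∀ (x : M) (u v : TS 7 x), metric.inner x (cross x u v) (cross x u v) =
    metric.inner x u u * metric.inner x v v - metric.inner x u v ^ 2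
  form_smooth : ∀ (x₀ : M) (a b c : Eu 7), ContDiffOn ℝ ∞
    (fun y => metric.inner (chartPt x₀ y) (cross (chartPt x₀ y) (chartVec x₀ y a)
      (chartVec x₀ y b)) (chartVec x₀ y c)) (extChartAt 𝓘(ℝ, Eu 7) x₀).target
  form_parallel : ∀ (x₀ : M), ∀ y ∈ (extChartAt 𝓘(ℝ, Eu 7) x₀).target, ∀ v a b c : Eu 7,
    fderiv ℝ (fun y => metric.inner (chartPt x₀ y) (cross (chartPt x₀ y) (chartVec x₀ y a)
      (chartVec x₀ y b)) (chartVec x₀ y c)) y v =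
    metric.inner (chartPt x₀ y) (cross (chartPt x₀ y)
      (chartVec x₀ y (christoffel metric x₀ y v a)) (chartVec x₀ y b)) (chartVec x₀ y c) +
    metric.inner (chartPt x₀ y) (cross (chartPt x₀ y) (chartVec x₀ y a)
      (chartVec x₀ y (christoffel metric x₀ y v b))) (chartVec x₀ y c) +
    metric.inner (chartPt x₀ y) (cross (chartPt x₀ y) (chartVec x₀ y a) (chartVec x₀ y b))
      (chartVec x₀ y (christoffel metric x₀ y v c))

section Geometry

variable {M : Type*} [TopologicalSpace M] [ChartedSpace (Eu 7) M] [IsManifold 𝓘(ℝ, Eu 7) ∞ M]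
variable {C : Type*} [TopologicalSpace C] [ChartedSpace (Eu 4) C]
variable {S : Type*} [TopologicalSpace S] [ChartedSpace (Eu 2) S]

/-- The `G₂`-form `Ω(u, v, w) = g(u × v, w)`. -/
def G2Structure.form (G : G2Structure M) (x : M) (u v w : TS 7 x) : ℝ :=
  G.metric.inner x (G.cross x u v) w

/-- The vector-valued `3`-form `τ(u, v, w) = -u × (v × w) - g(u, v) w + g(u, w) v`. -/
def G2Structure.tau (G : G2Structure M) (x : M) (u v w : TS 7 x) : TS 7 x :=
  -G.cross x u (G.cross x v w) - G.metric.inner x u v • w + G.metric.inner x u w • v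

/-- A one-parameter family `φ : [0, ε₀] × C → M` of coassociative submanifolds
`C_t = φ({t} × C)` that is an embedding of `[0, ε₀] × C` (`C` is going to be compact) and whose
initial velocity `n = ∂φ/∂t |_{t = 0}` is normal to `C_0`; by the immersion condition `n` has no
zeros, i.e. the self-dual form `ι_n Ω` on `C_0` is nowhere vanishing. -/
structure CoassociativeFamily (G : G2Structure M) (C : Type*) [TopologicalSpace C]
    [ChartedSpace (Eu 4) C] (ε₀ : ℝ) where
  /-- the map `φ` -/
  map : ℝ × C → M
  smooth : ContMDiffOn (modelR 4) 𝓘(ℝ, Eu 7) ∞ map (Icc 0 ε₀ ×ˢ univ)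
  injOn : InjOn map (Icc 0 ε₀ ×ˢ univ)
  immersion : ∀ p ∈ (Icc 0 ε₀ ×ˢ univ : Set (ℝ × C)),
    Function.Injective (mfderivWithin (modelR 4) 𝓘(ℝ, Eu 7) map (Icc 0 ε₀ ×ˢ univ) p)
  coassociative : ∀ p ∈ (Icc 0 ε₀ ×ˢ univ : Set (ℝ × C)), ∀ a b c : TS 4 p.2,
    G.form (map p) (mfderivWithin (modelR 4) 𝓘(ℝ, Eu 7) map (Icc 0 ε₀ ×ˢ univ) p (tvec p 0 a))
      (mfderivWithin (modelR 4) 𝓘(ℝ, Eu 7) map (Icc 0 ε₀ ×ˢ univ) p (tvec p 0 b))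
      (mfderivWithin (modelR 4) 𝓘(ℝ, Eu 7) map (Icc 0 ε₀ ×ˢ univ) p (tvec p 0 c)) = 0
  velocity_normal : ∀ (c : C) (a : TS 4 c), G.metric.inner (map (0, c))
    (mfderivWithin (modelR 4) 𝓘(ℝ, Eu 7) map (Icc 0 ε₀ ×ˢ univ) (0, c) (tvec (0, c) 1 0))
    (mfderivWithin (modelR 4) 𝓘(ℝ, Eu 7) map (Icc 0 ε₀ ×ˢ univ) (0, c) (tvec (0, c) 0 a)) = 0

variable {G : G2Structure M} {ε₀ : ℝ}

/-- The differential of `φ`. -/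
def CoassociativeFamily.d (K : CoassociativeFamily G C ε₀) (p : ℝ × C) :
    TangentSpace (modelR 4) p →L[ℝ] TS 7 (K.map p) :=
  mfderivWithin (modelR 4) 𝓘(ℝ, Eu 7) K.map (Icc 0 ε₀ ×ˢ univ) p

/-- The velocity field `n = ∂φ/∂t |_{t = 0}` along `C_0`. -/
def CoassociativeFamily.n (K : CoassociativeFamily G C ε₀) (c : C) : TS 7 (K.map (0, c)) :=
  K.d (0, c) (tvec (0, c) 1 0)

/-- An embedded `J_n`-holomorphic curve in `C_0`: an embedding `ι : S → C` of a (compact)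
surface such that the image of each tangent space is preserved by `J_n u = |n|⁻¹ n × u`. -/
structure HolomorphicCurve (K : CoassociativeFamily G C ε₀) (S : Type*) [TopologicalSpace S]
    [ChartedSpace (Eu 2) S] where
  /-- the embedding of the surface into `C` -/
  emb : S → C
  smooth : ContMDiff 𝓘(ℝ, Eu 2) 𝓘(ℝ, Eu 4) ∞ emb
  injective : Function.Injective emb
  immersion : ∀ s, Function.Injective (mfderiv 𝓘(ℝ, Eu 2) 𝓘(ℝ, Eu 4) emb s)
  holomorphic : ∀ (s : S) (v : TS 2 s), ∃ w : TS 2 s,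
    (Real.sqrt (G.metric.inner _ (K.n (emb s)) (K.n (emb s))))⁻¹ •
      G.cross _ (K.n (emb s))
        (K.d (0, emb s) (tvec (0, emb s) 0 (mfderiv 𝓘(ℝ, Eu 2) 𝓘(ℝ, Eu 4) emb s v))) =
    K.d (0, emb s) (tvec (0, emb s) 0 (mfderiv 𝓘(ℝ, Eu 2) 𝓘(ℝ, Eu 4) emb s w))

/-- The image of `f : C → M` is totally geodesic for `h`: geodesics that start tangentially to it
stay in it for a short time. -/
def IsTotallyGeodesic (h : Metric7 M) (f : C → M) : Prop :=
  ∀ (γ : ℝ → M) (r : ℝ), 0 < r → IsGeodesicOn h γ (Ioo (-r) r) →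
    ∀ (c : C) (a : TS 4 c),
      HasInitial γ (Ioo (-r) r) (f c) (mfderiv 𝓘(ℝ, Eu 4) 𝓘(ℝ, Eu 7) f c a) →
      ∀ᶠ s in 𝓝 (0 : ℝ), γ s ∈ range f

/-- A family of smooth metrics `g_ε`, `0 ≤ ε ≤ ε₀`, for which `C_0` and `C_ε` are totally geodesic,
and which depends continuously on `ε` (with all derivatives in the space variables, locally
uniformly). -/
structure AdaptedMetrics (K : CoassociativeFamily G C ε₀) where
  /-- the metric `g_ε` -/
  metric : ℝ → Metric7 M
  continuousOn : ∀ (x₀ : M) (k : ℕ), ContinuousOn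
    (fun q : ℝ × Eu 7 => iteratedFDeriv ℝ k (chartMetric (metric q.1) x₀) q.2)
    (Icc 0 ε₀ ×ˢ (extChartAt 𝓘(ℝ, Eu 7) x₀).target)
  totallyGeodesic_zero : ∀ ε ∈ Ioc 0 ε₀,
    IsTotallyGeodesic (metric ε) (fun c => K.map (0, c))
  totallyGeodesic_eps : ∀ ε ∈ Ioc 0 ε₀,
    IsTotallyGeodesic (metric ε) (fun c => K.map (ε, c))

namespace HolomorphicCurve

variable {K : CoassociativeFamily G C ε₀} (J : HolomorphicCurve K S)

/-- The parametrization `(t, s) ↦ φ(t, s)` of the thin `3`-manifolds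
`A'_ε = φ([0, ε] × Σ)`, `ε ≤ ε₀`. -/
def thin (p : ℝ × S) : M := K.map (p.1, J.emb p.2)

/-- The differential of the parametrization of `A'_ε`. -/
def dthin (p : ℝ × S) : TangentSpace (modelR 2) p →L[ℝ] TS 7 (J.thin p) :=
  mfderivWithin (modelR 2) 𝓘(ℝ, Eu 7) J.thin (Icc 0 ε₀ ×ˢ univ) p

/-- A vector at `φ(p)` is normal to `A'_ε` (with respect to `g`). -/
def IsNormal (p : ℝ × S) (w : TS 7 (J.thin p)) : Prop :=
  ∀ a : TangentSpace (modelR 2) p, G.metric.inner (J.thin p) (J.dthin p a) w = 0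

/-- The orthogonal projection `T_p M → N_p` to the normal space of `A'_ε`. -/
def normalProj (p : ℝ × S) (X : TS 7 (J.thin p)) : TS 7 (J.thin p) :=
  Classical.epsilon fun w : TS 7 (J.thin p) =>
    J.IsNormal p w ∧ ∃ a : TangentSpace (modelR 2) p, X - w = J.dthin p a

/-- The basis `∂/∂t, ∂/∂x, ∂/∂y` of the tangent space of `ℝ × S` at `p`. -/
def basisVec (p : ℝ × S) (i : Fin 3) : TangentSpace (modelR 2) p :=
  ![tvec p 1 0, tvec p 0 (EuclideanSpace.single 0 1 : Eu 2),
    tvec p 0 (EuclideanSpace.single 1 1 : Eu 2)] i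

/-- The value at `basisVec p` of the volume form of `A'_ε` induced by `g`. The sign is that of
`Ω(n, ∂/∂x, ∂/∂y)` on `Σ`, i.e. `A'_ε` carries the orientation `dt ∧ (complex orientation)`. -/
def dvol (p : ℝ × S) : ℝ :=
  Real.sign (G.form (J.thin (0, p.2)) (J.dthin (0, p.2) (basisVec (0, p.2) 0))
      (J.dthin (0, p.2) (basisVec (0, p.2) 1)) (J.dthin (0, p.2) (basisVec (0, p.2) 2))) *
    Real.sqrt (Matrix.det (Matrix.of fun i j : Fin 3 => G.metric.inner (J.thin p)
      (J.dthin p (basisVec p i)) (J.dthin p (basisVec p j))))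

/-- A section of `TM` along the parametrization of `A'_ε`. -/
abbrev Field : Type _ := ∀ p : ℝ × S, TS 7 (J.thin p)

/-- The deformed map `exp^h V : (t, s) ↦ exp^h_{φ(t, s)} V(t, s)`. -/
def deform (h : Metric7 M) (V : J.Field) (p : ℝ × S) : M := expCurve h (J.thin p) (V p) 1

/-- The `TM`-valued `3`-form `T_V ∘ (exp^h V)^* τ` on `A'_ε`: the form part of `τ` is pulled back
by `exp^h V`, the vector part by the parallel transport for `g` along `r ↦ exp^h (r V)`. (The
curve `expCurve h (J.thin p) (V p)` starts at `J.thin p`.) -/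
def pullTau (h : Metric7 M) (ε : ℝ) (V : J.Field) (p : ℝ × S)
    (a b c : TangentSpace (modelR 2) p) : TS 7 (J.thin p) :=
  transportBack G.metric (expCurve h (J.thin p) (V p))
    (G.tau (J.deform h V p)
      (mfderivWithin (modelR 2) 𝓘(ℝ, Eu 7) (J.deform h V) (Icc 0 ε ×ˢ univ) p a)
      (mfderivWithin (modelR 2) 𝓘(ℝ, Eu 7) (J.deform h V) (Icc 0 ε ×ˢ univ) p b)
      (mfderivWithin (modelR 2) 𝓘(ℝ, Eu 7) (J.deform h V) (Icc 0 ε ×ˢ univ) p c))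

/-- The nonlinear map `F_ε(V) = * ∘ ⊥ ∘ (T_V ∘ (exp^h V)^* τ)`, with `h = g_ε`; here `⊥` is the
projection to the normal bundle and `*` the quotient by the volume form of `A'_ε`. -/
def F (h : Metric7 M) (ε : ℝ) (V : J.Field) : J.Field := fun p =>
  (J.dvol p)⁻¹ • J.normalProj p
    (J.pullTau h ε V p (basisVec p 0) (basisVec p 1) (basisVec p 2))

/-- The derivative `F_ε'(V₀) V = d/dr |_{r = 0} F_ε(V₀ + r V)`. -/
def F' (h : Metric7 M) (ε : ℝ) (V₀ V : J.Field) : J.Field := fun p =>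
  deriv (fun r : ℝ => J.F h ε (V₀ + r • V) p) 0

/-- `F_ε` is defined at `V`: the map `exp^h V` is defined and differentiable on `A'_ε`. -/
def InDomain (h : Metric7 M) (ε : ℝ) (V : J.Field) : Prop :=
  (∀ p ∈ (Icc 0 ε ×ˢ univ : Set (ℝ × S)), ExpDefined h (J.thin p) (V p)) ∧
    MDifferentiableOn (modelR 2) 𝓘(ℝ, Eu 7) (J.deform h V) (Icc 0 ε ×ˢ univ)

/-- The data used to define Hölder norms uniformly in `ε`: finitely many coordinate discs which
cover `Σ`, and over `[0, ε₀] ×` each of them a smooth orthonormal frame of the normal bundle. -/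
structure HolderCharts where
  /-- the number of charts -/
  num : ℕ
  /-- the charts of the surface -/
  chart : Fin num → OpenPartialHomeomorph S (Eu 2)
  chart_mem : ∀ i, chart i ∈ IsManifold.maximalAtlas 𝓘(ℝ, Eu 2) ∞ S
  /-- the centre of the coordinate disc -/
  center : Fin num → Eu 2
  /-- the radius of the coordinate disc -/
  radius : Fin num → ℝ
  radius_pos : ∀ i, 0 < radius i
  disc_subset : ∀ i, Metric.closedBall (center i) (radius i) ⊆ (chart i).target
  cover : ∀ s : S, ∃ i, s ∈ (chart i).source ∧ chart i s ∈ Metric.ball (center i) (radius i)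
  /-- the frames of the normal bundle -/
  frame : Fin num → Fin 4 → J.Field
  frame_smooth : ∀ i a, ContMDiffOn (modelR 2) (𝓘(ℝ, Eu 7)).tangent ∞
    (fun p : ℝ × S => (⟨J.thin p, frame i a p⟩ : TangentBundle 𝓘(ℝ, Eu 7) M))
    (Icc 0 ε₀ ×ˢ (chart i).source)
  frame_normal : ∀ i a, ∀ p ∈ Icc 0 ε₀ ×ˢ (chart i).source, J.IsNormal p (frame i a p)
  frame_orthonormal : ∀ i a b, ∀ p ∈ Icc 0 ε₀ ×ˢ (chart i).source,
    G.metric.inner (J.thin p) (frame i a p) (frame i b p) = if a = b then 1 else 0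

end HolomorphicCurve

/-- The norm of `C^α(D)`: `sup |f| + [f]_α`. -/
def holderNorm {X Y : Type*} [NormedAddCommGroup X] [NormedAddCommGroup Y]
    (α : ℝ≥0) (D : Set X) (f : X → Y) : ℝ≥0∞ :=
  (⨆ x ∈ D, ‖f x‖ₑ) + eHolderNorm α (D.domRestrict f)

/-- The norm of `C^{1,α}(D)`: `sup |f| + sup |∇f| + [∇f]_α`. -/
def holderNormOne {X Y : Type*} [NormedAddCommGroup X] [NormedSpace ℝ X]
    [NormedAddCommGroup Y] [NormedSpace ℝ Y] (α : ℝ≥0) (D : Set X) (f : X → Y) : ℝ≥0∞ :=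
  (⨆ x ∈ D, ‖f x‖ₑ) + holderNorm α D (fderivWithin ℝ f D)

namespace HolomorphicCurve.HolderCharts

variable {K : CoassociativeFamily G C ε₀} {J : HolomorphicCurve K S} (H : J.HolderCharts)

/-- The `i`-th coordinate patch `[0, ε] × disc` of `A'_ε`. -/
def patch (ε : ℝ) (i : Fin H.num) : Set (ℝ × Eu 2) :=
  Icc 0 ε ×ˢ Metric.closedBall (H.center i) (H.radius i)

/-- The components of a section of the normal bundle in the `i`-th frame, as functions of the
coordinates. -/
def local_ (i : Fin H.num) (V : J.Field) (q : ℝ × Eu 2) : Eu 4 :=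
  WithLp.toLp 2 fun a => G.metric.inner (J.thin (q.1, (H.chart i).symm q.2))
    (V (q.1, (H.chart i).symm q.2)) (H.frame i a (q.1, (H.chart i).symm q.2))

/-- The norm of `C^α(A'_ε, N)`. -/
def norm (α : ℝ≥0) (ε : ℝ) (V : J.Field) : ℝ≥0∞ :=
  ⨆ i, holderNorm α (H.patch ε i) (H.local_ i V)

/-- The norm of `C^{1,α}(A'_ε, N)`. -/
def normOne (α : ℝ≥0) (ε : ℝ) (V : J.Field) : ℝ≥0∞ :=
  ⨆ i, holderNormOne α (H.patch ε i) (H.local_ i V)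

/-- `V` is a section of class `C^{1,α}` of the normal bundle of `A'_ε`. -/
def IsSection (α : ℝ≥0) (ε : ℝ) (V : J.Field) : Prop :=
  (∀ p ∈ (Icc 0 ε ×ˢ univ : Set (ℝ × S)), J.IsNormal p (V p)) ∧
    (∀ i, ContDiffOn ℝ 1 (H.local_ i V) (H.patch ε i)) ∧ H.normOne α ε V < ⊤

end HolomorphicCurve.HolderCharts

end Geometry

end ThinInstanton

end

/-!
In coordinates, `F_ε(V)` at a point is a smooth function of the `1`-jet of `V` at that point, of the
coefficients of the geometry (the position, the frame of the normal bundle, their derivatives and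
the volume form) and of the metric `g_ε`. The difference `F_ε'(V₀) V - F_ε'(0) V` is thus the
increment of the derivative of such a function in the jet variable, which vanishes to first order
in `V₀` and is linear in `V`, and the estimate is the usual one for the composition of smooth
functions with Hölder functions. The point is the uniformity in `ε`, both for the domain
`[0, ε] × Σ` and for the metrics `g_ε`, which depend only continuously on `ε`.

The metrics are treated by considering functions of the parameter as values: `exists_exp_family`
says that near a point the exponential maps of all `g_ε`, and the `g`-parallel transports along
their geodesics, are the values of smooth functions of position and velocity in the Banach space
`C([0, ε₀], ·)`. The coupled differential equations for geodesics and parallel transport are solved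
as an integral equation by the inverse function theorem in a space of continuous functions of
`(ε, t)` (`exists_solution_near_const`); superposition with a continuous family of smooth functions
is a smooth operator there (`SmoothFamily.contDiffOn_superpose`). At zero velocity the linearized
vector field has square zero, so the linearized integral equation is inverted explicitly. Geodesics
are unique in a Hausdorff manifold, so the solutions are the curves `expCurve` and the parallel
fields of the definitions (`expCurve_eq_of_chart`, `comps_transportBack`).

This leads to `exists_local_formula`: near every point of a coordinate strip the components of
`F_ε(V)` are `Ψ(κ(q), j¹V(q))(ε)`, with `Ψ` smooth and with values in `C([0, ε₀], ℝ⁴)`, and with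
`κ` smooth on `[0, ε₀] × disc` and independent of `ε`. Here the volume form has no zeros, because `Ω`
does not vanish on `T_pA'_ε` along `Σ` by holomorphicity (`form_ne_zero`).

The second order estimate for `Ψ` (`exists_derivIncr_bound`) then gives the bound near each point
(`exists_local_estimate`), and compactness of the largest patches `[0, ε₀] × disc` gives a common
constant: points closer than a Lebesgue number lie in one of finitely many good neighbourhoods, and
for the others the supremum bound suffices (`exists_patch_estimate`). That the discs are closed does
no harm: sections are differentiable up to the boundary of a disc within the strip, by means of a
disc that contains the point in its interior (`IsC1Section.differentiableWithinAt_local`).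
-/

open Set Filter Topology Manifold
open scoped ContDiff ENNReal NNReal

noncomputable section

namespace ThinInstanton

set_option maxSynthPendingDepth 3
set_option linter.unusedSectionVars false

/-! ### Superposition operators on spaces of continuous functions -/

section Superposition

variable {K : Type*} [TopologicalSpace K]

/-- A family of smooth functions on `U`, parametrized by a topological space, all of whose
derivatives are jointly continuous. -/
structure SmoothFamily {E F : Type*} [NormedAddCommGroup E] [NormedSpace ℝ E]
    [NormedAddCommGroup F] [NormedSpace ℝ F] (f : K → E → F) (U : Set E) : Prop where
  contDiffOn : ∀ k, ContDiffOn ℝ ∞ (f k) U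
  continuousOn : ∀ j : ℕ,
    ContinuousOn (fun p : K × E => iteratedFDeriv ℝ j (f p.1) p.2) (univ ×ˢ U)

/-- The superposition operator `u ↦ (k ↦ f k (u k))` on `C(K, E)`, with the value `0` where
the right-hand side is not continuous. -/
def superpose {E F : Type*} [TopologicalSpace E] [TopologicalSpace F] [Zero F]
    (f : K → E → F) (u : C(K, E)) : C(K, F) :=
  open Classical in if h : Continuous fun k => f k (u k) then ⟨_, h⟩ else 0

variable {E : Type*} [NormedAddCommGroup E] [NormedSpace ℝ E]
variable {F : Type*} [NormedAddCommGroup F] [NormedSpace ℝ F]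

theorem SmoothFamily.of_contDiffOn {f : E → F} {U : Set E} (hU : IsOpen U)
    (hf : ContDiffOn ℝ ∞ f U) : SmoothFamily (fun _ : K => f) U where
  contDiffOn _ := hf
  continuousOn j := by
    have h : ContinuousOn (iteratedFDeriv ℝ j f) U :=
      (hf.continuousOn_iteratedFDerivWithin (m := j) (by exact_mod_cast le_top)
        hU.uniqueDiffOn).congr fun x hx => (iteratedFDerivWithin_of_isOpen j hU hx).symm
    exact h.comp continuousOn_snd fun p hp => hp.2

theorem SmoothFamily.comp_left {K' : Type*} [TopologicalSpace K'] {f : K → E → F} {U : Set E}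
    (hf : SmoothFamily f U) {r : K' → K} (hr : Continuous r) :
    SmoothFamily (fun k => f (r k)) U where
  contDiffOn k := hf.contDiffOn (r k)
  continuousOn j := (hf.continuousOn j).comp (f := fun p : K' × E => (r p.1, p.2))
    (by fun_prop) fun p hp => ⟨mem_univ _, hp.2⟩

theorem SmoothFamily.fderiv {f : K → E → F} {U : Set E} (hf : SmoothFamily f U)
    (hU : IsOpen U) : SmoothFamily (fun k => fderiv ℝ (f k)) U where
  contDiffOn k := (hf.contDiffOn k).fderiv_of_isOpen hU (by simp)
  continuousOn j := by
    have h := (continuousMultilinearCurryRightEquiv' ℝ j E F).continuous.comp_continuousOn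
      (hf.continuousOn (j + 1))
    refine h.congr fun p _ => ?_
    simp [iteratedFDeriv_succ_eq_comp_right]

theorem SmoothFamily.continuousOn_uncurry {f : K → E → F} {U : Set E} (hf : SmoothFamily f U) :
    ContinuousOn (fun p : K × E => f p.1 p.2) (univ ×ˢ U) := by
  have h := (continuousMultilinearCurryFin0 ℝ E F).continuous.comp_continuousOn
    (hf.continuousOn 0)
  refine h.congr fun p _ => ?_
  simp [iteratedFDeriv_zero_eq_comp]

theorem SmoothFamily.superpose_apply {f : K → E → F} {U : Set E} (hf : SmoothFamily f U)
    {u : C(K, E)} (hu : MapsTo u univ U) (k : K) : superpose f u k = f k (u k) := by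
  have h : Continuous fun k => f k (u k) := continuousOn_univ.1
    (hf.continuousOn_uncurry.comp (f := fun k => (k, u k)) (by fun_prop)
      fun k _ => ⟨mem_univ _, hu (mem_univ k)⟩)
  simp [superpose, h]

variable [CompactSpace K]

omit [NormedSpace ℝ E] in
theorem isOpen_mapsTo_univ {U : Set E} (hU : IsOpen U) :
    IsOpen {u : C(K, E) | MapsTo u univ U} :=
  ContinuousMap.isOpen_setOfPred_mapsTo isCompact_univ hU

/-- Pointwise application of a continuous family of linear maps. -/
def pointwiseApply : C(K, E →L[ℝ] F) →L[ℝ] C(K, E) →L[ℝ] C(K, F) :=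
  LinearMap.mkContinuous₂
    (LinearMap.mk₂ ℝ (fun (A : C(K, E →L[ℝ] F)) (h : C(K, E)) =>
      (⟨fun k => A k (h k), by fun_prop⟩ : C(K, F)))
      (fun A B h => by ext; simp) (fun c A h => by ext; simp)
      (fun A h h' => by ext; simp) (fun c A h => by ext; simp)) 1
    (fun A h => by
      rw [one_mul]
      refine (ContinuousMap.norm_le _ (by positivity)).2 fun k => ?_
      exact ((A k).le_opNorm (h k)).trans (mul_le_mul (A.norm_coe_le_norm k)
        (h.norm_coe_le_norm k) (norm_nonneg _) (norm_nonneg A)))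

@[simp]
theorem pointwiseApply_apply (A : C(K, E →L[ℝ] F)) (h : C(K, E)) (k : K) :
    pointwiseApply A h k = A k (h k) := rfl

variable [LocallyCompactSpace K]

omit [CompactSpace K] in
theorem SmoothFamily.continuousOn_superpose {f : K → E → F} {U : Set E}
    (hf : SmoothFamily f U) : ContinuousOn (superpose f) {u : C(K, E) | MapsTo u univ U} := by
  rw [continuousOn_iff_continuous_domRestrict]
  refine ContinuousMap.continuous_of_continuous_uncurry _ ?_
  have h : Continuous fun p : {u : C(K, E) | MapsTo u univ U} × K => f p.2 (p.1.1 p.2) := by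
    refine continuousOn_univ.1 (hf.continuousOn_uncurry.comp
      (f := fun p : {u : C(K, E) | MapsTo u univ U} × K => (p.2, p.1.1 p.2)) ?_
      fun p _ => ⟨mem_univ _, p.1.2 (mem_univ _)⟩)
    fun_prop
  refine h.congr fun p => ?_
  exact (hf.superpose_apply p.1.2 p.2).symm

theorem SmoothFamily.hasFDerivAt_superpose {f : K → E → F} {U : Set E} (hU : IsOpen U)
    (hf : SmoothFamily f U) {u : C(K, E)} (hu : MapsTo u univ U) :
    HasFDerivAt (superpose f) (pointwiseApply (superpose (fun k => _root_.fderiv ℝ (f k)) u)) u := by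
  have hf' := hf.fderiv hU
  have hcont := (hf'.continuousOn_superpose).continuousAt ((isOpen_mapsTo_univ hU).mem_nhds hu)
  rw [hasFDerivAt_iff_isLittleO_nhds_zero, Asymptotics.isLittleO_iff]
  intro c hc
  obtain ⟨δ, hδ, h1⟩ := Metric.continuousAt_iff.1 hcont c hc
  obtain ⟨δ', hδ', h2⟩ := Metric.isOpen_iff.1 (isOpen_mapsTo_univ (K := K) hU) u hu
  refine Metric.eventually_nhds_iff.2 ⟨min δ δ', lt_min hδ hδ', fun h hh => ?_⟩
  rw [dist_zero_right] at hh
  -- The remainder is estimated at every point of `K` by the mean value inequality on a segment,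
  -- where the derivatives are uniformly close to those at `u`.
  have hseg : ∀ s ∈ Icc (0 : ℝ) 1, dist (u + s • h) u < min δ δ' := by
    intro s hs
    rw [dist_eq_norm, add_sub_cancel_left, norm_smul, Real.norm_of_nonneg hs.1]
    exact (mul_le_of_le_one_left (norm_nonneg _) hs.2).trans_lt hh
  have hU' : ∀ s ∈ Icc (0 : ℝ) 1, MapsTo (u + s • h) univ U := fun s hs =>
    h2 ((hseg s hs).trans_le (min_le_right _ _))
  have hb : ∀ s ∈ Icc (0 : ℝ) 1, ∀ k,
      ‖_root_.fderiv ℝ (f k) (u k + s • h k) - _root_.fderiv ℝ (f k) (u k)‖ ≤ c := by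
    intro s hs k
    have h3 := (h1 ((hseg s hs).trans_le (min_le_left _ _))).le
    have h4 := (ContinuousMap.dist_le hc.le).1 h3 k
    rw [hf'.superpose_apply (hU' s hs), hf'.superpose_apply hu, dist_eq_norm] at h4
    exact h4
  refine (ContinuousMap.norm_le _ (by positivity)).2 fun k => ?_
  have hu1 : MapsTo (u + h) univ U := by simpa using hU' 1 (by simp)
  simp only [ContinuousMap.sub_apply, pointwiseApply_apply, hf.superpose_apply hu1,
    hf.superpose_apply hu, hf'.superpose_apply hu, ContinuousMap.add_apply]
  have hmv := (convex_segment (𝕜 := ℝ) (u k) (u k + h k)).norm_image_sub_le_of_norm_hasFDerivWithin_le'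
    (f := f k) (f' := _root_.fderiv ℝ (f k)) (φ := _root_.fderiv ℝ (f k) (u k)) (C := c)
    (x := u k) (y := u k + h k) ?_ ?_ (left_mem_segment ℝ _ _) (right_mem_segment ℝ _ _)
  · rw [add_sub_cancel_left] at hmv
    exact hmv.trans (by gcongr; exact h.norm_coe_le_norm k)
  · intro x hx
    rw [segment_eq_image'] at hx
    obtain ⟨s, hs, rfl⟩ := hx
    rw [add_sub_cancel_left]
    have : u k + s • h k ∈ U := hU' s hs (mem_univ k)
    exact (((hf.contDiffOn k).contDiffAt (hU.mem_nhds this)).differentiableAt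
      (by simp)).hasFDerivAt.hasFDerivWithinAt
  · intro x hx
    rw [segment_eq_image'] at hx
    obtain ⟨s, hs, rfl⟩ := hx
    rw [add_sub_cancel_left]
    exact hb s hs k

end Superposition

section SuperpositionSmooth

universe u

variable {K : Type*} [TopologicalSpace K] [CompactSpace K] [LocallyCompactSpace K]
variable {E : Type u} [NormedAddCommGroup E] [NormedSpace ℝ E]

theorem SmoothFamily.contDiffOn_superpose_nat (n : ℕ) :
    ∀ {F : Type u} [NormedAddCommGroup F] [NormedSpace ℝ F] {f : K → E → F} {U : Set E},
      IsOpen U → SmoothFamily f U →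
      ContDiffOn ℝ n (superpose f) {u : C(K, E) | MapsTo u univ U} := by
  induction n with
  | zero =>
    intro F _ _ f U hU hf
    simpa using hf.continuousOn_superpose
  | succ n ih =>
    intro F _ _ f U hU hf
    have h := ih hU (hf.fderiv hU)
    rw [show ((n + 1 : ℕ) : ℕ∞ω) = (n : ℕ∞ω) + 1 by push_cast; rfl,
      contDiffOn_succ_iff_fderiv_of_isOpen (isOpen_mapsTo_univ hU)]
    refine ⟨fun u hu => (hf.hasFDerivAt_superpose hU hu).differentiableAt.differentiableWithinAt,
      by simp, ?_⟩
    refine ((pointwiseApply (K := K) (E := E) (F := F) :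
      C(K, E →L[ℝ] F) →L[ℝ] C(K, E) →L[ℝ] C(K, F)).contDiff.comp_contDiffOn h).congr fun u hu => ?_
    exact (hf.hasFDerivAt_superpose hU hu).fderiv

/-- The superposition operator of a smooth family is smooth: its derivative is the superposition
operator of the derivatives, followed by pointwise application. -/
theorem SmoothFamily.contDiffOn_superpose {F : Type u} [NormedAddCommGroup F] [NormedSpace ℝ F]
    {f : K → E → F} {U : Set E} (hU : IsOpen U) (hf : SmoothFamily f U) :
    ContDiffOn ℝ ∞ (superpose f) {u : C(K, E) | MapsTo u univ U} :=
  contDiffOn_infty.2 fun n => hf.contDiffOn_superpose_nat n hU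

theorem SmoothFamily.contDiffAt_superpose {F : Type u} [NormedAddCommGroup F] [NormedSpace ℝ F]
    {f : K → E → F} {U : Set E} (hU : IsOpen U) (hf : SmoothFamily f U) {u : C(K, E)}
    (hu : MapsTo u univ U) : ContDiffAt ℝ ∞ (superpose f) u :=
  (hf.contDiffOn_superpose hU).contDiffAt ((isOpen_mapsTo_univ hU).mem_nhds hu)

end SuperpositionSmooth

section Pairing

variable {K : Type*} [TopologicalSpace K]
variable {E : Type*} [NormedAddCommGroup E] [NormedSpace ℝ E]
variable {F : Type*} [NormedAddCommGroup F] [NormedSpace ℝ F]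

/-- The pairing `C(K, E) × C(K, F) → C(K, E × F)`, as a linear map. -/
def pairCLM : C(K, E) × C(K, F) →L[ℝ] C(K, E × F) :=
  ((ContinuousLinearMap.inl ℝ E F).compLeftContinuous ℝ K).coprod
    ((ContinuousLinearMap.inr ℝ E F).compLeftContinuous ℝ K)

@[simp]
theorem pairCLM_apply (u : C(K, E) × C(K, F)) (k : K) : pairCLM u k = (u.1 k, u.2 k) := by
  simp [pairCLM]

theorem contDiffAt_pairCLM {X : Type*} [NormedAddCommGroup X] [NormedSpace ℝ X] [CompactSpace K]
    {f : X → C(K, E)} {g : X → C(K, F)} {x : X} (hf : ContDiffAt ℝ ∞ f x)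
    (hg : ContDiffAt ℝ ∞ g x) : ContDiffAt ℝ ∞ (fun x => pairCLM (f x, g x)) x :=
  (pairCLM (K := K) (E := E) (F := F)).contDiff.contDiffAt.comp x (hf.prodMk hg)

end Pairing

/-! ### Ordinary differential equations near a constant solution -/

section ODE

variable {Λ : Type*} [TopologicalSpace Λ] [CompactSpace Λ]
variable {Z : Type*} [NormedAddCommGroup Z] [NormedSpace ℝ Z]

/-- Integration from `0` in the second variable. -/
def primitive : C(Λ × Icc (0 : ℝ) 1, Z) →L[ℝ] C(Λ × Icc (0 : ℝ) 1, Z) :=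
  LinearMap.mkContinuous
    { toFun := fun u => ⟨fun p => ∫ s in (0 : ℝ)..p.2, u (p.1, projIcc 0 1 zero_le_one s), by
        have h := intervalIntegral.continuous_parametric_intervalIntegral_of_continuous
          (μ := MeasureTheory.volume) (a₀ := (0 : ℝ))
          (f := fun (p : Λ × Icc (0 : ℝ) 1) s => u (p.1, projIcc 0 1 zero_le_one s))
          (s := fun p => (p.2 : ℝ))
          (by unfold Function.uncurry; fun_prop) (by fun_prop)
        exact h⟩
      map_add' := fun u v => by
        ext p
        exact intervalIntegral.integral_add
          (Continuous.intervalIntegrable (by fun_prop) _ _)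
          (Continuous.intervalIntegrable (by fun_prop) _ _)
      map_smul' := fun c u => by
        ext p
        exact intervalIntegral.integral_smul c _ } 1
    (fun u => by
      rw [one_mul]
      refine (ContinuousMap.norm_le _ (norm_nonneg _)).2 fun p => ?_
      have h := intervalIntegral.norm_integral_le_of_norm_le_const (a := (0 : ℝ)) (b := p.2)
        (C := ‖u‖) (f := fun s => u (p.1, projIcc 0 1 zero_le_one s))
        (fun s _ => u.norm_coe_le_norm _)
      refine h.trans ?_
      rw [sub_zero, abs_of_nonneg p.2.2.1]
      exact mul_le_of_le_one_right (norm_nonneg _) p.2.2.2)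

theorem primitive_apply (u : C(Λ × Icc (0 : ℝ) 1, Z)) (l : Λ) (t : Icc (0 : ℝ) 1) :
    primitive u (l, t) = ∫ s in (0 : ℝ)..t, u (l, projIcc 0 1 zero_le_one s) := rfl

theorem hasDerivWithinAt_primitive [CompleteSpace Z] (u : C(Λ × Icc (0 : ℝ) 1, Z)) (l : Λ) {t : ℝ}
    (ht : t ∈ Icc (0 : ℝ) 1) :
    HasDerivWithinAt (fun s => primitive u (l, projIcc 0 1 zero_le_one s)) (u (l, ⟨t, ht⟩))
      (Icc 0 1) t := by
  have hc : Continuous fun s : ℝ => u (l, projIcc 0 1 zero_le_one s) := by fun_prop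
  have h := (hc.integral_hasStrictDerivAt 0 t).hasDerivAt.hasDerivWithinAt (s := Icc 0 1)
  rw [projIcc_of_mem zero_le_one ht] at h
  refine h.congr (fun s hs => ?_) ?_
  · rw [projIcc_of_mem zero_le_one hs]; rfl
  · rw [projIcc_of_mem zero_le_one ht]; rfl

theorem primitive_compLeft [CompleteSpace Z] (A : Z →L[ℝ] Z) (u : C(Λ × Icc (0 : ℝ) 1, Z)) :
    primitive (A.compLeftContinuous ℝ _ u) = A.compLeftContinuous ℝ _ (primitive u) := by
  ext p
  exact A.intervalIntegral_comp_comm (Continuous.intervalIntegrable (by fun_prop) _ _)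

/-- Smooth dependence of solutions on initial values near a constant solution `z₀`, when the
linearization `A` of the vector field at `z₀` has square zero. The integral equation is solved with
the inverse function theorem on the space of continuous functions of `(λ, t)`, where its
linearization `1 - ∫ A` has the inverse `1 + ∫ A`; the parameter `λ` of the vector field is one more
variable of the unknown function, so all bounds are uniform in it. -/
theorem exists_solution_near_const [CompleteSpace Z]
    {N : C(Λ × Icc (0 : ℝ) 1, Z) → C(Λ × Icc (0 : ℝ) 1, Z)} {z₀ : Z} {A : Z →L[ℝ] Z}
    (hN : ContDiffAt ℝ ∞ N (ContinuousMap.const _ z₀))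
    (hN0 : N (ContinuousMap.const _ z₀) = 0)
    (hN' : fderiv ℝ N (ContinuousMap.const _ z₀) = A.compLeftContinuous ℝ _)
    (hA : ∀ z, A (A z) = 0) :
    ∃ u : Z → C(Λ × Icc (0 : ℝ) 1, Z), ContDiffAt ℝ ∞ u z₀ ∧
      u z₀ = ContinuousMap.const _ z₀ ∧
      ∀ᶠ z in 𝓝 z₀, u z = ContinuousMap.const _ z + primitive (N (u z)) := by
  set c : Z →L[ℝ] C(Λ × Icc (0 : ℝ) 1, Z) := ContinuousLinearMap.const ℝ _ with hc
  set L : C(Λ × Icc (0 : ℝ) 1, Z) →L[ℝ] C(Λ × Icc (0 : ℝ) 1, Z) :=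
    primitive ∘L A.compLeftContinuous ℝ _ with hL
  have hLL : ∀ u, L (L u) = 0 := by
    intro u
    simp only [hL, ContinuousLinearMap.comp_apply]
    rw [← primitive_compLeft]
    have : A.compLeftContinuous ℝ (Λ × Icc (0 : ℝ) 1) (A.compLeftContinuous ℝ _ u) = 0 := by
      ext p; exact hA _
    rw [this, map_zero, map_zero]
  let e : C(Λ × Icc (0 : ℝ) 1, Z) ≃L[ℝ] C(Λ × Icc (0 : ℝ) 1, Z) :=
    ContinuousLinearEquiv.equivOfInverse (ContinuousLinearMap.id ℝ _ - L)
      (ContinuousLinearMap.id ℝ _ + L)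
      (fun u => by simp [hLL]) (fun u => by simp [hLL])
  let Φ : C(Λ × Icc (0 : ℝ) 1, Z) → C(Λ × Icc (0 : ℝ) 1, Z) := fun u => u - primitive (N u)
  have hΦ : ContDiffAt ℝ ∞ Φ (c z₀) :=
    contDiffAt_id.sub ((primitive (Λ := Λ) (Z := Z)).contDiff.contDiffAt.comp (c z₀) hN)
  have hΦ' : HasFDerivAt Φ (e : C(Λ × Icc (0 : ℝ) 1, Z) →L[ℝ] C(Λ × Icc (0 : ℝ) 1, Z)) (c z₀) := by
    have h := (hN.differentiableAt (by simp)).hasFDerivAt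
    rw [hN'] at h
    exact (hasFDerivAt_id _).sub ((primitive (Λ := Λ) (Z := Z)).hasFDerivAt.comp (c z₀) h)
  have hn : (∞ : ℕ∞ω) ≠ 0 := by simp
  have hΦ0 : Φ (c z₀) = c z₀ := by
    have : N (c z₀) = 0 := hN0
    simp [Φ, this]
  refine ⟨fun z => hΦ.localInverse hΦ' hn (c z), ?_, ?_, ?_⟩
  · have h := hΦ.to_localInverse hΦ' hn
    rw [hΦ0] at h
    exact h.comp z₀ c.contDiff.contDiffAt
  · have h := hΦ.localInverse_apply_image hΦ' hn
    rw [hΦ0] at h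
    exact h
  · have h := (hΦ.hasStrictFDerivAt' hΦ' hn).eventually_right_inverse
    rw [hΦ0] at h
    have h2 := c.continuous.continuousAt.eventually h
    filter_upwards [h2] with z hz
    have : Φ (hΦ.localInverse hΦ' hn (c z)) = c z := hz
    simp only [Φ] at this
    exact (sub_eq_iff_eq_add.1 this)

end ODE

/-! ### Tangent vectors and metrics in a chart -/

section Chart

variable {M : Type*} [TopologicalSpace M] [ChartedSpace (Eu 7) M]

/-- The chart around `x₀`, as a map to `ℝ⁷`. -/
abbrev cmap (x₀ : M) : M → Eu 7 := extChartAt 𝓘(ℝ, Eu 7) x₀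

/-- The domain of the chart around `x₀`. -/
abbrev csource (x₀ : M) : Set M := (chartAt (Eu 7) x₀).source

/-- The image of the chart around `x₀`. -/
abbrev ctarget (x₀ : M) : Set (Eu 7) := (extChartAt 𝓘(ℝ, Eu 7) x₀).target

theorem isOpen_ctarget (x₀ : M) : IsOpen (ctarget x₀) := isOpen_extChartAt_target x₀

theorem chartPt_mem {x₀ : M} {y : Eu 7} (hy : y ∈ ctarget x₀) : chartPt x₀ y ∈ csource x₀ := by
  rw [csource, ← extChartAt_source 𝓘(ℝ, Eu 7)]
  exact (extChartAt 𝓘(ℝ, Eu 7) x₀).map_target hy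

theorem cmap_mem {x₀ x : M} (hx : x ∈ csource x₀) : cmap x₀ x ∈ ctarget x₀ := by
  rw [csource, ← extChartAt_source 𝓘(ℝ, Eu 7)] at hx
  exact (extChartAt 𝓘(ℝ, Eu 7) x₀).map_source hx

theorem cmap_chartPt {x₀ : M} {y : Eu 7} (hy : y ∈ ctarget x₀) : cmap x₀ (chartPt x₀ y) = y :=
  (extChartAt 𝓘(ℝ, Eu 7) x₀).right_inv hy

theorem chartPt_cmap {x₀ x : M} (hx : x ∈ csource x₀) : chartPt x₀ (cmap x₀ x) = x := by
  rw [csource, ← extChartAt_source 𝓘(ℝ, Eu 7)] at hx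
  exact (extChartAt 𝓘(ℝ, Eu 7) x₀).left_inv hx

theorem continuousOn_chartPt (x₀ : M) : ContinuousOn (chartPt x₀) (ctarget x₀) :=
  continuousOn_extChartAt_symm x₀

variable [IsManifold 𝓘(ℝ, Eu 7) ∞ M]

/-- The tangent vector at `x` with components `v` in the chart around `x₀`. -/
def ofComps (x₀ x : M) (v : Eu 7) : TS 7 x := tangentCoordChange 𝓘(ℝ, Eu 7) x₀ x x v

/-- `comps x₀` as a linear map. -/
def compsL (x₀ x : M) : TS 7 x →L[ℝ] Eu 7 := tangentCoordChange 𝓘(ℝ, Eu 7) x x₀ x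

theorem compsL_apply (x₀ x : M) (v : TS 7 x) : compsL x₀ x v = comps x₀ v := rfl

theorem comps_ofComps {x₀ x : M} (hx : x ∈ csource x₀) (v : Eu 7) :
    comps x₀ (ofComps x₀ x v) = v := by
  have h : x ∈ (extChartAt 𝓘(ℝ, Eu 7) x₀).source := by rwa [extChartAt_source]
  unfold comps ofComps
  rw [tangentCoordChange_comp ⟨⟨h, mem_extChartAt_source x⟩, h⟩, tangentCoordChange_self h]

theorem ofComps_comps {x₀ x : M} (hx : x ∈ csource x₀) (v : TS 7 x) :
    ofComps x₀ x (comps x₀ v) = v := by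
  have h : x ∈ (extChartAt 𝓘(ℝ, Eu 7) x₀).source := by rwa [extChartAt_source]
  unfold comps ofComps
  exact (tangentCoordChange_comp ⟨⟨mem_extChartAt_source x, h⟩, mem_extChartAt_source x⟩).trans
    (tangentCoordChange_self (mem_extChartAt_source x))

theorem comps_injective {x₀ x : M} (hx : x ∈ csource x₀) :
    Function.Injective (fun v : TS 7 x => comps x₀ v) :=
  Function.LeftInverse.injective (g := ofComps x₀ x) (ofComps_comps hx)

theorem comps_add (x₀ : M) {x : M} (v w : TS 7 x) :
    comps x₀ (v + w) = comps x₀ v + comps x₀ w := (compsL x₀ x).map_add v w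

theorem comps_smul (x₀ : M) {x : M} (c : ℝ) (v : TS 7 x) :
    comps x₀ (c • v) = c • comps x₀ v := (compsL x₀ x).map_smul c v

theorem comps_sum (x₀ : M) {x : M} {ι : Type*} (s : Finset ι) (v : ι → TS 7 x) :
    comps x₀ (∑ i ∈ s, v i) = ∑ i ∈ s, comps x₀ (v i) := map_sum (compsL x₀ x) v s

theorem chartMetric_apply (g : Metric7 M) (x₀ : M) (y a b : Eu 7) :
    chartMetric g x₀ y a b =
      g.inner (chartPt x₀ y) (ofComps x₀ (chartPt x₀ y) a) (ofComps x₀ (chartPt x₀ y) b) := rfl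

theorem inner_eq_chartMetric (g : Metric7 M) {x₀ x : M} (hx : x ∈ csource x₀) (v w : TS 7 x) :
    g.inner x v w = chartMetric g x₀ (cmap x₀ x) (comps x₀ v) (comps x₀ w) := by
  have key : ∀ z, z = x → g.inner z (ofComps x₀ z (comps x₀ v)) (ofComps x₀ z (comps x₀ w)) =
      g.inner x v w := by
    rintro _ rfl
    rw [ofComps_comps hx, ofComps_comps hx]
  rw [chartMetric_apply, key _ (chartPt_cmap hx)]

theorem chartMetric_symm (g : Metric7 M) (x₀ : M) (y a b : Eu 7) :
    chartMetric g x₀ y a b = chartMetric g x₀ y b a := g.symm _ _ _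

theorem chartMetric_pos (g : Metric7 M) {x₀ : M} {y : Eu 7} (hy : y ∈ ctarget x₀) {a : Eu 7}
    (ha : a ≠ 0) : 0 < chartMetric g x₀ y a a := by
  refine g.pos _ _ fun h => ha ?_
  rw [← comps_ofComps (chartPt_mem hy) a]
  have h' : ofComps x₀ (chartPt x₀ y) a = 0 := h
  rw [h', ← compsL_apply, map_zero]

theorem contMDiffOn_frame (x₀ : M) (v : Eu 7) :
    ContMDiffOn 𝓘(ℝ, Eu 7) (𝓘(ℝ, Eu 7)).tangent ∞
      (fun x : M => (⟨x, ofComps x₀ x v⟩ : TangentBundle 𝓘(ℝ, Eu 7) M)) (csource x₀) := by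
  refine (Bundle.Trivialization.contMDiffOn_iff (IB := 𝓘(ℝ, Eu 7)) (IM := 𝓘(ℝ, Eu 7))
    (e := trivializationAt (Eu 7) (TangentSpace 𝓘(ℝ, Eu 7)) x₀)
    (f := fun x : M => (⟨x, ofComps x₀ x v⟩ : TangentBundle 𝓘(ℝ, Eu 7) M))
    (s := csource x₀) (fun x hx => hx)).2 ⟨contMDiffOn_id, (contMDiffOn_const (c := v)).congr fun x hx => ?_⟩
  exact comps_ofComps hx v

theorem contDiffOn_chartMetric_apply (g : Metric7 M) (x₀ : M) (v w : Eu 7) :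
    ContDiffOn ℝ ∞ (fun y => chartMetric g x₀ y v w) (ctarget x₀) := by
  have h : ContMDiffOn 𝓘(ℝ, Eu 7) (𝓘(ℝ, Eu 7).prod 𝓘(ℝ)) ∞
      (fun x => Bundle.TotalSpace.mk' ℝ (E := Bundle.Trivial M ℝ) x
        (g.inner x (ofComps x₀ x v) (ofComps x₀ x w))) (csource x₀) := by
    apply ContMDiffOn.clm_bundle_apply₂ (F₁ := Eu 7) (F₂ := Eu 7)
    · exact g.contMDiff.contMDiffOn
    · exact contMDiffOn_frame x₀ v
    · exact contMDiffOn_frame x₀ w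
  have h2 : ContMDiffOn 𝓘(ℝ, Eu 7) 𝓘(ℝ) ∞
      (fun x => g.inner x (ofComps x₀ x v) (ofComps x₀ x w)) (csource x₀) := by
    intro x hx
    have := h x hx
    simp only [Bundle.contMDiffWithinAt_totalSpace] at this
    exact this.2
  have h3 := h2.comp (contMDiffOn_extChartAt_symm (I := 𝓘(ℝ, Eu 7)) (n := ∞) x₀)
    (fun y hy => chartPt_mem hy)
  exact contMDiffOn_iff_contDiffOn.1 h3

theorem contDiffOn_chartMetric (g : Metric7 M) (x₀ : M) :
    ContDiffOn ℝ ∞ (chartMetric g x₀) (ctarget x₀) :=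
  contDiffOn_clm_apply.2 fun v => contDiffOn_clm_apply.2 fun w =>
    contDiffOn_chartMetric_apply g x₀ v w

/-- The metric at a point of the chart is an isomorphism onto the dual space. -/
theorem exists_equiv_chartMetric (g : Metric7 M) {x₀ : M} {y : Eu 7} (hy : y ∈ ctarget x₀) :
    ∃ e : Eu 7 ≃L[ℝ] (Eu 7 →L[ℝ] ℝ), (e : Eu 7 →L[ℝ] Eu 7 →L[ℝ] ℝ) = chartMetric g x₀ y := by
  have hinj : Function.Injective (chartMetric g x₀ y : Eu 7 →ₗ[ℝ] Eu 7 →L[ℝ] ℝ) := by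
    rw [injective_iff_map_eq_zero]
    intro a ha
    by_contra hne
    have := chartMetric_pos g hy hne
    rw [show chartMetric g x₀ y a = 0 from ha] at this
    simp at this
  have hrank : Module.finrank ℝ (Eu 7) = Module.finrank ℝ (Eu 7 →L[ℝ] ℝ) := by
    rw [(LinearMap.toContinuousLinearMap (𝕜 := ℝ) (E := Eu 7) (F' := ℝ)).symm.finrank_eq]
    exact (Subspace.dual_finrank_eq (K := ℝ) (V := Eu 7)).symm
  refine ⟨(LinearEquiv.ofInjectiveOfFinrankEq _ hinj hrank).toContinuousLinearEquiv, ?_⟩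
  ext a b
  rfl

theorem chartMetric_inverse_apply (g : Metric7 M) {x₀ : M} {y : Eu 7} (hy : y ∈ ctarget x₀)
    (l : Eu 7 →L[ℝ] ℝ) : chartMetric g x₀ y ((chartMetric g x₀ y).inverse l) = l := by
  obtain ⟨e, he⟩ := exists_equiv_chartMetric g hy
  rw [← he]
  simp

theorem chartMetric_ext (g : Metric7 M) {x₀ : M} {y : Eu 7} (hy : y ∈ ctarget x₀) {a b : Eu 7}
    (h : ∀ c, chartMetric g x₀ y a c = chartMetric g x₀ y b c) : a = b := by
  obtain ⟨e, he⟩ := exists_equiv_chartMetric g hy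
  apply e.injective
  have : (e : Eu 7 →L[ℝ] Eu 7 →L[ℝ] ℝ) a = (e : Eu 7 →L[ℝ] Eu 7 →L[ℝ] ℝ) b := by
    rw [he]; ext c; exact h c
  exact this

theorem chartMetric_inverse_eq (g : Metric7 M) {x₀ : M} {y : Eu 7} (hy : y ∈ ctarget x₀)
    (a : Eu 7) : (chartMetric g x₀ y).inverse (chartMetric g x₀ y a) = a :=
  chartMetric_ext g hy fun c => by rw [chartMetric_inverse_apply g hy]

theorem contDiffOn_chartMetric_inverse (g : Metric7 M) (x₀ : M) :
    ContDiffOn ℝ ∞ (fun y => (chartMetric g x₀ y).inverse) (ctarget x₀) := by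
  intro y hy
  obtain ⟨e, he⟩ := exists_equiv_chartMetric g hy
  have h := contDiffAt_map_inverse (𝕜 := ℝ) (n := ∞) e
  rw [he] at h
  exact h.comp_contDiffWithinAt y (contDiffOn_chartMetric g x₀ y hy)

/-- The right-hand side `z ↦ (m' v w z + m' w v z - m' z v w) / 2` of the Koszul formula. -/
def koszul (m' : Eu 7 →L[ℝ] Eu 7 →L[ℝ] Eu 7 →L[ℝ] ℝ) :
    Eu 7 →L[ℝ] Eu 7 →L[ℝ] Eu 7 →L[ℝ] ℝ :=
  (1 / 2 : ℝ) • (m' + m'.flip -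
    ((ContinuousLinearMap.flipₗᵢ ℝ (Eu 7) (Eu 7) ℝ).toContinuousLinearEquiv :
      (Eu 7 →L[ℝ] Eu 7 →L[ℝ] ℝ) →L[ℝ] (Eu 7 →L[ℝ] Eu 7 →L[ℝ] ℝ)) ∘L m'.flip)

theorem koszul_apply (m' : Eu 7 →L[ℝ] Eu 7 →L[ℝ] Eu 7 →L[ℝ] ℝ) (v w z : Eu 7) :
    koszul m' v w z = 1 / 2 * (m' v w z + m' w v z - m' z v w) := by
  simp [koszul]

theorem contDiff_koszul : ContDiff ℝ ∞ koszul := by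
  refine contDiff_clm_apply_iff.2 fun v => contDiff_clm_apply_iff.2 fun w =>
    contDiff_clm_apply_iff.2 fun z => ?_
  simp only [koszul_apply]
  fun_prop

/-- The bilinear map of Christoffel symbols that belongs to a bilinear form `m` with
derivative `m'`. -/
def christoffelL (m : Eu 7 →L[ℝ] Eu 7 →L[ℝ] ℝ) (m' : Eu 7 →L[ℝ] Eu 7 →L[ℝ] Eu 7 →L[ℝ] ℝ) :
    Eu 7 →L[ℝ] Eu 7 →L[ℝ] Eu 7 :=
  (ContinuousLinearMap.compL ℝ (Eu 7) (Eu 7 →L[ℝ] ℝ) (Eu 7) m.inverse) ∘L koszul m'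

theorem christoffel_eq (g : Metric7 M) (x₀ : M) (y v w : Eu 7) :
    christoffel g x₀ y v w =
      christoffelL (chartMetric g x₀ y) (fderiv ℝ (chartMetric g x₀) y) v w := by
  simp only [christoffel, christoffelL, ContinuousLinearMap.comp_apply,
    ContinuousLinearMap.compL_apply]
  congr 1

theorem chartMetric_christoffel (g : Metric7 M) {x₀ : M} {y : Eu 7} (hy : y ∈ ctarget x₀)
    (v w z : Eu 7) : chartMetric g x₀ y (christoffel g x₀ y v w) z =
      1 / 2 * (fderiv ℝ (chartMetric g x₀) y v w z + fderiv ℝ (chartMetric g x₀) y w v z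
        - fderiv ℝ (chartMetric g x₀) y z v w) := by
  rw [christoffel, chartMetric_inverse_apply g hy]
  simp

theorem contDiffAt_christoffelL {p : (Eu 7 →L[ℝ] Eu 7 →L[ℝ] ℝ) ×
    (Eu 7 →L[ℝ] Eu 7 →L[ℝ] Eu 7 →L[ℝ] ℝ)} (e : Eu 7 ≃L[ℝ] (Eu 7 →L[ℝ] ℝ))
    (he : (e : Eu 7 →L[ℝ] Eu 7 →L[ℝ] ℝ) = p.1) :
    ContDiffAt ℝ ∞ (fun p : (Eu 7 →L[ℝ] Eu 7 →L[ℝ] ℝ) ×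
      (Eu 7 →L[ℝ] Eu 7 →L[ℝ] Eu 7 →L[ℝ] ℝ) => christoffelL p.1 p.2) p := by
  have h := contDiffAt_map_inverse (𝕜 := ℝ) (n := ∞) e
  rw [he] at h
  have h1 : ContDiffAt ℝ ∞ (fun p : (Eu 7 →L[ℝ] Eu 7 →L[ℝ] ℝ) ×
      (Eu 7 →L[ℝ] Eu 7 →L[ℝ] Eu 7 →L[ℝ] ℝ) => p.1.inverse) p := h.comp p contDiffAt_fst
  have h2 : ContDiffAt ℝ ∞ (fun p : (Eu 7 →L[ℝ] Eu 7 →L[ℝ] ℝ) ×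
      (Eu 7 →L[ℝ] Eu 7 →L[ℝ] Eu 7 →L[ℝ] ℝ) => koszul p.2) p :=
    contDiff_koszul.contDiffAt.comp p contDiffAt_snd
  exact ((ContinuousLinearMap.compL ℝ (Eu 7) (Eu 7 →L[ℝ] ℝ) (Eu 7)).contDiff.contDiffAt.comp p
    h1).clm_comp h2

theorem contDiffOn_christoffel (g : Metric7 M) (x₀ : M) :
    ContDiffOn ℝ ∞ (fun y => christoffelL (chartMetric g x₀ y) (fderiv ℝ (chartMetric g x₀) y))
      (ctarget x₀) := by
  intro y hy
  obtain ⟨e, he⟩ := exists_equiv_chartMetric g hy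
  refine (contDiffAt_christoffelL (p := (_, _)) e he).comp_contDiffWithinAt y
    ((contDiffOn_chartMetric g x₀ y hy).prodMk
      ((contDiffOn_chartMetric g x₀).fderiv_of_isOpen (isOpen_ctarget x₀) (by simp) y hy))

/-! ### The cross product and `τ` in a chart -/

/-- The cross product in the chart around `x₀`. -/
def chartCross (G : G2Structure M) (x₀ : M) (y u v : Eu 7) : Eu 7 :=
  comps x₀ (G.cross (chartPt x₀ y) (chartVec x₀ y u) (chartVec x₀ y v))

theorem comps_cross (G : G2Structure M) {x₀ x : M} (hx : x ∈ csource x₀) (u v : TS 7 x) :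
    comps x₀ (G.cross x u v) = chartCross G x₀ (cmap x₀ x) (comps x₀ u) (comps x₀ v) := by
  have key : ∀ z, z = x → comps x₀ (G.cross z (ofComps x₀ z (comps x₀ u))
      (ofComps x₀ z (comps x₀ v))) = comps x₀ (G.cross x u v) := by
    rintro _ rfl
    rw [ofComps_comps hx, ofComps_comps hx]
  exact (key _ (chartPt_cmap hx)).symm

theorem chartMetric_chartCross (G : G2Structure M) {x₀ : M} {y : Eu 7} (hy : y ∈ ctarget x₀)
    (u v w : Eu 7) : chartMetric G.metric x₀ y (chartCross G x₀ y u v) w =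
      G.metric.inner (chartPt x₀ y) (G.cross (chartPt x₀ y) (chartVec x₀ y u)
        (chartVec x₀ y v)) (chartVec x₀ y w) := by
  rw [chartMetric_apply, chartCross, ofComps_comps (chartPt_mem hy)]
  rfl

/-- Smoothness is given for `Ω` only; the cross product is recovered with the inverse of the
metric. -/
theorem contDiffOn_chartCross (G : G2Structure M) (x₀ : M) :
    ContDiffOn ℝ ∞ (fun p : Eu 7 × Eu 7 × Eu 7 => chartCross G x₀ p.1 p.2.1 p.2.2)
      (ctarget x₀ ×ˢ univ) := by
  have hform : ContDiffOn ℝ ∞ (fun p : Eu 7 × Eu 7 × Eu 7 =>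
      chartMetric G.metric x₀ p.1 (chartCross G x₀ p.1 p.2.1 p.2.2)) (ctarget x₀ ×ˢ univ) := by
    refine contDiffOn_clm_apply.2 fun c => ?_
    have hsum : ContDiffOn ℝ ∞ (fun p : Eu 7 × Eu 7 × Eu 7 => ∑ i : Fin 7, ∑ j : Fin 7,
        p.2.1 i * (p.2.2 j * G.metric.inner (chartPt x₀ p.1) (G.cross (chartPt x₀ p.1)
          (chartVec x₀ p.1 (EuclideanSpace.single i 1))
          (chartVec x₀ p.1 (EuclideanSpace.single j 1))) (chartVec x₀ p.1 c)))
        (ctarget x₀ ×ˢ univ) := by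
      refine ContDiffOn.sum fun i _ => ContDiffOn.sum fun j _ => ?_
      refine ContDiffOn.mul (ContDiff.contDiffOn (by fun_prop)) (ContDiffOn.mul
        (ContDiff.contDiffOn (by fun_prop)) ?_)
      exact (G.form_smooth x₀ _ _ c).comp contDiffOn_fst fun p hp => hp.1
    refine hsum.congr fun p hp => ?_
    rw [chartMetric_chartCross G hp.1]
    have hu : ∀ u : Eu 7, u = ∑ i, u i • EuclideanSpace.single i (1 : ℝ) := fun u => by
      conv_lhs => rw [← (EuclideanSpace.basisFun (Fin 7) ℝ).sum_repr u]
      simp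
    have hc : ∀ u : Eu 7, chartVec x₀ p.1 u = ∑ i, u i • chartVec x₀ p.1
        (EuclideanSpace.single i (1 : ℝ)) := fun u => by
      conv_lhs => rw [hu u]
      unfold chartVec
      rw [map_sum]
      simp only [map_smul]
      rfl
    rw [hc p.2.1, hc p.2.2]
    simp only [map_sum, map_smul, LinearMap.sum_apply, LinearMap.smul_apply,
      _root_.sum_apply, _root_.smul_apply, smul_eq_mul, Finset.mul_sum]
    rw [Finset.sum_comm]
    exact Finset.sum_congr rfl fun i _ => Finset.sum_congr rfl fun j _ => mul_left_comm _ _ _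
  refine (((contDiffOn_chartMetric_inverse G.metric x₀).comp contDiffOn_fst
    (fun p hp => hp.1)).clm_apply hform).congr fun p hp => ?_
  exact (chartMetric_inverse_eq G.metric hp.1 _).symm

/-- The vector-valued form `τ` in the chart around `x₀`. -/
def chartTau (G : G2Structure M) (x₀ : M) (y u v w : Eu 7) : Eu 7 :=
  -chartCross G x₀ y u (chartCross G x₀ y v w) - chartMetric G.metric x₀ y u v • w +
    chartMetric G.metric x₀ y u w • v

theorem comps_tau (G : G2Structure M) {x₀ x : M} (hx : x ∈ csource x₀) (u v w : TS 7 x) :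
    comps x₀ (G.tau x u v w) =
      chartTau G x₀ (cmap x₀ x) (comps x₀ u) (comps x₀ v) (comps x₀ w) := by
  rw [G2Structure.tau, chartTau, inner_eq_chartMetric _ hx, inner_eq_chartMetric _ hx,
    comps_add, comps_smul, ← comps_cross G hx, ← comps_cross G hx, sub_eq_add_neg, comps_add,
    ← neg_smul, comps_smul, ← neg_one_smul ℝ (G.cross x u _), comps_smul]
  simp [sub_eq_add_neg]

theorem contDiffOn_chartTau (G : G2Structure M) (x₀ : M) :
    ContDiffOn ℝ ∞ (fun p : Eu 7 × Eu 7 × Eu 7 × Eu 7 =>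
      chartTau G x₀ p.1 p.2.1 p.2.2.1 p.2.2.2) (ctarget x₀ ×ˢ univ) := by
  have hm : ContDiffOn ℝ ∞ (fun p : Eu 7 × Eu 7 × Eu 7 × Eu 7 => chartMetric G.metric x₀ p.1)
      (ctarget x₀ ×ˢ univ) :=
    (contDiffOn_chartMetric G.metric x₀).comp contDiffOn_fst fun p hp => hp.1
  have h1 : ContDiffOn ℝ ∞ (fun p : Eu 7 × Eu 7 × Eu 7 × Eu 7 =>
      chartCross G x₀ p.1 p.2.2.1 p.2.2.2) (ctarget x₀ ×ˢ univ) :=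
    (contDiffOn_chartCross G x₀).comp (f := fun p : Eu 7 × Eu 7 × Eu 7 × Eu 7 =>
      (p.1, p.2.2.1, p.2.2.2)) (ContDiff.contDiffOn (by fun_prop)) fun p hp => ⟨hp.1, trivial⟩
  have h2 : ContDiffOn ℝ ∞ (fun p : Eu 7 × Eu 7 × Eu 7 × Eu 7 =>
      chartCross G x₀ p.1 p.2.1 (chartCross G x₀ p.1 p.2.2.1 p.2.2.2)) (ctarget x₀ ×ˢ univ) :=
    (contDiffOn_chartCross G x₀).comp (f := fun p : Eu 7 × Eu 7 × Eu 7 × Eu 7 =>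
      (p.1, p.2.1, chartCross G x₀ p.1 p.2.2.1 p.2.2.2)) (contDiffOn_fst.prodMk
        ((ContDiff.contDiffOn (by fun_prop)).prodMk h1)) fun p hp => ⟨hp.1, trivial⟩
  refine (h2.neg.sub (((hm.clm_apply (ContDiff.contDiffOn (by fun_prop))).clm_apply
    (ContDiff.contDiffOn (by fun_prop))).smul (ContDiff.contDiffOn (by fun_prop)))).add
    (((hm.clm_apply (ContDiff.contDiffOn (by fun_prop))).clm_apply
    (ContDiff.contDiffOn (by fun_prop))).smul (ContDiff.contDiffOn (by fun_prop)))

end Chart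

/-! ### Change of charts -/

section Transition

variable {M : Type*} [TopologicalSpace M] [ChartedSpace (Eu 7) M] [IsManifold 𝓘(ℝ, Eu 7) ∞ M]

/-- The transition map from the chart around `x₀` to the chart around `x₁`. -/
def transition (x₀ x₁ : M) (y : Eu 7) : Eu 7 := cmap x₁ (chartPt x₀ y)

/-- The domain of `transition x₀ x₁`. -/
def overlap (x₀ x₁ : M) : Set (Eu 7) := ctarget x₀ ∩ chartPt x₀ ⁻¹' csource x₁

theorem isOpen_overlap (x₀ x₁ : M) : IsOpen (overlap x₀ x₁) :=
  (continuousOn_chartPt x₀).isOpen_inter_preimage (isOpen_ctarget x₀)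
    (chartAt (Eu 7) x₁).open_source

theorem contDiffOn_transition (x₀ x₁ : M) : ContDiffOn ℝ ∞ (transition x₀ x₁) (overlap x₀ x₁) := by
  refine contMDiffOn_iff_contDiffOn.1 ?_
  refine (contMDiffOn_extChartAt (I := 𝓘(ℝ, Eu 7)) (n := ∞) (x := x₁)).comp
    ((contMDiffOn_extChartAt_symm (I := 𝓘(ℝ, Eu 7)) (n := ∞) x₀).mono inter_subset_left) ?_
  intro y hy
  exact hy.2

theorem fderiv_transition {x₀ x₁ : M} {y : Eu 7} (hy : y ∈ overlap x₀ x₁) :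
    fderiv ℝ (transition x₀ x₁) y = tangentCoordChange 𝓘(ℝ, Eu 7) x₀ x₁ (chartPt x₀ y) := by
  have h1 : chartPt x₀ y ∈ (extChartAt 𝓘(ℝ, Eu 7) x₀).source ∩
      (extChartAt 𝓘(ℝ, Eu 7) x₁).source := by
    rw [extChartAt_source, extChartAt_source]
    exact ⟨chartPt_mem hy.1, hy.2⟩
  have h := hasFDerivWithinAt_tangentCoordChange (I := 𝓘(ℝ, Eu 7)) h1
  have h2 : cmap x₀ (chartPt x₀ y) = y := cmap_chartPt hy.1
  rw [show extChartAt 𝓘(ℝ, Eu 7) x₀ (chartPt x₀ y) = y from h2] at h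
  rw [ModelWithCorners.range_eq_univ, hasFDerivWithinAt_univ] at h
  exact h.fderiv

theorem comps_eq_fderiv_transition {x₀ x₁ x : M} (h₀ : x ∈ csource x₀) (h₁ : x ∈ csource x₁)
    (v : TS 7 x) :
    comps x₁ v = fderiv ℝ (transition x₀ x₁) (cmap x₀ x) (comps x₀ v) := by
  rw [fderiv_transition ⟨cmap_mem h₀, by rwa [mem_preimage, chartPt_cmap h₀]⟩, chartPt_cmap h₀]
  refine (tangentCoordChange_comp ⟨⟨mem_extChartAt_source x, ?_⟩, ?_⟩).symm <;>
  rwa [extChartAt_source]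

theorem fderiv_transition_surjective {x₀ x₁ : M} {y : Eu 7} (hy : y ∈ overlap x₀ x₁) (c : Eu 7) :
    ∃ z, fderiv ℝ (transition x₀ x₁) y z = c := by
  refine ⟨comps x₀ (ofComps x₁ (chartPt x₀ y) c), ?_⟩
  have h := comps_eq_fderiv_transition (chartPt_mem hy.1) hy.2 (ofComps x₁ (chartPt x₀ y) c)
  rw [cmap_chartPt hy.1, comps_ofComps hy.2] at h
  exact h.symm

theorem chartMetric_transition (g : Metric7 M) {x₀ x₁ : M} {y : Eu 7} (hy : y ∈ overlap x₀ x₁)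
    (a b : Eu 7) : chartMetric g x₀ y a b = chartMetric g x₁ (transition x₀ x₁ y)
      (fderiv ℝ (transition x₀ x₁) y a) (fderiv ℝ (transition x₀ x₁) y b) := by
  have h0 := chartPt_mem hy.1
  rw [chartMetric_apply, inner_eq_chartMetric g hy.2,
    comps_eq_fderiv_transition h0 hy.2, comps_eq_fderiv_transition h0 hy.2,
    comps_ofComps h0, comps_ofComps h0, cmap_chartPt hy.1]
  rfl

theorem transition_mem {x₀ x₁ : M} {y : Eu 7} (hy : y ∈ overlap x₀ x₁) :
    transition x₀ x₁ y ∈ ctarget x₁ := cmap_mem hy.2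

/-- The transformation law of the Christoffel symbols. -/
theorem christoffel_transition (g : Metric7 M) {x₀ x₁ : M} {y : Eu 7} (hy : y ∈ overlap x₀ x₁)
    (v w : Eu 7) :
    fderiv ℝ (transition x₀ x₁) y (christoffel g x₀ y v w) =
      christoffel g x₁ (transition x₀ x₁ y) (fderiv ℝ (transition x₀ x₁) y v)
        (fderiv ℝ (transition x₀ x₁) y w) +
      fderiv ℝ (fderiv ℝ (transition x₀ x₁)) y v w := by
  have hO := (isOpen_overlap x₀ x₁).mem_nhds hy
  have hψ := (contDiffOn_transition x₀ x₁).contDiffAt hO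
  have hψ1 : HasFDerivAt (transition x₀ x₁) (fderiv ℝ (transition x₀ x₁) y) y :=
    (hψ.differentiableAt (by simp)).hasFDerivAt
  have hψ2 : HasFDerivAt (fderiv ℝ (transition x₀ x₁))
      (fderiv ℝ (fderiv ℝ (transition x₀ x₁)) y) y :=
    ((hψ.fderiv_right (m := ∞) (by simp)).differentiableAt (by simp)).hasFDerivAt
  have hM : HasFDerivAt (chartMetric g x₁) (fderiv ℝ (chartMetric g x₁) (transition x₀ x₁ y))
      (transition x₀ x₁ y) :=
    (((contDiffOn_chartMetric g x₁).contDiffAt ((isOpen_ctarget x₁).mem_nhds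
      (transition_mem hy))).differentiableAt (by simp)).hasFDerivAt
  have hM0 : HasFDerivAt (chartMetric g x₀) (fderiv ℝ (chartMetric g x₀) y) y :=
    (((contDiffOn_chartMetric g x₀).contDiffAt ((isOpen_ctarget x₀).mem_nhds
      hy.1)).differentiableAt (by simp)).hasFDerivAt
  have hsymm : ∀ a b, fderiv ℝ (fderiv ℝ (transition x₀ x₁)) y a b =
      fderiv ℝ (fderiv ℝ (transition x₀ x₁)) y b a :=
    (hψ.isSymmSndFDerivAt (by
      simpa using WithTop.coe_le_coe.2 (le_top : (2 : ℕ∞) ≤ ⊤))).eq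
  set D := fderiv ℝ (transition x₀ x₁) y with hD
  -- the derivative of the transformation law of the metric
  have key : ∀ u a b, fderiv ℝ (chartMetric g x₀) y u a b =
      fderiv ℝ (chartMetric g x₁) (transition x₀ x₁ y) (D u) (D a) (D b) +
      chartMetric g x₁ (transition x₀ x₁ y) (fderiv ℝ (fderiv ℝ (transition x₀ x₁)) y u a) (D b) +
      chartMetric g x₁ (transition x₀ x₁ y) (D a)
        (fderiv ℝ (fderiv ℝ (transition x₀ x₁)) y u b) := by
    intro u a b
    have e1 := (hM0.clm_apply (hasFDerivAt_const a y)).clm_apply (hasFDerivAt_const b y)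
    have e2 := ((hM.comp y hψ1).clm_apply (hψ2.clm_apply (hasFDerivAt_const a y))).clm_apply
      (hψ2.clm_apply (hasFDerivAt_const b y))
    have e3 := e1.congr_of_eventuallyEq (f₁ := fun y => chartMetric g x₁ (transition x₀ x₁ y)
      (fderiv ℝ (transition x₀ x₁) y a) (fderiv ℝ (transition x₀ x₁) y b))
      (by filter_upwards [hO] with y' hy' using (chartMetric_transition g hy' a b).symm)
    have e4 := congrArg (fun L => L u) (e3.unique e2)
    simp only [ContinuousLinearMap.comp_zero, zero_add, _root_.add_apply,
      ContinuousLinearMap.flip_apply, ContinuousLinearMap.comp_apply, Function.comp_apply] at e4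
    rw [e4]
    ring
  refine chartMetric_ext g (transition_mem hy) fun c => ?_
  obtain ⟨z, rfl⟩ := fderiv_transition_surjective hy c
  rw [← hD, ← chartMetric_transition g hy, chartMetric_christoffel g hy.1, map_add,
    _root_.add_apply, chartMetric_christoffel g (transition_mem hy), key, key, key,
    hsymm w v, hsymm z v, hsymm z w,
    chartMetric_symm g x₁ _ (fderiv ℝ (fderiv ℝ (transition x₀ x₁)) y v z) (D w)]
  ring

/-! ### Derivatives of maps into a manifold, in a chart -/

section MFDeriv

variable {EN : Type*} [NormedAddCommGroup EN] [NormedSpace ℝ EN] {HN : Type*}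
  [TopologicalSpace HN] {IN : ModelWithCorners ℝ EN HN} {N : Type*} [TopologicalSpace N]
  [ChartedSpace HN N]

theorem mdifferentiableWithinAt_of_cmap {f : N → M} {W : Set N} {p : N} {x₀ : M}
    (hc : ContinuousWithinAt f W p) (hx : f p ∈ csource x₀)
    (hf : MDifferentiableWithinAt IN 𝓘(ℝ, Eu 7) (fun q => cmap x₀ (f q)) W p) :
    MDifferentiableWithinAt IN 𝓘(ℝ, Eu 7) f W p := by
  have h1 : MDifferentiableAt 𝓘(ℝ, Eu 7) 𝓘(ℝ, Eu 7) (chartPt x₀) (cmap x₀ (f p)) :=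
    ((contMDiffOn_extChartAt_symm (I := 𝓘(ℝ, Eu 7)) (n := ∞) x₀).contMDiffAt
      ((isOpen_ctarget x₀).mem_nhds (cmap_mem hx))).mdifferentiableAt (by simp)
  have h2 := h1.comp_mdifferentiableWithinAt p hf
  refine h2.congr_of_eventuallyEq ?_ ?_
  · filter_upwards [hc ((chartAt (Eu 7) x₀).open_source.mem_nhds hx)] with q hq
    exact (chartPt_cmap hq).symm
  · exact (chartPt_cmap hx).symm

theorem mdifferentiableAt_cmap {x₀ x : M} (hx : x ∈ csource x₀) :
    MDifferentiableAt 𝓘(ℝ, Eu 7) 𝓘(ℝ, Eu 7) (cmap x₀) x :=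
  mdifferentiableAt_extChartAt hx

theorem mfderiv_cmap {x₀ x : M} (hx : x ∈ csource x₀) (v : TS 7 x) :
    mfderiv 𝓘(ℝ, Eu 7) 𝓘(ℝ, Eu 7) (cmap x₀) x v = comps x₀ v := by
  have h := mfderiv_chartAt_eq_tangentCoordChange (I := 𝓘(ℝ, Eu 7)) hx
  exact congrArg (fun L : Eu 7 →L[ℝ] Eu 7 => L v) h

theorem comps_mfderivWithin {f : N → M} {W : Set N} {p : N} {x₀ : M}
    (hf : MDifferentiableWithinAt IN 𝓘(ℝ, Eu 7) f W p) (hW : UniqueMDiffWithinAt IN W p)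
    (hx : f p ∈ csource x₀) (a : TangentSpace IN p) :
    comps x₀ (mfderivWithin IN 𝓘(ℝ, Eu 7) f W p a) =
      mfderivWithin IN 𝓘(ℝ, Eu 7) (fun q => cmap x₀ (f q)) W p a := by
  rw [← mfderiv_cmap hx]
  have h := mfderiv_comp_mfderivWithin p (mdifferentiableAt_cmap hx) hf hW
  exact (congrArg (fun L : EN →L[ℝ] Eu 7 => L a) h).symm

end MFDeriv

/-! ### Geodesics and parallel fields in a chart -/

section Curves

variable {γ : ℝ → M} {J : Set ℝ} {x₀ : M} {c v : ℝ → Eu 7}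

theorem chartVel_eq_of_chart (hJ : UniqueDiffOn ℝ J)
    (hγ : ∀ r ∈ J, γ r = chartPt x₀ (c r)) (hcv : ∀ r ∈ J, HasDerivWithinAt c (v r) J r)
    {x₁ : M} {r : ℝ} (hr : r ∈ J) (hr' : c r ∈ overlap x₀ x₁) :
    HasDerivWithinAt (fun r' => cmap x₁ (γ r')) (fderiv ℝ (transition x₀ x₁) (c r) (v r)) J r ∧
      chartVel γ J x₁ r = fderiv ℝ (transition x₀ x₁) (c r) (v r) := by
  have h1 : HasFDerivAt (transition x₀ x₁) (fderiv ℝ (transition x₀ x₁) (c r)) (c r) :=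
    (((contDiffOn_transition x₀ x₁).contDiffAt
      ((isOpen_overlap x₀ x₁).mem_nhds hr')).differentiableAt (by simp)).hasFDerivAt
  have h2 := (h1.comp_hasDerivWithinAt r (hcv r hr)).congr
    (f₁ := fun r' => cmap x₁ (γ r')) (fun r' hr' => by rw [hγ r' hr']; rfl)
    (by rw [hγ r hr]; rfl)
  exact ⟨h2, h2.derivWithin (hJ r hr)⟩

theorem chartVel_eq_self (hJ : UniqueDiffOn ℝ J) (hc : ∀ r ∈ J, c r ∈ ctarget x₀)
    (hγ : ∀ r ∈ J, γ r = chartPt x₀ (c r)) (hcv : ∀ r ∈ J, HasDerivWithinAt c (v r) J r)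
    {r : ℝ} (hr : r ∈ J) : chartVel γ J x₀ r = v r := by
  refine HasDerivWithinAt.derivWithin ?_ (hJ r hr)
  refine (hcv r hr).congr (fun r' hr' => ?_) ?_
  · rw [hγ r' hr']; exact cmap_chartPt (hc r' hr')
  · rw [hγ r hr]; exact cmap_chartPt (hc r hr)

theorem eventually_mem_overlap (hγ : ∀ r ∈ J, γ r = chartPt x₀ (c r))
    (hc : ∀ r ∈ J, c r ∈ ctarget x₀) (hcv : ∀ r ∈ J, HasDerivWithinAt c (v r) J r)
    {x₁ : M} {r : ℝ} (hr : r ∈ J) (hx : γ r ∈ csource x₁) :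
    c r ∈ overlap x₀ x₁ ∧ ∀ᶠ r' in 𝓝[J] r, c r' ∈ overlap x₀ x₁ := by
  have h : c r ∈ overlap x₀ x₁ := ⟨hc r hr, by rw [mem_preimage, ← hγ r hr]; exact hx⟩
  exact ⟨h, (hcv r hr).continuousWithinAt ((isOpen_overlap x₀ x₁).mem_nhds h)⟩

/-- A solution of the geodesic equation in one chart is a geodesic. -/
theorem isGeodesicOn_of_chart (g : Metric7 M) (hJ : UniqueDiffOn ℝ J)
    (hc : ∀ r ∈ J, c r ∈ ctarget x₀) (hγ : ∀ r ∈ J, γ r = chartPt x₀ (c r))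
    (hcv : ∀ r ∈ J, HasDerivWithinAt c (v r) J r)
    (hv : ∀ r ∈ J, HasDerivWithinAt v (-christoffel g x₀ (c r) (v r) (v r)) J r) :
    IsGeodesicOn g γ J := by
  refine ⟨?_, fun x₁ r hr hx => ?_⟩
  · refine ((continuousOn_chartPt x₀).comp (fun r hr => (hcv r hr).continuousWithinAt) hc).congr
      hγ
  · obtain ⟨hO, hO'⟩ := eventually_mem_overlap hγ hc hcv hr hx
    obtain ⟨h1, h2⟩ := chartVel_eq_of_chart hJ hγ hcv hr hO
    refine ⟨h1.differentiableWithinAt, ?_⟩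
    have hψ := (contDiffOn_transition x₀ x₁).contDiffAt ((isOpen_overlap x₀ x₁).mem_nhds hO)
    have hψ2 : HasFDerivAt (fderiv ℝ (transition x₀ x₁))
        (fderiv ℝ (fderiv ℝ (transition x₀ x₁)) (c r)) (c r) :=
      ((hψ.fderiv_right (m := ∞) (by simp)).differentiableAt (by simp)).hasFDerivAt
    have h3 := (hψ2.comp_hasDerivWithinAt r (hcv r hr)).clm_apply (hv r hr)
    have h4 := h3.congr_of_eventuallyEq (f₁ := chartVel γ J x₁) (by
      filter_upwards [hO', self_mem_nhdsWithin] with r' h' hr'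
      exact (chartVel_eq_of_chart hJ hγ hcv hr' h').2) h2
    refine h4.congr_deriv ?_
    rw [h2, hγ r hr, map_neg, Function.comp_apply, christoffel_transition g hO]
    change _ = -christoffel g x₁ (transition x₀ x₁ (c r)) _ _
    abel

/-- A solution of the equation of parallel transport in one chart is a parallel field. -/
theorem isParallelOn_of_chart (g : Metric7 M) (hJ : UniqueDiffOn ℝ J)
    (hc : ∀ r ∈ J, c r ∈ ctarget x₀) (hγ : ∀ r ∈ J, γ r = chartPt x₀ (c r))
    (hcv : ∀ r ∈ J, HasDerivWithinAt c (v r) J r) {P : ℝ → Eu 7}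
    (hP : ∀ r ∈ J, HasDerivWithinAt P (-christoffel g x₀ (c r) (v r) (P r)) J r) :
    IsParallelOn g γ (fun r => ofComps x₀ (γ r) (P r)) J := by
  intro x₁ r hr hx
  obtain ⟨hO, hO'⟩ := eventually_mem_overlap hγ hc hcv hr hx
  obtain ⟨h1, h2⟩ := chartVel_eq_of_chart hJ hγ hcv hr hO
  have hψ := (contDiffOn_transition x₀ x₁).contDiffAt ((isOpen_overlap x₀ x₁).mem_nhds hO)
  have hψ2 : HasFDerivAt (fderiv ℝ (transition x₀ x₁))
      (fderiv ℝ (fderiv ℝ (transition x₀ x₁)) (c r)) (c r) :=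
    ((hψ.fderiv_right (m := ∞) (by simp)).differentiableAt (by simp)).hasFDerivAt
  have h3 := (hψ2.comp_hasDerivWithinAt r (hcv r hr)).clm_apply (hP r hr)
  have hcomp : ∀ r' ∈ J, c r' ∈ overlap x₀ x₁ →
      comps x₁ (ofComps x₀ (γ r') (P r')) = fderiv ℝ (transition x₀ x₁) (c r') (P r') := by
    intro r' hr' h'
    have hs : γ r' ∈ csource x₀ := by rw [hγ r' hr']; exact chartPt_mem h'.1
    have hs1 : γ r' ∈ csource x₁ := by rw [hγ r' hr']; exact h'.2
    have hcm : cmap x₀ (γ r') = c r' := by rw [hγ r' hr']; exact cmap_chartPt h'.1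
    rw [comps_eq_fderiv_transition hs hs1, comps_ofComps hs, hcm]
  have h4 := h3.congr_of_eventuallyEq (f₁ := fun r' => comps x₁ (ofComps x₀ (γ r') (P r'))) (by
    filter_upwards [hO', self_mem_nhdsWithin] with r' h' hr'
    exact hcomp r' hr' h') (hcomp r hr hO)
  refine h4.congr_deriv ?_
  rw [h2, hcomp r hr hO, hγ r hr, map_neg, Function.comp_apply, christoffel_transition g hO]
  change _ = -christoffel g x₁ (transition x₀ x₁ (c r)) _ _
  abel

end Curves

end Transition

/-! ### Uniqueness of geodesics and of parallel transport -/

section Uniqueness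

variable {M : Type*} [TopologicalSpace M] [ChartedSpace (Eu 7) M] [IsManifold 𝓘(ℝ, Eu 7) ∞ M]
variable {γ : ℝ → M} {J : Set ℝ} {x₀ : M} {c v : ℝ → Eu 7} {p : M} {w : TS 7 p}

theorem comps_mfderivWithin_curve {r : ℝ} (hJ : UniqueDiffWithinAt ℝ J r)
    (hc : ContinuousWithinAt γ J r) (hx : γ r ∈ csource x₀)
    (hd : DifferentiableWithinAt ℝ (fun r' => cmap x₀ (γ r')) J r) :
    comps x₀ (mfderivWithin 𝓘(ℝ, ℝ) 𝓘(ℝ, Eu 7) γ J r (1 : ℝ) : TS 7 (γ r)) =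
      chartVel γ J x₀ r := by
  have h1 := mdifferentiableWithinAt_of_cmap hc hx
    (mdifferentiableWithinAt_iff_differentiableWithinAt.2 hd)
  refine (comps_mfderivWithin h1 (uniqueMDiffWithinAt_iff_uniqueDiffWithinAt.2 hJ) hx _).trans ?_
  rw [mfderivWithin_eq_fderivWithin]
  rfl

theorem HasInitial.apply_zero (h : HasInitial γ J p w) : γ 0 = p :=
  congrArg (fun z : TangentBundle 𝓘(ℝ, Eu 7) M => z.1) h

theorem HasInitial.comps_mfderivWithin (h : HasInitial γ J p w) :
    comps x₀ (mfderivWithin 𝓘(ℝ, ℝ) 𝓘(ℝ, Eu 7) γ J 0 (1 : ℝ) : TS 7 (γ 0)) = comps x₀ w := by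
  have := congrArg (fun z : TangentBundle 𝓘(ℝ, Eu 7) M => comps x₀ z.2) h
  exact this

theorem HasInitial.chartVel_zero (h : HasInitial γ J p w) (hJ : UniqueDiffWithinAt ℝ J 0)
    (h0 : (0 : ℝ) ∈ J) {g : Metric7 M} (hγ : IsGeodesicOn g γ J) (hp : p ∈ csource x₀) :
    chartVel γ J x₀ 0 = comps x₀ w := by
  have hx : γ 0 ∈ csource x₀ := by
    have h0 := h.apply_zero
    rw [h0]
    exact hp
  rw [← h.comps_mfderivWithin]
  exact (comps_mfderivWithin_curve hJ (hγ.1 0 h0) hx (hγ.2 x₀ 0 h0 hx).1).symm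

theorem hasInitial_of_chart (hJ : UniqueDiffWithinAt ℝ J 0) (hc : ContinuousWithinAt γ J 0)
    (hp : p ∈ csource x₀) (hd : DifferentiableWithinAt ℝ (fun r' => cmap x₀ (γ r')) J 0)
    (h0 : γ 0 = p) (hv : chartVel γ J x₀ 0 = comps x₀ w) : HasInitial γ J p w := by
  subst h0
  unfold HasInitial
  congr 1
  apply comps_injective hp
  change comps x₀ _ = comps x₀ _
  rw [← hv]
  exact comps_mfderivWithin_curve hJ hc hp hd

/-- The vector field of the geodesic equation in a chart. -/
def spray (g : Metric7 M) (x₀ : M) (z : Eu 7 × Eu 7) : Eu 7 × Eu 7 :=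
  (z.2, -christoffel g x₀ z.1 z.2 z.2)

theorem contDiffOn_spray (g : Metric7 M) (x₀ : M) :
    ContDiffOn ℝ ∞ (spray g x₀) (ctarget x₀ ×ˢ univ) := by
  unfold spray
  simp only [christoffel_eq]
  refine contDiffOn_snd.prodMk (ContDiffOn.neg ?_)
  refine ContDiffOn.clm_apply (ContDiffOn.clm_apply ?_ contDiffOn_snd) contDiffOn_snd
  exact (contDiffOn_christoffel g x₀).comp contDiffOn_fst fun z hz => hz.1

/-- As long as a geodesic stays in the chart, it agrees with the solution of the geodesic equation
there. -/
theorem geodesic_eq_of_mem_csource {g : Metric7 M} (hγ : IsGeodesicOn g γ (Icc 0 1))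
    (hi : HasInitial γ (Icc 0 1) p w) (hp : p ∈ csource x₀)
    (hc : ∀ r ∈ Icc (0 : ℝ) 1, c r ∈ ctarget x₀)
    (hcv : ∀ r ∈ Icc (0 : ℝ) 1, HasDerivWithinAt c (v r) (Icc 0 1) r)
    (hv : ∀ r ∈ Icc (0 : ℝ) 1,
      HasDerivWithinAt v (-christoffel g x₀ (c r) (v r) (v r)) (Icc 0 1) r)
    (h0 : c 0 = cmap x₀ p) (hv0 : v 0 = comps x₀ w) {b : ℝ} (hb : b ∈ Icc (0 : ℝ) 1)
    (hs : ∀ r ∈ Icc 0 b, γ r ∈ csource x₀) : ∀ r ∈ Icc 0 b, γ r = chartPt x₀ (c r) := by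
  have hsub : Icc 0 b ⊆ Icc (0 : ℝ) 1 := Icc_subset_Icc_right hb.2
  set z : ℝ → Eu 7 × Eu 7 := fun r => (cmap x₀ (γ r), chartVel γ (Icc 0 1) x₀ r) with hz
  set z₁ : ℝ → Eu 7 × Eu 7 := fun r => (c r, v r) with hz₁
  have hJ : UniqueDiffOn ℝ (Icc (0 : ℝ) 1) := uniqueDiffOn_Icc zero_lt_one
  have h1 : ∀ r ∈ Icc 0 b, HasDerivWithinAt z (spray g x₀ (z r)) (Icc 0 1) r := by
    intro r hr
    obtain ⟨ha, hb⟩ := hγ.2 x₀ r (hsub hr) (hs r hr)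
    exact ha.hasDerivWithinAt.prodMk hb
  have h2 : ∀ r ∈ Icc 0 b, HasDerivWithinAt z₁ (spray g x₀ (z₁ r)) (Icc 0 1) r :=
    fun r hr => (hcv r (hsub hr)).prodMk (hv r (hsub hr))
  have hzc : ContinuousOn z (Icc 0 b) := fun r hr => ((h1 r hr).continuousWithinAt).mono hsub
  have hzc₁ : ContinuousOn z₁ (Icc 0 b) := fun r hr => ((h2 r hr).continuousWithinAt).mono hsub
  set T := z '' Icc 0 b ∪ z₁ '' Icc 0 b with hT
  have hTc : IsCompact T := (isCompact_Icc.image_of_continuousOn hzc).union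
    (isCompact_Icc.image_of_continuousOn hzc₁)
  have hTs : T ⊆ ctarget x₀ ×ˢ univ := by
    rintro _ (⟨r, hr, rfl⟩ | ⟨r, hr, rfl⟩)
    · exact ⟨cmap_mem (hs r hr), trivial⟩
    · exact ⟨hc r (hsub hr), trivial⟩
  have hlip : LocallyLipschitzOn T (spray g x₀) := by
    intro y hy
    have hcd := (contDiffOn_spray g x₀).contDiffAt
      (((isOpen_ctarget x₀).prod isOpen_univ).mem_nhds (hTs hy))
    obtain ⟨K, t, ht, hK⟩ := (hcd.of_le (m := 1) (by simp)).exists_lipschitzOnWith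
    exact ⟨K, t, mem_nhdsWithin_of_mem_nhds ht, hK⟩
  obtain ⟨K, hK⟩ := hlip.exists_lipschitzOnWith_of_compact hTc
  have hright : ∀ r ∈ Ico 0 b, Icc (0 : ℝ) 1 ∈ 𝓝[≥] r := fun r hr =>
    mem_of_superset (Icc_mem_nhdsGE (hr.2.trans_le hb.2)) (Icc_subset_Icc_left hr.1)
  have huniq := ODE_solution_unique_of_mem_Icc_right (v := fun _ => spray g x₀) (s := fun _ => T)
    (K := K) (f := z) (g := z₁) (a := 0) (b := b) (fun _ _ => hK) hzc
    (fun r hr => (h1 r (Ico_subset_Icc_self hr)).mono_of_mem_nhdsWithin (hright r hr))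
    (fun r hr => Or.inl (mem_image_of_mem _ (Ico_subset_Icc_self hr))) hzc₁
    (fun r hr => (h2 r (Ico_subset_Icc_self hr)).mono_of_mem_nhdsWithin (hright r hr))
    (fun r hr => Or.inr (mem_image_of_mem _ (Ico_subset_Icc_self hr)))
    (by
      simp only [hz, hz₁, h0, hv0]
      rw [hi.apply_zero, hi.chartVel_zero (hJ 0 (by simp)) (by simp) hγ hp])
  intro r hr
  have h3 : cmap x₀ (γ r) = c r := congrArg Prod.fst (huniq hr)
  rw [← h3, chartPt_cmap (hs r hr)]

/-- A geodesic with the initial values of a solution of the geodesic equation in a chart agrees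
with that solution; in particular it cannot leave the chart. -/
theorem geodesic_eq_of_chart [T2Space M] {g : Metric7 M} (hγ : IsGeodesicOn g γ (Icc 0 1))
    (hi : HasInitial γ (Icc 0 1) p w) (hp : p ∈ csource x₀)
    (hc : ∀ r ∈ Icc (0 : ℝ) 1, c r ∈ ctarget x₀)
    (hcv : ∀ r ∈ Icc (0 : ℝ) 1, HasDerivWithinAt c (v r) (Icc 0 1) r)
    (hv : ∀ r ∈ Icc (0 : ℝ) 1,
      HasDerivWithinAt v (-christoffel g x₀ (c r) (v r) (v r)) (Icc 0 1) r)
    (h0 : c 0 = cmap x₀ p) (hv0 : v 0 = comps x₀ w) :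
    ∀ r ∈ Icc (0 : ℝ) 1, γ r = chartPt x₀ (c r) := by
  -- The set of times up to which the geodesic stays in the chart is closed, since up to then it
  -- agrees with the solution, and the limit is unique.
  set T : Set ℝ := {b | ∀ r ∈ Icc 0 b, γ r ∈ csource x₀} with hT
  have hstep : ∀ b ∈ Icc (0 : ℝ) 1, b ∈ T → ∀ r ∈ Icc 0 b, γ r = chartPt x₀ (c r) :=
    fun b hb hbT => geodesic_eq_of_mem_csource hγ hi hp hc hcv hv h0 hv0 hb hbT
  have hsub : Icc (0 : ℝ) 1 ⊆ T := by
    refine IsClosed.Icc_subset_of_forall_exists_gt ?_ ?_ ?_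
    · refine isClosed_of_closure_subset fun b hb => ?_
      have hb1 : b ∈ Icc (0 : ℝ) 1 :=
        closure_minimal inter_subset_right isClosed_Icc hb
      have hlt : ∀ r ∈ Ico 0 b, ∃ b' ∈ T ∩ Icc 0 1, r < b' := by
        intro r hr
        obtain ⟨b', hb', hb'T⟩ := mem_closure_iff.1 hb (Ioi r) isOpen_Ioi hr.2
        exact ⟨b', hb'T, hb'⟩
      refine ⟨fun r hr => ?_, hb1⟩
      rcases hr.2.lt_or_eq with hrb | rfl
      · obtain ⟨b', hb', hrb'⟩ := hlt r ⟨hr.1, hrb⟩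
        exact hb'.1 r ⟨hr.1, hrb'.le⟩
      · rcases hr.1.eq_or_lt with rfl | hpos
        · rwa [hi.apply_zero]
        · have hne : (𝓝[Ico 0 r] r).NeBot := by
            rw [← mem_closure_iff_nhdsWithin_neBot, closure_Ico hpos.ne]
            exact right_mem_Icc.2 hpos.le
          have hIco : Ico 0 r ⊆ Icc (0 : ℝ) 1 := fun s hs => ⟨hs.1, hs.2.le.trans hb1.2⟩
          have t1 : Tendsto γ (𝓝[Ico 0 r] r) (𝓝 (γ r)) := (hγ.1 r hb1).mono hIco
          have t2 : Tendsto (fun s => chartPt x₀ (c s)) (𝓝[Ico 0 r] r) (𝓝 (chartPt x₀ (c r))) :=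
            (((continuousOn_chartPt x₀).continuousAt ((isOpen_ctarget x₀).mem_nhds
              (hc r hb1))).comp_continuousWithinAt (hcv r hb1).continuousWithinAt).mono hIco
          have t3 : Tendsto γ (𝓝[Ico 0 r] r) (𝓝 (chartPt x₀ (c r))) := by
            refine t2.congr' ?_
            filter_upwards [self_mem_nhdsWithin] with s hs
            obtain ⟨b', hb', hsb'⟩ := hlt s hs
            exact (hstep b' hb'.2 hb'.1 s ⟨hs.1, hsb'.le⟩).symm
          rw [tendsto_nhds_unique t1 t3]
          exact chartPt_mem (hc r hb1)
    · intro r hr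
      rw [Icc_self, mem_singleton_iff] at hr
      rwa [hr, hi.apply_zero]
    · rintro b ⟨hbT, hb⟩ y hy
      have hcont : ContinuousWithinAt γ (Icc 0 1) b := hγ.1 b ⟨hb.1, hb.2.le⟩
      have h1 : γ ⁻¹' csource x₀ ∈ 𝓝[≥] b :=
        (hcont.mono_of_mem_nhdsWithin (mem_of_superset (Icc_mem_nhdsGE hb.2)
          (Icc_subset_Icc_left hb.1))) ((chartAt (Eu 7) x₀).open_source.mem_nhds
            (hbT b ⟨hb.1, le_rfl⟩))
      obtain ⟨u, hu, hus⟩ := mem_nhdsGE_iff_exists_Icc_subset.1 h1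
      refine ⟨min u y, fun r hr => ?_, lt_min hu hy, min_le_right _ _⟩
      rcases le_or_gt r b with h | h
      · exact hbT r ⟨hr.1, h⟩
      · exact hus ⟨h.le, hr.2.trans (min_le_left _ _)⟩
  exact hstep 1 (by simp) (hsub (by simp))

theorem expCurve_eq_of_chart [T2Space M] {g : Metric7 M} (hp : p ∈ csource x₀)
    (hc : ∀ r ∈ Icc (0 : ℝ) 1, c r ∈ ctarget x₀)
    (hcv : ∀ r ∈ Icc (0 : ℝ) 1, HasDerivWithinAt c (v r) (Icc 0 1) r)
    (hv : ∀ r ∈ Icc (0 : ℝ) 1,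
      HasDerivWithinAt v (-christoffel g x₀ (c r) (v r) (v r)) (Icc 0 1) r)
    (h0 : c 0 = cmap x₀ p) (hv0 : v 0 = comps x₀ w) :
    ExpDefined g p w ∧ ∀ r ∈ Icc (0 : ℝ) 1, expCurve g p w r = chartPt x₀ (c r) := by
  have hJ : UniqueDiffOn ℝ (Icc (0 : ℝ) 1) := uniqueDiffOn_Icc zero_lt_one
  have h : ExpDefined g p w := by
    refine ⟨fun r => chartPt x₀ (c r), isGeodesicOn_of_chart g hJ hc (fun _ _ => rfl) hcv hv, ?_⟩
    have h00 : (0 : ℝ) ∈ Icc (0 : ℝ) 1 := by simp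
    have hd : HasDerivWithinAt (fun r' => cmap x₀ (chartPt x₀ (c r'))) (v 0) (Icc 0 1) 0 :=
      (hcv 0 h00).congr (fun r hr => cmap_chartPt (hc r hr)) (cmap_chartPt (hc 0 h00))
    refine hasInitial_of_chart (x₀ := x₀) (hJ 0 h00) ?_ hp hd.differentiableWithinAt ?_ ?_
    · exact ((continuousOn_chartPt x₀).continuousAt ((isOpen_ctarget x₀).mem_nhds
        (hc 0 h00))).comp_continuousWithinAt (hcv 0 h00).continuousWithinAt
    · rw [h0, chartPt_cmap hp]
    · rw [← hv0]
      exact hd.derivWithin (hJ 0 h00)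
  refine ⟨h, ?_⟩
  have heq : expCurve g p w = h.choose := by
    unfold expCurve; rw [dif_pos h]
  rw [heq]
  exact geodesic_eq_of_chart h.choose_spec.1 h.choose_spec.2 hp hc hcv hv h0 hv0

/-- Backwards parallel transport in a chart is given by the solution `Q` of `Q' = Q ∘ Γ(c', ·)`
with `Q(0) = 1`: for a parallel field `X` the product `Q X` is constant. -/
theorem comps_transportBack (g : Metric7 M)
    (hc : ∀ r ∈ Icc (0 : ℝ) 1, c r ∈ ctarget x₀)
    (hγ : ∀ r ∈ Icc (0 : ℝ) 1, γ r = chartPt x₀ (c r))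
    (hcv : ∀ r ∈ Icc (0 : ℝ) 1, HasDerivWithinAt c (v r) (Icc 0 1) r)
    {P Q : ℝ → Eu 7 →L[ℝ] Eu 7}
    (hP : ∀ r ∈ Icc (0 : ℝ) 1, HasDerivWithinAt P (-((christoffelL (chartMetric g x₀ (c r))
      (fderiv ℝ (chartMetric g x₀) (c r)) (v r)) ∘L P r)) (Icc 0 1) r)
    (hQ : ∀ r ∈ Icc (0 : ℝ) 1, HasDerivWithinAt Q (Q r ∘L (christoffelL (chartMetric g x₀ (c r))
      (fderiv ℝ (chartMetric g x₀) (c r)) (v r))) (Icc 0 1) r)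
    (hP0 : P 0 = ContinuousLinearMap.id ℝ _) (hQ0 : Q 0 = ContinuousLinearMap.id ℝ _)
    (w : TS 7 (γ 1)) : comps x₀ (transportBack g γ w) = Q 1 (comps x₀ w) := by
  have hJ : UniqueDiffOn ℝ (Icc (0 : ℝ) 1) := uniqueDiffOn_Icc zero_lt_one
  have h00 : (0 : ℝ) ∈ Icc (0 : ℝ) 1 := by simp
  have h11 : (1 : ℝ) ∈ Icc (0 : ℝ) 1 := by simp
  have hmem : ∀ r ∈ Icc (0 : ℝ) 1, γ r ∈ csource x₀ := fun r hr => by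
    rw [hγ r hr]; exact chartPt_mem (hc r hr)
  have hcm : ∀ r ∈ Icc (0 : ℝ) 1, cmap x₀ (γ r) = c r := fun r hr => by
    rw [hγ r hr]; exact cmap_chartPt (hc r hr)
  have hconst : ∀ {F : Type} [NormedAddCommGroup F] [NormedSpace ℝ F] {f : ℝ → F},
      (∀ r ∈ Icc (0 : ℝ) 1, HasDerivWithinAt f 0 (Icc 0 1) r) → f 1 = f 0 := by
    intro F _ _ f hf
    exact constant_of_derivWithin_zero (fun r hr => (hf r hr).differentiableWithinAt)
      (fun r hr => (hf r (Ico_subset_Icc_self hr)).derivWithin (hJ r (Ico_subset_Icc_self hr)))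
      1 h11
  have hQP : Q 1 ∘L P 1 = ContinuousLinearMap.id ℝ _ := by
    have := hconst (f := fun r => Q r ∘L P r) fun r hr => by
      refine ((hQ r hr).clm_comp (hP r hr)).congr_deriv ?_
      rw [ContinuousLinearMap.comp_neg, ContinuousLinearMap.comp_assoc]
      exact add_neg_cancel _
    rw [this, hP0, hQ0]
    rfl
  -- In finite dimensions a left inverse is a right inverse.
  have hPQ : ∀ a, P 1 (Q 1 a) = a := by
    have h1 : (Q 1 : Eu 7 →ₗ[ℝ] Eu 7) * (P 1 : Eu 7 →ₗ[ℝ] Eu 7) = 1 := by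
      ext1 a; exact congrArg (fun L => L a) hQP
    have h2 := mul_eq_one_comm.1 h1
    exact fun a => congrArg (fun L => L a) h2
  have huniq : ∀ X : ∀ r : ℝ, TS 7 (γ r), IsParallelOn g γ X (Icc 0 1) → X 1 = w →
      comps x₀ (X 0) = Q 1 (comps x₀ w) := by
    intro X hX hX1
    have := hconst (f := fun r => Q r (comps x₀ (X r))) fun r hr => by
      refine ((hQ r hr).clm_apply (hX x₀ r hr (hmem r hr))).congr_deriv ?_
      have hcr : extChartAt 𝓘(ℝ, Eu 7) x₀ (γ r) = c r := hcm r hr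
      rw [hcr, chartVel_eq_self hJ hc hγ hcv hr, christoffel_eq, map_neg]
      exact add_neg_cancel _
    rw [hX1] at this
    rw [this, hQ0]
    rfl
  have hex : ∃ X : ∀ r : ℝ, TS 7 (γ r), IsParallelOn g γ X (Icc 0 1) ∧ X 1 = w := by
    refine ⟨fun r => ofComps x₀ (γ r) (P r (Q 1 (comps x₀ w))),
      isParallelOn_of_chart g hJ hc hγ hcv fun r hr => ?_, ?_⟩
    · refine ((hP r hr).clm_apply (hasDerivWithinAt_const r _ (Q 1 (comps x₀ w)))).congr_deriv ?_
      rw [christoffel_eq, map_zero, add_zero]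
      rfl
    · apply comps_injective (hmem 1 h11)
      change comps x₀ _ = comps x₀ _
      rw [comps_ofComps (hmem 1 h11), hPQ]
  unfold transportBack
  rw [dif_pos hex]
  exact huniq _ hex.choose_spec.1 hex.choose_spec.2

end Uniqueness

/-! ### Exponential maps and parallel transport of a family of metrics -/

/-- The states of the combined equation of geodesics and parallel transport: position, velocity,
and the matrices of forward and backward parallel transport. -/
abbrev TransportState : Type := Eu 7 × Eu 7 × (Eu 7 →L[ℝ] Eu 7) × (Eu 7 →L[ℝ] Eu 7)

/-- Bilinear forms on `ℝ⁷`. -/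
abbrev BilinForm7 : Type := Eu 7 →L[ℝ] Eu 7 →L[ℝ] ℝ

/-- The vector field of the combined equation, with Christoffel symbols `Γ` of the geodesics and
`Γ'` of the parallel transport. -/
def transportField (Γ Γ' : Eu 7 →L[ℝ] Eu 7 →L[ℝ] Eu 7) (z : TransportState) : TransportState :=
  (z.2.1, -Γ z.2.1 z.2.1, -((Γ' z.2.1) ∘L z.2.2.1), z.2.2.2 ∘L (Γ' z.2.1))

/-- The initial state with velocity `v` at `x`. -/
def initialState (z : Eu 7 × Eu 7) : TransportState :=
  (z.1, z.2, ContinuousLinearMap.id ℝ _, ContinuousLinearMap.id ℝ _)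

theorem contDiff_initialState : ContDiff ℝ ∞ initialState := by
  unfold initialState
  fun_prop

theorem hasDerivAt_id_smul {F : Type*} [NormedAddCommGroup F] [NormedSpace ℝ F] {ψ : ℝ → F}
    (h : ContinuousAt ψ 0) : HasDerivAt (fun s : ℝ => s • ψ s) (ψ 0) 0 := by
  rw [hasDerivAt_iff_tendsto_slope]
  refine (h.tendsto.mono_left nhdsWithin_le_nhds).congr' ?_
  filter_upwards [self_mem_nhdsWithin] with s hs
  have : s ≠ 0 := hs
  simp [slope, smul_smul, this]

/-- The linearization of `transportField` at a state without velocity. -/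
def transportLinear (Γ' : Eu 7 →L[ℝ] Eu 7 →L[ℝ] Eu 7) : TransportState →L[ℝ] TransportState :=
  let b : TransportState →L[ℝ] Eu 7 :=
    (ContinuousLinearMap.fst ℝ _ _) ∘L (ContinuousLinearMap.snd ℝ _ _)
  b.prod ((0 : TransportState →L[ℝ] Eu 7).prod ((-(Γ' ∘L b)).prod (Γ' ∘L b)))

theorem transportLinear_apply (Γ' : Eu 7 →L[ℝ] Eu 7 →L[ℝ] Eu 7) (z : TransportState) :
    transportLinear Γ' z = (z.2.1, 0, -Γ' z.2.1, Γ' z.2.1) := rfl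

section ExpFamily

variable {M : Type*} [TopologicalSpace M] [ChartedSpace (Eu 7) M] [IsManifold 𝓘(ℝ, Eu 7) ∞ M]

/-- The Christoffel symbols at a point, as a bilinear map. -/
abbrev christoffelAt (g : Metric7 M) (x₀ : M) (y : Eu 7) : Eu 7 →L[ℝ] Eu 7 →L[ℝ] Eu 7 :=
  christoffelL (chartMetric g x₀ y) (fderiv ℝ (chartMetric g x₀) y)

/-- The vector field of the combined equation as a smooth function of the state and of the value
and derivative of the metric whose geodesics are considered. -/
def transportFieldOf (g : Metric7 M) (x₀ : M)
    (q : TransportState × BilinForm7 × (Eu 7 →L[ℝ] BilinForm7)) : TransportState :=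
  transportField (christoffelL q.2.1 q.2.2) (christoffelAt g x₀ q.1.1) q.1

/-- The domain of smoothness of `transportFieldOf`. -/
def transportDomain (x₀ : M) : Set (TransportState × BilinForm7 × (Eu 7 →L[ℝ] BilinForm7)) :=
  (ctarget x₀ ×ˢ univ) ×ˢ (range ((↑) : (Eu 7 ≃L[ℝ] (Eu 7 →L[ℝ] ℝ)) → BilinForm7) ×ˢ univ)

theorem isOpen_transportDomain (x₀ : M) : IsOpen (transportDomain x₀) :=
  ((isOpen_ctarget x₀).prod isOpen_univ).prod (ContinuousLinearEquiv.isOpen.prod isOpen_univ)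

theorem contDiffOn_transportFieldOf (g : Metric7 M) (x₀ : M) :
    ContDiffOn ℝ ∞ (transportFieldOf g x₀) (transportDomain x₀) := by
  rintro q ⟨⟨hx, -⟩, ⟨e, he⟩, -⟩
  have hv : ContDiffAt ℝ ∞ (fun q : TransportState × BilinForm7 × (Eu 7 →L[ℝ] BilinForm7) =>
      q.1.2.1) q := by fun_prop
  have hP : ContDiffAt ℝ ∞ (fun q : TransportState × BilinForm7 × (Eu 7 →L[ℝ] BilinForm7) =>
      q.1.2.2.1) q := by fun_prop
  have hQ : ContDiffAt ℝ ∞ (fun q : TransportState × BilinForm7 × (Eu 7 →L[ℝ] BilinForm7) =>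
      q.1.2.2.2) q := by fun_prop
  have h1 : ContDiffAt ℝ ∞ (fun q : TransportState × BilinForm7 × (Eu 7 →L[ℝ] BilinForm7) =>
      christoffelL q.2.1 q.2.2) q :=
    (contDiffAt_christoffelL (p := q.2) e he).comp q contDiffAt_snd
  have h2 : ContDiffAt ℝ ∞ (fun q : TransportState × BilinForm7 × (Eu 7 →L[ℝ] BilinForm7) =>
      christoffelAt g x₀ q.1.1) q :=
    ((contDiffOn_christoffel g x₀).contDiffAt ((isOpen_ctarget x₀).mem_nhds hx)).comp
      (f := fun q : TransportState × BilinForm7 × (Eu 7 →L[ℝ] BilinForm7) => q.1.1) q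
      (by fun_prop)
  have h3 := h2.clm_apply hv
  exact ContDiffAt.contDiffWithinAt (hv.prodMk ((((h1.clm_apply hv).clm_apply hv).neg).prodMk
    ((h3.clm_comp hP).neg.prodMk (hQ.clm_comp h3))))

variable {Λ : Type} [TopologicalSpace Λ] [CompactSpace Λ] [LocallyCompactSpace Λ]

/-- The vector field of the combined equations of all parameters at once, as a map on the space
of continuous functions of the parameter and the time. -/
def transportOperator (g : Metric7 M) (h : Λ → Metric7 M) (x₀ : M)
    (u : C(Λ × Icc (0 : ℝ) 1, TransportState)) : C(Λ × Icc (0 : ℝ) 1, TransportState) :=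
  let x := (ContinuousLinearMap.fst ℝ (Eu 7) _).compLeftContinuous ℝ _ u
  superpose (fun _ => transportFieldOf g x₀)
    (pairCLM (u, pairCLM (superpose (fun k => chartMetric (h k.1) x₀) x,
      superpose (fun k => fderiv ℝ (chartMetric (h k.1) x₀)) x)))

variable {h : Λ → Metric7 M} {x₀ : M}

theorem transportOperator_spec (g : Metric7 M)
    (hh : SmoothFamily (fun l => chartMetric (h l) x₀) (ctarget x₀))
    {u : C(Λ × Icc (0 : ℝ) 1, TransportState)} (hu : MapsTo u univ (ctarget x₀ ×ˢ univ)) :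
    ContDiffAt ℝ ∞ (transportOperator g h x₀) u ∧
      ∀ k, transportOperator g h x₀ u k =
        transportField (christoffelAt (h k.1) x₀ (u k).1) (christoffelAt g x₀ (u k).1) (u k) := by
  have hO := isOpen_ctarget x₀
  have hh1 : SmoothFamily (fun k : Λ × Icc (0 : ℝ) 1 => chartMetric (h k.1) x₀) (ctarget x₀) :=
    hh.comp_left continuous_fst
  have hh2 := hh1.fderiv hO
  set X := (ContinuousLinearMap.fst ℝ (Eu 7)
    (Eu 7 × (Eu 7 →L[ℝ] Eu 7) × (Eu 7 →L[ℝ] Eu 7))).compLeftContinuous ℝ (Λ × Icc (0 : ℝ) 1)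
    with hX
  have hxu : MapsTo (X u) univ (ctarget x₀) := fun k _ => (hu (mem_univ k)).1
  have hf : SmoothFamily (fun _ : Λ × Icc (0 : ℝ) 1 => transportFieldOf g x₀)
      (transportDomain x₀) :=
    SmoothFamily.of_contDiffOn (isOpen_transportDomain x₀) (contDiffOn_transportFieldOf g x₀)
  have hmaps : MapsTo (pairCLM (u, pairCLM (superpose (fun k : Λ × Icc (0 : ℝ) 1 =>
      chartMetric (h k.1) x₀) (X u),
      superpose (fun k : Λ × Icc (0 : ℝ) 1 => fderiv ℝ (chartMetric (h k.1) x₀)) (X u))))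
      univ (transportDomain x₀) := by
    intro k _
    simp only [pairCLM_apply]
    refine ⟨hu (mem_univ k), ?_, trivial⟩
    simp only [hh1.superpose_apply hxu]
    exact exists_equiv_chartMetric (h k.1) (hxu (mem_univ k))
  constructor
  · have c1 : ContDiffAt ℝ ∞ (fun u => superpose (fun k : Λ × Icc (0 : ℝ) 1 =>
        chartMetric (h k.1) x₀) (X u)) u :=
      (hh1.contDiffAt_superpose hO hxu).comp u X.contDiff.contDiffAt
    have c2 : ContDiffAt ℝ ∞ (fun u => superpose (fun k : Λ × Icc (0 : ℝ) 1 =>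
        fderiv ℝ (chartMetric (h k.1) x₀)) (X u)) u :=
      (hh2.contDiffAt_superpose hO hxu).comp u X.contDiff.contDiffAt
    have c4 := contDiffAt_pairCLM (contDiffAt_id (x := u)) (contDiffAt_pairCLM c1 c2)
    exact (hf.contDiffAt_superpose (isOpen_transportDomain x₀) hmaps).comp u c4
  · intro k
    have e1 := hf.superpose_apply hmaps k
    have e2 : transportOperator g h x₀ u k = _ := e1
    rw [e2]
    simp only [pairCLM_apply, hh1.superpose_apply hxu, hh2.superpose_apply hxu]
    rfl

theorem fderiv_transportOperator (g : Metric7 M)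
    (hh : SmoothFamily (fun l => chartMetric (h l) x₀) (ctarget x₀)) {y₀ : Eu 7}
    (hy₀ : y₀ ∈ ctarget x₀) :
    fderiv ℝ (transportOperator g h x₀) (ContinuousMap.const _ (initialState (y₀, 0))) =
      (transportLinear (christoffelAt g x₀ y₀)).compLeftContinuous ℝ _ := by
  set c : C(Λ × Icc (0 : ℝ) 1, TransportState) := ContinuousMap.const _ (initialState (y₀, 0))
    with hc
  have hOpen : IsOpen (ctarget x₀ ×ˢ (univ : Set (Eu 7 × (Eu 7 →L[ℝ] Eu 7) ×
    (Eu 7 →L[ℝ] Eu 7)))) := (isOpen_ctarget x₀).prod isOpen_univ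
  have hmaps : MapsTo c univ (ctarget x₀ ×ˢ univ) := fun k _ => ⟨hy₀, trivial⟩
  have hd := (((transportOperator_spec g hh hmaps).1.differentiableAt (by simp))).hasFDerivAt
  ext1 u
  ext1 k
  have hline : HasDerivAt (fun s : ℝ => c + s • u) u 0 := by
    simpa using ((hasDerivAt_id (0 : ℝ)).smul_const u).const_add c
  have hd0 : HasFDerivAt (transportOperator g h x₀) (fderiv ℝ (transportOperator g h x₀) c)
      (c + (0 : ℝ) • u) := by simpa using hd
  have h0 : HasDerivAt (fun s : ℝ => transportOperator g h x₀ (c + s • u))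
      (fderiv ℝ (transportOperator g h x₀) c u) 0 :=
    HasFDerivAt.comp_hasDerivAt (f := fun s : ℝ => c + s • u) (0 : ℝ) hd0 hline
  have h1 : HasDerivAt (fun s : ℝ => transportOperator g h x₀ (c + s • u) k)
      (fderiv ℝ (transportOperator g h x₀) c u k) 0 :=
    (ContinuousMap.evalCLM ℝ k :
      C(Λ × Icc (0 : ℝ) 1, TransportState) →L[ℝ] TransportState).hasFDerivAt.comp_hasDerivAt
      (0 : ℝ) h0
  rcases huk : u k with ⟨a, b, P, Q⟩
  -- All components of the field contain the velocity as a factor. On the line `c + s u` the velocity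
  -- is `s b`, so the field is `s ψ(s)` with `ψ` continuous, and its derivative at `0` is `ψ(0)`.
  let ψ : ℝ → TransportState := fun s =>
    (b, -(s • christoffelAt (h k.1) x₀ (y₀ + s • a) b b),
      -((christoffelAt g x₀ (y₀ + s • a) b) ∘L (ContinuousLinearMap.id ℝ _ + s • P)),
      (ContinuousLinearMap.id ℝ _ + s • Q) ∘L (christoffelAt g x₀ (y₀ + s • a) b))
  have hψ : ContinuousAt ψ 0 := by
    have hcont : ∀ g' : Metric7 M, ContinuousAt (fun s : ℝ => christoffelAt g' x₀ (y₀ + s • a)) 0 :=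
      fun g' => ContinuousAt.comp (f := fun s : ℝ => y₀ + s • a)
        ((contDiffOn_christoffel g' x₀).continuousOn.continuousAt
          ((isOpen_ctarget x₀).mem_nhds (by simpa using hy₀))) (by fun_prop)
    have h2 := hcont (h k.1)
    have h3 := hcont g
    have h3b := h3.clm_apply (continuousAt_const (y := b))
    exact continuousAt_const.prodMk ((continuousAt_id.smul
      ((h2.clm_apply continuousAt_const).clm_apply continuousAt_const)).neg.prodMk
      ((h3b.clm_comp (by fun_prop)).neg.prodMk (ContinuousAt.clm_comp (by fun_prop) h3b)))
  have h2 := hasDerivAt_id_smul hψ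
  have hev : ∀ᶠ s : ℝ in 𝓝 0, transportOperator g h x₀ (c + s • u) k = s • ψ s := by
    have := hline.continuousAt.eventually ((isOpen_mapsTo_univ hOpen).mem_nhds
      (by simpa using hmaps))
    filter_upwards [this] with s hs
    rw [(transportOperator_spec g hh hs).2 k]
    have hval : (c + s • u) k = (y₀ + s • a, s • b, ContinuousLinearMap.id ℝ _ + s • P,
        ContinuousLinearMap.id ℝ _ + s • Q) := by
      rw [ContinuousMap.add_apply, ContinuousMap.smul_apply, huk]
      simp [hc, initialState]
    rw [hval]
    simp only [transportField, ψ, map_smul, Prod.smul_mk, smul_neg, _root_.smul_apply,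
      ContinuousLinearMap.smul_comp, ContinuousLinearMap.comp_smul]
  have h3 := h1.unique (h2.congr_of_eventuallyEq hev)
  rw [h3]
  change ψ 0 = transportLinear (christoffelAt g x₀ y₀) (u k)
  rw [huk, transportLinear_apply]
  simp only [ψ, zero_smul, add_zero, neg_zero, ContinuousLinearMap.comp_id,
    ContinuousLinearMap.id_comp]

/-- In the chart around `x₀`, the exponential map of `h` maps the tangent vector with position and
components `z` to the point `x`, and the matrix of the parallel transport of `g` back along the
geodesic is `Q`. -/
def IsExpFormula (g h : Metric7 M) (x₀ : M) (z : Eu 7 × Eu 7) (x : Eu 7) (Q : Eu 7 →L[ℝ] Eu 7) :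
    Prop :=
  x ∈ ctarget x₀ ∧ ∀ p ∈ csource x₀, ∀ w : TS 7 p, cmap x₀ p = z.1 → comps x₀ w = z.2 →
    ExpDefined h p w ∧ expCurve h p w 1 = chartPt x₀ x ∧
    ∀ w' : TS 7 (expCurve h p w 1),
      comps x₀ (transportBack g (expCurve h p w) w') = Q (comps x₀ w')

/-- Near a point of a chart, the exponential maps of a compact smooth family of metrics `h` and the
parallel transport of a metric `g` along their geodesics are given in the chart by smooth functions
with values in the continuous functions of the parameter. -/
theorem exists_exp_family [T2Space M] (g : Metric7 M)
    (hh : SmoothFamily (fun l => chartMetric (h l) x₀) (ctarget x₀)) {y₀ : Eu 7}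
    (hy₀ : y₀ ∈ ctarget x₀) :
    ∃ (X : Eu 7 × Eu 7 → C(Λ, Eu 7)) (Q : Eu 7 × Eu 7 → C(Λ, Eu 7 →L[ℝ] Eu 7)),
      ContDiffAt ℝ ∞ X (y₀, 0) ∧ ContDiffAt ℝ ∞ Q (y₀, 0) ∧
      ∀ᶠ z in 𝓝 (y₀, (0 : Eu 7)), ∀ l : Λ, IsExpFormula g (h l) x₀ z (X z l) (Q z l) := by
  have hmaps : MapsTo (ContinuousMap.const (Λ × Icc (0 : ℝ) 1) (initialState (y₀, 0))) univ
    (ctarget x₀ ×ˢ univ) := fun k _ => ⟨hy₀, trivial⟩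
  have hOpen : IsOpen (ctarget x₀ ×ˢ (univ : Set (Eu 7 × (Eu 7 →L[ℝ] Eu 7) ×
    (Eu 7 →L[ℝ] Eu 7)))) := (isOpen_ctarget x₀).prod isOpen_univ
  obtain ⟨hN, hNv⟩ := transportOperator_spec g hh hmaps
  obtain ⟨u, hu, hu0, hsol⟩ := exists_solution_near_const hN
    (by
      ext1 k
      rw [hNv k]
      simp [initialState, transportField])
    (fderiv_transportOperator g hh hy₀)
    (fun z => by simp [transportLinear_apply])
  have hi := contDiff_initialState.contDiffAt (x := (y₀, (0 : Eu 7)))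
  have hui : ContDiffAt ℝ ∞ (fun z => u (initialState z)) (y₀, (0 : Eu 7)) := hu.comp _ hi
  -- evaluation at time `1`
  let r : C(Λ, Λ × Icc (0 : ℝ) 1) := ⟨fun l => (l, 1), by fun_prop⟩
  let R : C(Λ × Icc (0 : ℝ) 1, TransportState) →L[ℝ] C(Λ, TransportState) :=
    ContinuousMap.compCLM ℝ TransportState r
  refine ⟨fun z => (ContinuousLinearMap.fst ℝ _ _).compLeftContinuous ℝ _ (R (u (initialState z))),
    fun z => ((ContinuousLinearMap.snd ℝ _ _) ∘L (ContinuousLinearMap.snd ℝ _ _) ∘L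
      (ContinuousLinearMap.snd ℝ _ _)).compLeftContinuous ℝ _ (R (u (initialState z))),
    (ContinuousLinearMap.contDiff _).contDiffAt.comp _ (R.contDiff.contDiffAt.comp _ hui),
    (ContinuousLinearMap.contDiff _).contDiffAt.comp _ (R.contDiff.contDiffAt.comp _ hui), ?_⟩
  have hev1 := hi.continuousAt.eventually hsol
  have hev2 := hui.continuousAt.eventually ((isOpen_mapsTo_univ hOpen).mem_nhds
    (by change MapsTo (u (initialState (y₀, 0))) _ _; rw [hu0]; exact hmaps))
  filter_upwards [hev1, hev2] with z hz1 hz2 l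
  refine ⟨(hz2 (mem_univ (l, 1))).1, fun p hp w hpz hwz => ?_⟩
  -- The solution for a single parameter, as a curve.
  let ζ : ℝ → TransportState := fun t => u (initialState z) (l, projIcc 0 1 zero_le_one t)
  have hζ : ∀ t ∈ Icc (0 : ℝ) 1, HasDerivWithinAt ζ (transportField
      (christoffelAt (h l) x₀ (ζ t).1) (christoffelAt g x₀ (ζ t).1) (ζ t)) (Icc 0 1) t := by
    intro t ht
    have h1 := (hasDerivWithinAt_primitive (transportOperator g h x₀ (u (initialState z))) l
      ht).const_add (initialState z)
    rw [(transportOperator_spec g hh hz2).2] at h1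
    have h2 : ∀ s, ζ s = initialState z + primitive (transportOperator g h x₀
        (u (initialState z))) (l, projIcc 0 1 zero_le_one s) := fun s => by
      have := congrArg (fun f => f (l, projIcc 0 1 zero_le_one s)) hz1
      exact this
    have h3 : ζ t = u (initialState z) (l, ⟨t, ht⟩) := by
      simp only [ζ, projIcc_of_mem zero_le_one ht]
    rw [← h3] at h1
    exact h1.congr (fun s _ => h2 s) (h2 t)
  have hζ0 : ζ 0 = initialState z := by
    have := congrArg (fun f => f (l, projIcc 0 1 zero_le_one 0)) hz1
    simp only [ContinuousMap.add_apply, primitive_apply] at this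
    rw [projIcc_of_mem zero_le_one (show (0 : ℝ) ∈ Icc (0 : ℝ) 1 by simp)] at this
    simp only [intervalIntegral.integral_same, add_zero] at this
    simp only [ζ]
    rw [projIcc_of_mem zero_le_one (show (0 : ℝ) ∈ Icc (0 : ℝ) 1 by simp)]
    exact this
  have hζ1 : ζ 1 = u (initialState z) (l, 1) := by
    simp only [ζ]
    rw [projIcc_of_mem zero_le_one (show (1 : ℝ) ∈ Icc (0 : ℝ) 1 by simp)]
    rfl
  have hc : ∀ t ∈ Icc (0 : ℝ) 1, (ζ t).1 ∈ ctarget x₀ := fun t _ => (hz2 (mem_univ _)).1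
  have hcv : ∀ t ∈ Icc (0 : ℝ) 1, HasDerivWithinAt (fun t => (ζ t).1) (ζ t).2.1 (Icc 0 1) t :=
    fun t ht => (hζ t ht).fst
  have hv : ∀ t ∈ Icc (0 : ℝ) 1, HasDerivWithinAt (fun t => (ζ t).2.1)
      (-christoffel (h l) x₀ (ζ t).1 (ζ t).2.1 (ζ t).2.1) (Icc 0 1) t := by
    intro t ht
    rw [christoffel_eq]
    exact (hζ t ht).snd.fst
  have h0 : (ζ 0).1 = cmap x₀ p := by rw [hζ0, hpz]; rfl
  have hv0 : (ζ 0).2.1 = comps x₀ w := by rw [hζ0, hwz]; rfl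
  obtain ⟨hdef, hcurve⟩ := expCurve_eq_of_chart hp hc hcv hv h0 hv0
  refine ⟨hdef, ?_, fun w' => ?_⟩
  · rw [hcurve 1 (by simp), hζ1]
    rfl
  · rw [comps_transportBack g hc hcurve hcv (P := fun t => (ζ t).2.2.1) (Q := fun t => (ζ t).2.2.2)
      (fun t ht => (hζ t ht).snd.snd.fst) (fun t ht => (hζ t ht).snd.snd.snd)
      (by rw [hζ0]; rfl) (by rw [hζ0]; rfl), hζ1]
    rfl

end ExpFamily

/-! ### The thin submanifolds and their normal bundles -/

/-- An injective image of a `3`-dimensional space and four orthonormal vectors orthogonal to it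
span a `7`-dimensional space. -/
theorem exists_eq_add_sum_of_orthonormal {W P : Type*} [AddCommGroup W] [Module ℝ W]
    [FiniteDimensional ℝ W] [AddCommGroup P] [Module ℝ P] [FiniteDimensional ℝ P]
    (hW : Module.finrank ℝ W = 7) (hP : Module.finrank ℝ P = 3) (B : W →ₗ[ℝ] W →ₗ[ℝ] ℝ)
    (d : P →ₗ[ℝ] W) (hd : Function.Injective d) (e : Fin 4 → W)
    (he : ∀ i j, B (e i) (e j) = if i = j then 1 else 0) (hde : ∀ a i, B (d a) (e i) = 0)
    (X : W) : ∃ a, X = d a + ∑ i, B X (e i) • e i := by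
  let L : P × (Fin 4 → ℝ) →ₗ[ℝ] W :=
    d.coprod (Fintype.linearCombination ℝ e)
  have hL : ∀ z, L z = d z.1 + ∑ i, z.2 i • e i := fun z => by
    simp [L, Fintype.linearCombination_apply]
  have hcoef : ∀ z j, B (L z) (e j) = z.2 j := fun z j => by
    rw [hL]
    simp [hde, he]
  have hinj : Function.Injective L := by
    rw [← LinearMap.ker_eq_bot, LinearMap.ker_eq_bot']
    intro z hz
    have h2 : z.2 = 0 := by
      ext j
      rw [← hcoef z j, hz]
      simp
    rw [hL, h2] at hz
    have h1 : z.1 = 0 := hd (by simpa using hz)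
    exact Prod.ext h1 h2
  have hsurj := (LinearMap.injective_iff_surjective_of_finrank_eq_finrank
    (by rw [Module.finrank_prod, hP, hW]; simp)).1 hinj
  obtain ⟨z, rfl⟩ := hsurj X
  refine ⟨z.1, ?_⟩
  simp only [hcoef]
  exact hL z

section Thin

variable {M : Type*} [TopologicalSpace M] [ChartedSpace (Eu 7) M] [IsManifold 𝓘(ℝ, Eu 7) ∞ M]
variable {C : Type*} [TopologicalSpace C] [ChartedSpace (Eu 4) C] [IsManifold 𝓘(ℝ, Eu 4) ∞ C]
variable {S : Type*} [TopologicalSpace S] [ChartedSpace (Eu 2) S] [IsManifold 𝓘(ℝ, Eu 2) ∞ S]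
variable {G : G2Structure M} {ε₀ : ℝ} {K : CoassociativeFamily G C ε₀}

theorem inner_self_eq_zero_iff (g : Metric7 M) {x : M} {v : TS 7 x} (h : g.inner x v v = 0) :
    v = 0 := by
  by_contra hv
  exact (g.pos x v hv).ne' h

/-- A metric at a point as a bilinear form. -/
def innerBilin (g : Metric7 M) (x : M) : TS 7 x →ₗ[ℝ] TS 7 x →ₗ[ℝ] ℝ :=
  LinearMap.mk₂ ℝ (fun v w => g.inner x v w)
    (fun v v' w => by rw [map_add]; rfl) (fun c v w => by rw [map_smul]; rfl)
    (fun v w w' => map_add _ _ _) (fun c v w => map_smul _ _ _)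

theorem innerBilin_apply (g : Metric7 M) (x : M) (v w : TS 7 x) :
    innerBilin g x v w = g.inner x v w := rfl

namespace HolomorphicCurve

variable (J : HolomorphicCurve K S)

theorem contMDiff_prodMk_emb : ContMDiff (modelR 2) (modelR 4) ∞
    (fun p : ℝ × S => ((p.1, J.emb p.2) : ℝ × C)) :=
  contMDiff_fst.prodMk (J.smooth.comp contMDiff_snd)

theorem contMDiffOn_thin :
    ContMDiffOn (modelR 2) 𝓘(ℝ, Eu 7) ∞ J.thin (Icc 0 ε₀ ×ˢ univ) :=
  have h : MapsTo (fun p : ℝ × S => ((p.1, J.emb p.2) : ℝ × C)) (Icc 0 ε₀ ×ˢ univ)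
      (Icc 0 ε₀ ×ˢ univ) := fun _ hp => ⟨hp.1, trivial⟩
  K.smooth.comp J.contMDiff_prodMk_emb.contMDiffOn h

theorem uniqueMDiffWithinAt_strip {n : ℕ} {N : Type*} [TopologicalSpace N] [ChartedSpace (Eu n) N]
    {ε : ℝ} (hε : 0 < ε) {p : ℝ × N} (hp : p.1 ∈ Icc 0 ε) :
    UniqueMDiffWithinAt (modelR n) (Icc 0 ε ×ˢ (univ : Set N)) p :=
  UniqueMDiffWithinAt.prod
    (uniqueMDiffWithinAt_iff_uniqueDiffWithinAt.2 (uniqueDiffOn_Icc hε _ hp))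
    (uniqueMDiffWithinAt_univ _)

theorem dthin_tvec (hε₀ : 0 < ε₀) {p : ℝ × S} (hp : p.1 ∈ Icc 0 ε₀) (r : ℝ) (a : TS 2 p.2) :
    J.dthin p (tvec p r a) = K.d (p.1, J.emb p.2)
      (tvec (p.1, J.emb p.2) r (mfderiv 𝓘(ℝ, Eu 2) 𝓘(ℝ, Eu 4) J.emb p.2 a)) := by
  have h1 : HasMFDerivAt (modelR 2) (modelR 4) (fun p : ℝ × S => ((p.1, J.emb p.2) : ℝ × C)) p
      ((ContinuousLinearMap.fst ℝ ℝ (Eu 2)).prod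
        ((mfderiv 𝓘(ℝ, Eu 2) 𝓘(ℝ, Eu 4) J.emb p.2).comp (ContinuousLinearMap.snd ℝ ℝ (Eu 2)))) :=
    (hasMFDerivAt_fst p).prodMk (((J.smooth.mdifferentiableAt (x := p.2)
      (by simp)).hasMFDerivAt).comp p (hasMFDerivAt_snd p))
  have h2 : HasMFDerivWithinAt (modelR 4) 𝓘(ℝ, Eu 7) K.map (Icc 0 ε₀ ×ˢ univ)
      (p.1, J.emb p.2) (K.d (p.1, J.emb p.2)) :=
    ((K.smooth.mdifferentiableOn (by simp)) (p.1, J.emb p.2) ⟨hp, trivial⟩).hasMFDerivWithinAt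
  have hmaps : MapsTo (fun p : ℝ × S => ((p.1, J.emb p.2) : ℝ × C)) (Icc 0 ε₀ ×ˢ univ)
      (Icc 0 ε₀ ×ˢ univ) := fun _ hq => ⟨hq.1, trivial⟩
  have h3 := (h2.comp p h1.hasMFDerivWithinAt hmaps).mfderivWithin (uniqueMDiffWithinAt_strip hε₀ hp)
  have h4 := congrArg (fun L : (ℝ × Eu 2) →L[ℝ] Eu 7 => L (r, a)) h3
  exact h4

theorem dthin_injective (hε₀ : 0 < ε₀) {p : ℝ × S} (hp : p.1 ∈ Icc 0 ε₀) :
    Function.Injective (J.dthin p) := by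
  intro a b hab
  have h1 := J.dthin_tvec hε₀ hp (a : ℝ × Eu 2).1 (a : ℝ × Eu 2).2
  have h2 := J.dthin_tvec hε₀ hp (b : ℝ × Eu 2).1 (b : ℝ × Eu 2).2
  have h3 := K.immersion (p.1, J.emb p.2) ⟨hp, trivial⟩ (h1.symm.trans (Eq.trans hab h2))
  have h4 : (a : ℝ × Eu 2).1 = (b : ℝ × Eu 2).1 := congrArg (fun z : ℝ × Eu 4 => z.1) h3
  have h5 := J.immersion p.2 (congrArg (fun z : ℝ × Eu 4 => z.2) h3)
  exact Prod.ext h4 h5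

section Normal

variable {J}
variable {p : ℝ × S}

theorem exists_eq_dthin_add_sum (hε₀ : 0 < ε₀) (hp : p.1 ∈ Icc 0 ε₀)
    {e : Fin 4 → TS 7 (J.thin p)} (hn : ∀ i, J.IsNormal p (e i))
    (ho : ∀ i j, G.metric.inner (J.thin p) (e i) (e j) = if i = j then 1 else 0)
    (X : TS 7 (J.thin p)) : ∃ a, X = J.dthin p a + ∑ i, G.metric.inner (J.thin p) X (e i) • e i :=
  haveI : FiniteDimensional ℝ (TS 7 (J.thin p)) := inferInstanceAs (FiniteDimensional ℝ (Eu 7))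
  haveI : FiniteDimensional ℝ (TangentSpace (modelR 2) p) :=
    inferInstanceAs (FiniteDimensional ℝ (ℝ × Eu 2))
  exists_eq_add_sum_of_orthonormal (W := TS 7 (J.thin p)) (P := TangentSpace (modelR 2) p)
    (by
      change Module.finrank ℝ (Eu 7) = 7
      simp)
    (by
      change Module.finrank ℝ (ℝ × Eu 2) = 3
      simp)
    (innerBilin G.metric (J.thin p)) (J.dthin p).toLinearMap (J.dthin_injective hε₀ hp) e ho (fun a i => hn i a) X

theorem IsNormal.eq_sum (hε₀ : 0 < ε₀) (hp : p.1 ∈ Icc 0 ε₀)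
    {e : Fin 4 → TS 7 (J.thin p)} (hn : ∀ i, J.IsNormal p (e i))
    (ho : ∀ i j, G.metric.inner (J.thin p) (e i) (e j) = if i = j then 1 else 0)
    {X : TS 7 (J.thin p)} (hX : J.IsNormal p X) :
    X = ∑ i, G.metric.inner (J.thin p) X (e i) • e i := by
  obtain ⟨a, ha⟩ := exists_eq_dthin_add_sum hε₀ hp hn ho X
  have h1 : innerBilin G.metric (J.thin p) (J.dthin p a) X = 0 := hX a
  have h2 : innerBilin G.metric (J.thin p) (J.dthin p a) (J.dthin p a) = 0 := by
    have h3 : J.dthin p a = X - ∑ i, G.metric.inner (J.thin p) X (e i) • e i :=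
      eq_sub_of_add_eq ha.symm
    nth_rewrite 2 [h3]
    rw [map_sub, h1, map_sum]
    simp only [map_smul]
    have : ∀ i, innerBilin G.metric (J.thin p) (J.dthin p a) (e i) = 0 := fun i => hn i a
    simp [this]
  have h3 := inner_self_eq_zero_iff G.metric h2
  rw [h3, zero_add] at ha
  exact ha

theorem IsNormal.add {X Y : TS 7 (J.thin p)} (hX : J.IsNormal p X) (hY : J.IsNormal p Y) :
    J.IsNormal p (X + Y) := fun a => by
  rw [map_add, hX a, hY a, add_zero]

theorem IsNormal.smul {X : TS 7 (J.thin p)} (hX : J.IsNormal p X) (c : ℝ) :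
    J.IsNormal p (c • X) := fun a => by
  rw [map_smul, hX a, smul_zero]

theorem IsNormal.sum {ι : Type*} (s : Finset ι) {X : ι → TS 7 (J.thin p)}
    (hX : ∀ i ∈ s, J.IsNormal p (X i)) : J.IsNormal p (∑ i ∈ s, X i) := fun a => by
  rw [map_sum]
  exact Finset.sum_eq_zero fun i hi => hX i hi a

theorem normalProj_eq_sum (hε₀ : 0 < ε₀) (hp : p.1 ∈ Icc 0 ε₀)
    {e : Fin 4 → TS 7 (J.thin p)} (hn : ∀ i, J.IsNormal p (e i))
    (ho : ∀ i j, G.metric.inner (J.thin p) (e i) (e j) = if i = j then 1 else 0)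
    (X : TS 7 (J.thin p)) :
    J.normalProj p X = ∑ i, G.metric.inner (J.thin p) X (e i) • e i := by
  have hs := Classical.epsilon_spec (p := fun w : TS 7 (J.thin p) =>
    J.IsNormal p w ∧ ∃ a : TangentSpace (modelR 2) p, X - w = J.dthin p a)
    ⟨∑ i, G.metric.inner (J.thin p) X (e i) • e i,
      IsNormal.sum _ fun i _ => (hn i).smul _, by
        obtain ⟨a, ha⟩ := exists_eq_dthin_add_sum hε₀ hp hn ho X
        exact ⟨a, sub_eq_of_eq_add ha⟩⟩
  obtain ⟨hw, a, ha⟩ := hs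
  change J.IsNormal p (J.normalProj p X) at hw
  change X - J.normalProj p X = J.dthin p a at ha
  rw [hw.eq_sum hε₀ hp hn ho]
  refine Finset.sum_congr rfl fun i _ => ?_
  congr 1
  have h1 : X = J.dthin p a + J.normalProj p X := eq_add_of_sub_eq ha
  have h2 : innerBilin G.metric (J.thin p) X (e i) =
      innerBilin G.metric (J.thin p) (J.dthin p a + J.normalProj p X) (e i) := by rw [← h1]
  rw [map_add, LinearMap.add_apply] at h2
  have h3 : innerBilin G.metric (J.thin p) (J.dthin p a) (e i) = 0 := hn i a
  rw [h3, zero_add] at h2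
  exact h2.symm

end Normal

/-- `Ω(n, u, v) ≠ 0` for linearly independent tangent vectors `u`, `v` of `Σ`: otherwise `n × u`,
which is tangent to `Σ` by holomorphicity, would be orthogonal to `Σ`, and so would vanish. -/
theorem form_ne_zero (hε₀ : 0 < ε₀) (s : S) {u v : TS 2 s}
    (huv : ∀ w : TS 2 s, ∃ a b : ℝ, w = a • u + b • v) (hu : u ≠ 0) :
    G.form (J.thin (0, s)) (J.dthin (0, s) (tvec (0, s) 1 0)) (J.dthin (0, s) (tvec (0, s) 0 u))
      (J.dthin (0, s) (tvec (0, s) 0 v)) ≠ 0 := by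
  have h0 : (0 : ℝ) ∈ Icc 0 ε₀ := ⟨le_rfl, hε₀.le⟩
  have hinj := J.dthin_injective (p := (0, s)) hε₀ h0
  set n := J.dthin (0, s) (tvec (0, s) 1 0) with hn
  set U : TS 2 s → TS 7 (J.thin (0, s)) := fun w => J.dthin (0, s) (tvec (0, s) 0 w) with hU
  have hUadd : ∀ (a b : ℝ), U (a • u + b • v) = a • U u + b • U v := by
    intro a b
    have : (tvec (0, s) 0 (a • u + b • v) : TangentSpace (modelR 2) ((0 : ℝ), s)) =
        a • tvec (0, s) 0 u + b • tvec (0, s) 0 v := by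
      refine Prod.ext ?_ rfl
      change (0 : ℝ) = a * 0 + b * 0
      ring
    simp only [hU]
    rw [this, map_add, map_smul, map_smul]
  have hnK : n = K.n (J.emb s) := by
    rw [hn, J.dthin_tvec hε₀ h0 1 0]
    have : mfderiv 𝓘(ℝ, Eu 2) 𝓘(ℝ, Eu 4) J.emb s (0 : TS 2 s) = 0 := map_zero _
    exact congrArg (fun w : Eu 4 => K.d (0, J.emb s) (tvec (0, J.emb s) 1 w)) this
  have hUK : ∀ w, U w = K.d (0, J.emb s) (tvec (0, J.emb s) 0
      (mfderiv 𝓘(ℝ, Eu 2) 𝓘(ℝ, Eu 4) J.emb s w)) := fun w => J.dthin_tvec hε₀ h0 0 w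
  have hU0 : U u ≠ 0 := by
    intro h
    have h2 : J.dthin (0, s) (tvec (0, s) 0 u) = J.dthin (0, s) 0 := by
      rw [map_zero]; exact h
    exact hu (congrArg (fun z : ℝ × Eu 2 => z.2) (hinj h2))
  have hn0 : n ≠ 0 := by
    intro h
    have h2 : J.dthin (0, s) (tvec (0, s) 1 0) = J.dthin (0, s) 0 := by
      rw [map_zero]; exact h
    exact one_ne_zero (congrArg (fun z : ℝ × Eu 2 => z.1) (hinj h2))
  have hnn := G.metric.pos _ n hn0
  have hUU := G.metric.pos _ (U u) hU0
  have hnU : G.metric.inner (J.thin (0, s)) n (U u) = 0 := by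
    have := K.velocity_normal (J.emb s) (mfderiv 𝓘(ℝ, Eu 2) 𝓘(ℝ, Eu 4) J.emb s u)
    rw [hnK, hUK u]
    exact this
  obtain ⟨w, hw⟩ := J.holomorphic s u
  rw [← hUK u, ← hUK w, ← hnK] at hw
  obtain ⟨a, b, rfl⟩ := huv w
  rw [hUadd] at hw
  set N : ℝ := Real.sqrt (G.metric.inner (J.thin (0, s)) n n) with hN
  have hN0 : N ≠ 0 := (Real.sqrt_pos.2 hnn).ne'
  have hcross : G.cross (J.thin (0, s)) n (U u) = N • (a • U u + b • U v) := by
    rw [← hw]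
    exact (smul_inv_smul₀ hN0 _).symm
  intro hform
  change innerBilin G.metric (J.thin (0, s)) (G.cross (J.thin (0, s)) n (U u)) (U v) = 0 at hform
  have hperp : innerBilin G.metric (J.thin (0, s)) (G.cross (J.thin (0, s)) n (U u)) (U u) = 0 :=
    G.cross_perp_right _ n (U u)
  have harea := G.cross_area (J.thin (0, s)) n (U u)
  rw [hnU] at harea
  have hzero : innerBilin G.metric (J.thin (0, s)) (G.cross (J.thin (0, s)) n (U u))
      (G.cross (J.thin (0, s)) n (U u)) = 0 := by
    nth_rewrite 2 [hcross]
    rw [map_smul, map_add, map_smul, map_smul, hform, hperp]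
    simp
  rw [innerBilin_apply, harea] at hzero
  have := mul_pos hnn hUU
  simp only [ne_eq, OfNat.ofNat_ne_zero, not_false_eq_true, zero_pow, sub_zero] at hzero
  exact this.ne' hzero

end HolomorphicCurve

end Thin

/-! ### Coordinates on a strip -/

section Strip

variable {S : Type*} [TopologicalSpace S] [ChartedSpace (Eu 2) S] [IsManifold 𝓘(ℝ, Eu 2) ∞ S]

/-- The strip `[0, ε] × N`. -/
abbrev strip (N : Type*) (ε : ℝ) : Set (ℝ × N) := Icc 0 ε ×ˢ univ

/-- The point of `ℝ × S` with given coordinates. -/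
def stripPt (e : OpenPartialHomeomorph S (Eu 2)) (q : ℝ × Eu 2) : ℝ × S := (q.1, e.symm q.2)

/-- The coordinates of a point of `ℝ × S`. -/
def stripCoord (e : OpenPartialHomeomorph S (Eu 2)) (p : ℝ × S) : ℝ × Eu 2 := (p.1, e p.2)

variable {e : OpenPartialHomeomorph S (Eu 2)} {ε : ℝ} {p : ℝ × S} {q : ℝ × Eu 2}

theorem stripPt_stripCoord (hp : p.2 ∈ e.source) : stripPt e (stripCoord e p) = p :=
  Prod.ext rfl (e.left_inv hp)

theorem stripCoord_stripPt (hq : q.2 ∈ e.target) : stripCoord e (stripPt e q) = q :=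
  Prod.ext rfl (e.right_inv hq)

theorem uniqueDiffOn_strip {E : Type*} [NormedAddCommGroup E] [NormedSpace ℝ E] (hε : 0 < ε) :
    UniqueDiffOn ℝ (strip E ε) :=
  (uniqueDiffOn_Icc hε).prod uniqueDiffOn_univ

/-- The derivative of `e` at `s`, in terms of the preferred chart at `s`. -/
def chartDeriv (e : OpenPartialHomeomorph S (Eu 2)) (s : S) : Eu 2 →L[ℝ] Eu 2 :=
  mfderiv 𝓘(ℝ, Eu 2) 𝓘(ℝ, Eu 2) e s

/-- The derivative of `stripCoord e` at `p`. -/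
def stripDeriv (e : OpenPartialHomeomorph S (Eu 2)) (p : ℝ × S) :
    TangentSpace (modelR 2) p →L[ℝ] ℝ × Eu 2 :=
  (ContinuousLinearMap.fst ℝ ℝ (Eu 2)).prod
    ((chartDeriv e p.2).comp (ContinuousLinearMap.snd ℝ ℝ (Eu 2)))

theorem stripDeriv_tvec (r : ℝ) (a : TS 2 p.2) : stripDeriv e p (tvec p r a) =
    (r, chartDeriv e p.2 a) := rfl

theorem hasMFDerivAt_stripCoord (he : e ∈ IsManifold.maximalAtlas 𝓘(ℝ, Eu 2) ∞ S)
    (hp : p.2 ∈ e.source) :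
    HasMFDerivAt (modelR 2) 𝓘(ℝ, ℝ × Eu 2) (stripCoord e) p (stripDeriv e p) := by
  have h1 : HasMFDerivAt 𝓘(ℝ, Eu 2) 𝓘(ℝ, Eu 2) e p.2 (mfderiv 𝓘(ℝ, Eu 2) 𝓘(ℝ, Eu 2) e p.2) :=
    ((((contMDiffOn_of_mem_maximalAtlas he).contMDiffAt
      (e.open_source.mem_nhds hp)).mdifferentiableAt (by simp))).hasMFDerivAt
  have h2 : HasMFDerivAt (modelR 2) 𝓘(ℝ, ℝ) (fun p : ℝ × S => p.1) p
      (ContinuousLinearMap.fst ℝ ℝ (Eu 2)) := hasMFDerivAt_fst p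
  have h3 : HasMFDerivAt (modelR 2) 𝓘(ℝ, Eu 2) (fun p : ℝ × S => e p.2) p
      ((chartDeriv e p.2).comp (ContinuousLinearMap.snd ℝ ℝ (Eu 2))) :=
    h1.comp p (hasMFDerivAt_snd p)
  exact ⟨h2.1.prodMk h3.1, h2.2.prodMk h3.2⟩

theorem tendsto_stripCoord (hp : p.2 ∈ e.source) :
    Tendsto (stripCoord e) (𝓝[strip S ε] p) (𝓝[strip (Eu 2) ε] (stripCoord e p)) := by
  refine tendsto_nhdsWithin_iff.2 ⟨?_, ?_⟩
  · have h : ContinuousAt (stripCoord e) p :=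
      continuousAt_fst.prodMk ((e.continuousAt hp).comp (f := Prod.snd) continuousAt_snd)
    exact h.tendsto.mono_left nhdsWithin_le_nhds
  · filter_upwards [self_mem_nhdsWithin] with p' hp'
    exact ⟨hp'.1, trivial⟩

theorem continuousAt_stripPt (hq : q.2 ∈ e.target) : ContinuousAt (stripPt e) q :=
  continuousAt_fst.prodMk
    ((e.symm.continuousAt (x := q.2) (by simpa using hq)).comp (f := Prod.snd) continuousAt_snd)

theorem tendsto_stripPt (hq : q.2 ∈ e.target) :
    Tendsto (stripPt e) (𝓝[strip (Eu 2) ε] q) (𝓝[strip S ε] (stripPt e q)) := by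
  refine tendsto_nhdsWithin_iff.2 ⟨?_, ?_⟩
  · exact (continuousAt_stripPt hq).tendsto.mono_left nhdsWithin_le_nhds
  · filter_upwards [self_mem_nhdsWithin] with p' hp'
    exact ⟨hp'.1, trivial⟩

theorem contMDiffAt_stripPt (he : e ∈ IsManifold.maximalAtlas 𝓘(ℝ, Eu 2) ∞ S)
    (hq : q.2 ∈ e.target) :
    ContMDiffAt 𝓘(ℝ, ℝ × Eu 2) (modelR 2) ∞ (stripPt e) q := by
  have h1 : ContMDiffAt 𝓘(ℝ, Eu 2) 𝓘(ℝ, Eu 2) ∞ e.symm q.2 :=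
    (contMDiffOn_symm_of_mem_maximalAtlas he).contMDiffAt (e.open_target.mem_nhds hq)
  have h2 : ContMDiffAt 𝓘(ℝ, ℝ × Eu 2) 𝓘(ℝ, ℝ) ∞ (fun q : ℝ × Eu 2 => q.1) q :=
    contDiffAt_fst.contMDiffAt
  have h3 : ContMDiffAt 𝓘(ℝ, ℝ × Eu 2) 𝓘(ℝ, Eu 2) ∞ (fun q : ℝ × Eu 2 => q.2) q :=
    contDiffAt_snd.contMDiffAt
  exact h2.prodMk (h1.comp q h3)

/-- A function that is smooth on a strip is smooth in coordinates. -/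
theorem contDiffWithinAt_comp_stripPt {E : Type*} [NormedAddCommGroup E] [NormedSpace ℝ E]
    (he : e ∈ IsManifold.maximalAtlas 𝓘(ℝ, Eu 2) ∞ S) (hq : q.2 ∈ e.target) {f : ℝ × S → E}
    (hf : ContMDiffWithinAt (modelR 2) 𝓘(ℝ, E) ∞ f (strip S ε) (stripPt e q)) :
    ContDiffWithinAt ℝ ∞ (fun q => f (stripPt e q)) (strip (Eu 2) ε) q := by
  have hmaps : MapsTo (stripPt e) (strip (Eu 2) ε) (strip S ε) := fun q hq => ⟨hq.1, trivial⟩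
  exact contMDiffWithinAt_iff_contDiffWithinAt.1
    (hf.comp q (contMDiffAt_stripPt he hq).contMDiffWithinAt hmaps)

/-- Differentiability within a strip can be checked in coordinates. -/
theorem hasMFDerivWithinAt_comp_stripCoord {E : Type*} [NormedAddCommGroup E] [NormedSpace ℝ E]
    (he : e ∈ IsManifold.maximalAtlas 𝓘(ℝ, Eu 2) ∞ S) (hp : p.2 ∈ e.source) {f : ℝ × Eu 2 → E}
    {L : ℝ × Eu 2 →L[ℝ] E} (hf : HasFDerivWithinAt f L (strip (Eu 2) ε) (stripCoord e p)) :
    HasMFDerivWithinAt (modelR 2) 𝓘(ℝ, E) (fun p => f (stripCoord e p)) (strip S ε) p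
      (L.comp (stripDeriv e p)) := by
  have hmaps : MapsTo (stripCoord e) (strip S ε) (strip (Eu 2) ε) := fun q hq => ⟨hq.1, trivial⟩
  exact hf.hasMFDerivWithinAt.comp p (hasMFDerivAt_stripCoord he hp).hasMFDerivWithinAt hmaps

variable {M : Type*} [TopologicalSpace M] [ChartedSpace (Eu 7) M] [IsManifold 𝓘(ℝ, Eu 7) ∞ M]

/-- A map of a strip to `M` that is given in charts by a differentiable map is differentiable, and
the components of its differential are the derivatives of the map in charts. -/
theorem comps_mfderivWithin_strip (hε : 0 < ε)
    (he : e ∈ IsManifold.maximalAtlas 𝓘(ℝ, Eu 2) ∞ S) (hp : p ∈ strip S ε) (hps : p.2 ∈ e.source)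
    {x₀ : M} {D : ℝ × S → M} {c : ℝ × Eu 2 → Eu 7} {L : ℝ × Eu 2 →L[ℝ] Eu 7}
    (hc : HasFDerivWithinAt c L (strip (Eu 2) ε) (stripCoord e p))
    (hct : c (stripCoord e p) ∈ ctarget x₀)
    (hD : ∀ᶠ p' in 𝓝[strip S ε] p, D p' = chartPt x₀ (c (stripCoord e p'))) :
    MDifferentiableWithinAt (modelR 2) 𝓘(ℝ, Eu 7) D (strip S ε) p ∧
      ∀ a, comps x₀ (mfderivWithin (modelR 2) 𝓘(ℝ, Eu 7) D (strip S ε) p a) =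
        L (stripDeriv e p a) := by
  have hu : UniqueMDiffWithinAt (modelR 2) (strip S ε) p :=
    HolomorphicCurve.uniqueMDiffWithinAt_strip hε hp.1
  have h1 := hasMFDerivWithinAt_comp_stripCoord he hps hc
  have hDp : D p = chartPt x₀ (c (stripCoord e p)) := hD.self_of_nhdsWithin hp
  have hx : D p ∈ csource x₀ := hDp ▸ chartPt_mem hct
  have hcont : ContinuousWithinAt D (strip S ε) p := by
    have h2 : ContinuousWithinAt (fun p => chartPt x₀ (c (stripCoord e p))) (strip S ε) p :=
      ContinuousAt.comp_continuousWithinAt (f := fun p => c (stripCoord e p))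
        ((continuousOn_chartPt x₀).continuousAt ((isOpen_ctarget x₀).mem_nhds hct)) h1.1
    exact h2.congr_of_eventuallyEq hD hDp
  have hev : (fun p' => cmap x₀ (D p')) =ᶠ[𝓝[strip S ε] p] fun p' => c (stripCoord e p') := by
    filter_upwards [hD, h1.1.eventually ((isOpen_ctarget x₀).mem_nhds hct)] with p' h3 h4
    rw [h3, cmap_chartPt h4]
  have h5 : HasMFDerivWithinAt (modelR 2) 𝓘(ℝ, Eu 7) (fun p' => cmap x₀ (D p')) (strip S ε) p
      (L.comp (stripDeriv e p)) :=
    h1.congr_of_eventuallyEq hev (by rw [hDp, cmap_chartPt hct])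
  have h6 := mdifferentiableWithinAt_of_cmap hcont hx h5.mdifferentiableWithinAt
  refine ⟨h6, fun a => ?_⟩
  rw [comps_mfderivWithin h6 hu hx]
  have h7 := h5.mfderivWithin hu
  exact congrArg (fun T : (ℝ × Eu 2) →L[ℝ] Eu 7 => T a) h7

/-- The matrix of the derivative of a chart with respect to the preferred chart at a point, as
the coefficients of the images of the basis vectors. -/
def chartCoeff (e : OpenPartialHomeomorph S (Eu 2)) (s : S) (i j : Fin 2) : ℝ :=
  (chartDeriv e s) (EuclideanSpace.single i 1) j

/-- The determinant of `chartCoeff`. -/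
def chartDet (e : OpenPartialHomeomorph S (Eu 2)) (s : S) : ℝ :=
  chartCoeff e s 0 0 * chartCoeff e s 1 1 - chartCoeff e s 0 1 * chartCoeff e s 1 0

/-- The standard basis of `ℝ × ℝ²`. -/
def stdVec (i : Fin 3) : ℝ × Eu 2 :=
  ![(1, 0), (0, EuclideanSpace.single 0 1), (0, EuclideanSpace.single 1 1)] i

theorem eu2_eq (v : Eu 2) :
    v = v 0 • (EuclideanSpace.single 0 1 : Eu 2) + v 1 • EuclideanSpace.single 1 1 := by
  ext i
  fin_cases i <;> simp

theorem stripDeriv_basisVec_zero : stripDeriv e p (HolomorphicCurve.basisVec p 0) = stdVec 0 := by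
  change stripDeriv e p (tvec p 1 0) = (1, 0)
  rw [stripDeriv_tvec]
  exact Prod.ext rfl (map_zero (chartDeriv e p.2))

theorem stripDeriv_basisVec_one : stripDeriv e p (HolomorphicCurve.basisVec p 1) =
    chartCoeff e p.2 0 0 • stdVec 1 + chartCoeff e p.2 0 1 • stdVec 2 := by
  refine Prod.ext ?_ ?_
  · change (0 : ℝ) = chartCoeff e p.2 0 0 * 0 + chartCoeff e p.2 0 1 * 0
    ring
  · exact eu2_eq _

theorem stripDeriv_basisVec_two : stripDeriv e p (HolomorphicCurve.basisVec p 2) =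
    chartCoeff e p.2 1 0 • stdVec 1 + chartCoeff e p.2 1 1 • stdVec 2 := by
  refine Prod.ext ?_ ?_
  · change (0 : ℝ) = chartCoeff e p.2 1 0 * 0 + chartCoeff e p.2 1 1 * 0
    ring
  · exact eu2_eq _

theorem mfderiv_chart_injective (he : e ∈ IsManifold.maximalAtlas 𝓘(ℝ, Eu 2) ∞ S) {s : S}
    (hs : s ∈ e.source) :
    Function.Injective (chartDeriv e s) := by
  have h1 : MDifferentiableAt 𝓘(ℝ, Eu 2) 𝓘(ℝ, Eu 2) e s :=
    ((contMDiffOn_of_mem_maximalAtlas he).contMDiffAt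
      (e.open_source.mem_nhds hs)).mdifferentiableAt (by simp)
  have h2 : MDifferentiableAt 𝓘(ℝ, Eu 2) 𝓘(ℝ, Eu 2) e.symm (e s) :=
    ((contMDiffOn_symm_of_mem_maximalAtlas he).contMDiffAt
      (e.open_target.mem_nhds (e.map_source hs))).mdifferentiableAt (by simp)
  have h3 := (h2.hasMFDerivAt.comp s h1.hasMFDerivAt).congr_of_eventuallyEq
    (f₁ := id) (by
      filter_upwards [e.open_source.mem_nhds hs] with x hx
      exact (e.left_inv hx).symm)
  have h4 := hasMFDerivAt_unique h3 (hasMFDerivAt_id s)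
  intro a b hab
  have h5 : ∀ a : Eu 2, (mfderiv 𝓘(ℝ, Eu 2) 𝓘(ℝ, Eu 2) e.symm (e s) : Eu 2 →L[ℝ] Eu 2)
      ((chartDeriv e s) a) = a := fun a =>
    congrArg (fun T : Eu 2 →L[ℝ] Eu 2 => T a) h4
  rw [← h5 a, hab, h5 b]

theorem chartDet_ne_zero (he : e ∈ IsManifold.maximalAtlas 𝓘(ℝ, Eu 2) ∞ S) {s : S}
    (hs : s ∈ e.source) : chartDet e s ≠ 0 := by
  intro h
  set A := chartDeriv e s with hA
  have hinj : Function.Injective A := mfderiv_chart_injective he hs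
  have key : ∀ v : Eu 2, A v = (v 0 * chartCoeff e s 0 0 + v 1 * chartCoeff e s 1 0) •
      (EuclideanSpace.single 0 1 : Eu 2) + (v 0 * chartCoeff e s 0 1 + v 1 * chartCoeff e s 1 1) •
      EuclideanSpace.single 1 1 := by
    intro v
    have h0 : A (EuclideanSpace.single 0 1) = chartCoeff e s 0 0 • (EuclideanSpace.single 0 1 : Eu 2)
        + chartCoeff e s 0 1 • EuclideanSpace.single 1 1 := eu2_eq _
    have h1 : A (EuclideanSpace.single 1 1) = chartCoeff e s 1 0 • (EuclideanSpace.single 0 1 : Eu 2)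
        + chartCoeff e s 1 1 • EuclideanSpace.single 1 1 := eu2_eq _
    conv_lhs => rw [eu2_eq v, map_add, map_smul, map_smul, h0, h1]
    module
  unfold chartDet at h
  -- If the determinant vanishes, the columns of the adjugate matrix are in the kernel.
  have h1 := hinj (a₁ := !₂[chartCoeff e s 1 1, -chartCoeff e s 0 1]) (a₂ := 0) (by
    rw [key, map_zero]
    simp only [Matrix.cons_val_zero, Matrix.cons_val_one, Matrix.cons_val_fin_one]
    rw [show chartCoeff e s 1 1 * chartCoeff e s 0 0 + -chartCoeff e s 0 1 * chartCoeff e s 1 0 = 0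
      by linarith, show chartCoeff e s 1 1 * chartCoeff e s 0 1 +
      -chartCoeff e s 0 1 * chartCoeff e s 1 1 = 0 by ring]
    simp)
  have h2 := hinj (a₁ := !₂[chartCoeff e s 1 0, -chartCoeff e s 0 0]) (a₂ := 0) (by
    rw [key, map_zero]
    simp only [Matrix.cons_val_zero, Matrix.cons_val_one, Matrix.cons_val_fin_one]
    rw [show chartCoeff e s 1 0 * chartCoeff e s 0 1 + -chartCoeff e s 0 0 * chartCoeff e s 1 1 = 0
      by linarith, show chartCoeff e s 1 0 * chartCoeff e s 0 0 +
      -chartCoeff e s 0 0 * chartCoeff e s 1 0 = 0 by ring]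
    simp)
  have h3 : chartCoeff e s 0 1 = 0 := by
    have := congrArg (fun v : Eu 2 => v 1) h1
    simpa using this
  have h4 : chartCoeff e s 0 0 = 0 := by
    have := congrArg (fun v : Eu 2 => v 1) h2
    simpa using this
  have h5 := hinj (a₁ := EuclideanSpace.single 0 1) (a₂ := 0) (by
    rw [key, map_zero]
    simp [h3, h4])
  have := congrArg (fun v : Eu 2 => v 0) h5
  simp at this

end Strip

/-! ### The thin submanifolds in coordinates -/

section ChartForms

variable {M : Type*} [TopologicalSpace M] [ChartedSpace (Eu 7) M] [IsManifold 𝓘(ℝ, Eu 7) ∞ M]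
variable (G : G2Structure M) {x₀ : M} {y : Eu 7}

theorem chartCross_right (y u v w : Eu 7) (a b : ℝ) :
    chartCross G x₀ y u (a • v + b • w) =
      a • chartCross G x₀ y u v + b • chartCross G x₀ y u w := by
  have h : chartVec x₀ y (a • v + b • w) = a • chartVec x₀ y v + b • chartVec x₀ y w := by
    simp only [chartVec]
    rw [map_add, map_smul, map_smul]
    rfl
  unfold chartCross
  rw [h, map_add, map_smul, map_smul, comps_add, comps_smul, comps_smul]

theorem chartCross_skew (y u v : Eu 7) : chartCross G x₀ y u v = -chartCross G x₀ y v u := by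
  unfold chartCross
  rw [G.cross_skew]
  exact map_neg (compsL x₀ (chartPt x₀ y)) _

theorem chartCross_combination (y v w : Eu 7) (a b c d : ℝ) :
    chartCross G x₀ y (a • v + b • w) (c • v + d • w) =
      (a * d - b * c) • chartCross G x₀ y v w := by
  have hs : ∀ v, chartCross G x₀ y v v = 0 := fun v => by
    have := chartCross_skew G (x₀ := x₀) y v v
    have h2 : (2 : ℝ) • chartCross G x₀ y v v = 0 := by
      rw [two_smul]
      nth_rewrite 1 [this]
      exact neg_add_cancel _
    simpa using h2
  rw [chartCross_right, chartCross_skew G y _ v, chartCross_skew G y _ w, chartCross_right,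
    chartCross_right, hs, hs, chartCross_skew G y w v]
  module

/-- `τ(u, ·, ·)` is multiplied by the determinant of a change of basis. -/
theorem chartTau_combination (y u v w : Eu 7) (a b c d : ℝ) :
    chartTau G x₀ y u (a • v + b • w) (c • v + d • w) =
      (a * d - b * c) • chartTau G x₀ y u v w := by
  have h : ∀ (r : ℝ) (v : Eu 7), chartCross G x₀ y u (r • v) = r • chartCross G x₀ y u v := by
    intro r v
    have := chartCross_right G (x₀ := x₀) y u v 0 r 0
    simpa using this
  unfold chartTau
  rw [chartCross_combination, h]
  simp only [map_add, map_smul, smul_eq_mul]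
  module

/-- The components of the `3`-form `Ω` in a chart. -/
def chartForm (x₀ : M) (y u v w : Eu 7) : ℝ :=
  chartMetric G.metric x₀ y (chartCross G x₀ y u v) w

theorem form_eq_chartForm {x : M} (hx : x ∈ csource x₀) (u v w : TS 7 x) :
    G.form x u v w =
      chartForm G x₀ (cmap x₀ x) (comps x₀ u) (comps x₀ v) (comps x₀ w) := by
  unfold G2Structure.form chartForm
  rw [inner_eq_chartMetric G.metric hx, comps_cross G hx]

/-- `Ω(u, ·, ·)` is multiplied by the determinant of a change of basis. -/
theorem chartForm_combination (hy : y ∈ ctarget x₀) (u v w : Eu 7) (a b c d : ℝ) :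
    chartForm G x₀ y u (a • v + b • w) (c • v + d • w) =
      (a * d - b * c) * chartForm G x₀ y u v w := by
  have hs : ∀ v, chartForm G x₀ y u v v = 0 := fun v => by
    unfold chartForm
    rw [chartMetric_chartCross G hy]
    exact G.cross_perp_right _ _ _
  have hlin : ∀ (a b c d : ℝ), chartForm G x₀ y u (a • v + b • w) (c • v + d • w) =
      a * c * chartForm G x₀ y u v v + a * d * chartForm G x₀ y u v w +
      b * c * chartForm G x₀ y u w v + b * d * chartForm G x₀ y u w w := by
    intro a b c d
    unfold chartForm
    rw [chartCross_right]
    simp only [map_add, map_smul, smul_eq_mul, _root_.add_apply, _root_.smul_apply]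
    ring
  have h1 := hlin 1 1 1 1
  rw [hs, hs v, hs w] at h1
  rw [hlin, hs, hs]
  linear_combination (-b * c) * h1

theorem gram_combination (m : Eu 7 →L[ℝ] Eu 7 →L[ℝ] ℝ) (η : Fin 3 → Eu 7) (a b c d : ℝ) :
    Matrix.det (Matrix.of fun i j : Fin 3 => m
      ((![η 0, a • η 1 + b • η 2, c • η 1 + d • η 2] : Fin 3 → Eu 7) i)
      ((![η 0, a • η 1 + b • η 2, c • η 1 + d • η 2] : Fin 3 → Eu 7) j)) =
    (a * d - b * c) ^ 2 * Matrix.det (Matrix.of fun i j : Fin 3 => m (η i) (η j)) := by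
  simp only [Matrix.det_fin_three, Matrix.of_apply, Matrix.cons_val_zero, Matrix.cons_val_one,
    Matrix.cons_val, map_add, map_smul, smul_eq_mul, _root_.add_apply, _root_.smul_apply]
  ring

theorem gram_pos (g : Metric7 M) (hy : y ∈ ctarget x₀) {η : Fin 3 → Eu 7}
    (hη : LinearIndependent ℝ η) :
    0 < Matrix.det (Matrix.of fun i j : Fin 3 => chartMetric g x₀ y (η i) (η j)) := by
  refine Matrix.PosDef.det_pos (Matrix.PosDef.of_dotProduct_mulVec_pos ?_ fun x hx => ?_)
  · ext i j
    simp [chartMetric_symm g x₀ y (η i)]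
  · have h1 : ∑ i, x i • η i ≠ 0 := fun h =>
      hx (funext fun i => Fintype.linearIndependent_iff.1 hη x h i)
    have h2 := chartMetric_pos g hy h1
    simp only [map_sum, map_smul, sum_apply, _root_.smul_apply, smul_eq_mul] at h2
    refine h2.trans_eq ?_
    simp only [dotProduct, Matrix.mulVec, Matrix.of_apply, Pi.star_apply, star_trivial]
    refine Finset.sum_congr rfl fun i _ => ?_
    simp only [Finset.mul_sum]
    refine Finset.sum_congr rfl fun j _ => ?_
    rw [chartMetric_symm g x₀ y (η j)]
    ring

theorem real_sign_mul (a b : ℝ) : Real.sign (a * b) = Real.sign a * Real.sign b := by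
  rcases lt_trichotomy a 0 with ha | rfl | ha <;> rcases lt_trichotomy b 0 with hb | rfl | hb <;>
    simp [Real.sign_of_neg, Real.sign_of_pos, mul_pos_of_neg_of_neg, mul_neg_of_neg_of_pos,
      mul_neg_of_pos_of_neg, *]

end ChartForms

section Coordinates

variable {M : Type*} [TopologicalSpace M] [ChartedSpace (Eu 7) M] [IsManifold 𝓘(ℝ, Eu 7) ∞ M]
variable {C : Type*} [TopologicalSpace C] [ChartedSpace (Eu 4) C] [IsManifold 𝓘(ℝ, Eu 4) ∞ C]
variable {S : Type*} [TopologicalSpace S] [ChartedSpace (Eu 2) S] [IsManifold 𝓘(ℝ, Eu 2) ∞ S]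
variable {G : G2Structure M} {ε₀ : ℝ} {K : CoassociativeFamily G C ε₀}
variable {J : HolomorphicCurve K S} {e : OpenPartialHomeomorph S (Eu 2)} {x₀ : M}
  {p : ℝ × S} {q : ℝ × Eu 2}

namespace HolomorphicCurve

/-- The parametrization of the thin submanifolds in coordinates. -/
def thinCoord (J : HolomorphicCurve K S) (e : OpenPartialHomeomorph S (Eu 2)) (x₀ : M)
    (q : ℝ × Eu 2) : Eu 7 := cmap x₀ (J.thin (stripPt e q))

/-- The coordinates of points of the strip that are mapped to a given chart domain of `M`. -/
def goodSet (J : HolomorphicCurve K S) (e : OpenPartialHomeomorph S (Eu 2)) (x₀ : M) :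
    Set (ℝ × Eu 2) :=
  {q | q ∈ strip (Eu 2) ε₀ ∧ q.2 ∈ e.target ∧ J.thin (stripPt e q) ∈ csource x₀}

theorem continuousWithinAt_thin (hp : p ∈ strip S ε₀) :
    ContinuousWithinAt J.thin (strip S ε₀) p := J.contMDiffOn_thin.continuousOn p hp

theorem goodSet_mem_nhdsWithin (hq : q ∈ goodSet J e x₀) :
    goodSet J e x₀ ∈ 𝓝[strip (Eu 2) ε₀] q := by
  obtain ⟨h1, h2, h3⟩ := hq
  have h4 := (continuousWithinAt_thin (J := J) (p := stripPt e q) ⟨h1.1, trivial⟩).tendsto.comp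
    (tendsto_stripPt (ε := ε₀) h2)
  have h5 : ∀ᶠ q' in 𝓝[strip (Eu 2) ε₀] q, q'.2 ∈ e.target :=
    (continuousAt_snd.eventually (e.open_target.mem_nhds h2)).filter_mono nhdsWithin_le_nhds
  filter_upwards [self_mem_nhdsWithin, h5,
    h4.eventually ((chartAt (Eu 7) x₀).open_source.mem_nhds h3)] with q' h6 h7 h8
  exact ⟨h6, h7, h8⟩

theorem contDiffWithinAt_thinCoord (he : e ∈ IsManifold.maximalAtlas 𝓘(ℝ, Eu 2) ∞ S)
    (hq : q ∈ goodSet J e x₀) :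
    ContDiffWithinAt ℝ ∞ (thinCoord J e x₀) (strip (Eu 2) ε₀) q := by
  obtain ⟨h1, h2, h3⟩ := hq
  refine contDiffWithinAt_comp_stripPt (f := fun p => cmap x₀ (J.thin p)) he h2 ?_
  exact (contMDiffAt_extChartAt' (I := 𝓘(ℝ, Eu 7)) (n := ∞) h3).comp_contMDiffWithinAt _
    (J.contMDiffOn_thin _ ⟨h1.1, trivial⟩)

/-- The derivative of the parametrization in coordinates. -/
def thinCoordDeriv (J : HolomorphicCurve K S) (e : OpenPartialHomeomorph S (Eu 2)) (x₀ : M)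
    (q : ℝ × Eu 2) : ℝ × Eu 2 →L[ℝ] Eu 7 :=
  fderivWithin ℝ (thinCoord J e x₀) (strip (Eu 2) ε₀) q

theorem hasFDerivWithinAt_thinCoord (he : e ∈ IsManifold.maximalAtlas 𝓘(ℝ, Eu 2) ∞ S)
    (hq : q ∈ goodSet J e x₀) : HasFDerivWithinAt (thinCoord J e x₀) (thinCoordDeriv J e x₀ q)
      (strip (Eu 2) ε₀) q :=
  ((contDiffWithinAt_thinCoord he hq).differentiableWithinAt (by simp)).hasFDerivWithinAt

theorem contDiffWithinAt_thinCoordDeriv (hε₀ : 0 < ε₀)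
    (he : e ∈ IsManifold.maximalAtlas 𝓘(ℝ, Eu 2) ∞ S) (hq : q ∈ goodSet J e x₀) :
    ContDiffWithinAt ℝ ∞ (thinCoordDeriv J e x₀) (strip (Eu 2) ε₀) q :=
  (contDiffWithinAt_thinCoord he hq).fderivWithin_right (uniqueDiffOn_strip hε₀) (by simp) hq.1

theorem comps_dthin (hε₀ : 0 < ε₀) (he : e ∈ IsManifold.maximalAtlas 𝓘(ℝ, Eu 2) ∞ S)
    (hp : p.2 ∈ e.source) (hq : stripCoord e p ∈ goodSet J e x₀)
    (a : TangentSpace (modelR 2) p) :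
    comps x₀ (J.dthin p a) = thinCoordDeriv J e x₀ (stripCoord e p) (stripDeriv e p a) := by
  have hev : ∀ᶠ p' in 𝓝[strip S ε₀] p,
      J.thin p' = chartPt x₀ (thinCoord J e x₀ (stripCoord e p')) := by
    have h1 : ∀ᶠ p' in 𝓝[strip S ε₀] p, p'.2 ∈ e.source :=
      (continuousAt_snd.eventually (e.open_source.mem_nhds hp)).filter_mono nhdsWithin_le_nhds
    filter_upwards [h1, (tendsto_stripCoord hp).eventually (goodSet_mem_nhdsWithin hq)]
      with p' h2 h3
    have h4 := h3.2.2
    unfold thinCoord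
    rw [stripPt_stripCoord h2] at h4 ⊢
    rw [chartPt_cmap h4]
  exact (comps_mfderivWithin_strip hε₀ he ⟨hq.1.1, trivial⟩ hp
    (hasFDerivWithinAt_thinCoord he hq) (cmap_mem hq.2.2) hev).2 a

/-- The Gram determinant of the parametrization in coordinates. -/
def gramDet (J : HolomorphicCurve K S) (e : OpenPartialHomeomorph S (Eu 2)) (x₀ : M)
    (q : ℝ × Eu 2) : ℝ :=
  Matrix.det (Matrix.of fun i j : Fin 3 => chartMetric G.metric x₀ (thinCoord J e x₀ q)
    (thinCoordDeriv J e x₀ q (stdVec i)) (thinCoordDeriv J e x₀ q (stdVec j)))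

theorem thinCoordDeriv_injective (hε₀ : 0 < ε₀)
    (he : e ∈ IsManifold.maximalAtlas 𝓘(ℝ, Eu 2) ∞ S) (hp : p.2 ∈ e.source)
    (hq : stripCoord e p ∈ goodSet J e x₀) :
    Function.Injective (thinCoordDeriv J e x₀ (stripCoord e p)) := by
  have h1 : Function.Injective (fun a : ℝ × Eu 2 => stripDeriv e p a) := by
    intro a b hab
    have hab' : (a.1, chartDeriv e p.2 a.2) = (b.1, chartDeriv e p.2 b.2) := hab
    exact Prod.ext (Prod.ext_iff.1 hab').1
      (mfderiv_chart_injective he hp (Prod.ext_iff.1 hab').2)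
  have h2 : Function.Surjective (fun a : ℝ × Eu 2 => stripDeriv e p a) :=
    (LinearMap.injective_iff_surjective (f := (show (ℝ × Eu 2) →L[ℝ] (ℝ × Eu 2) from
      stripDeriv e p).toLinearMap)).1 h1
  have hx : J.thin p ∈ csource x₀ := by
    have := hq.2.2
    rwa [stripPt_stripCoord hp] at this
  intro a b hab
  obtain ⟨a, rfl⟩ := h2 a
  obtain ⟨b, rfl⟩ := h2 b
  have hab' := ((comps_dthin hε₀ he hp hq a).trans hab).trans (comps_dthin hε₀ he hp hq b).symm
  have hab'' : a = b := J.dthin_injective hε₀ hq.1.1 (comps_injective hx hab')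
  rw [hab'']

theorem linearIndependent_stdVec : LinearIndependent ℝ stdVec := by
  rw [Fintype.linearIndependent_iff]
  intro g hg
  have h0 := congrArg (fun z : ℝ × Eu 2 => z.1) hg
  have h1 := congrArg (fun z : ℝ × Eu 2 => z.2 0) hg
  have h2 := congrArg (fun z : ℝ × Eu 2 => z.2 1) hg
  simp [Fin.sum_univ_three, stdVec] at h0 h1 h2
  intro i
  fin_cases i <;> simp [h0, h1, h2]

theorem gramDet_pos (hε₀ : 0 < ε₀) (he : e ∈ IsManifold.maximalAtlas 𝓘(ℝ, Eu 2) ∞ S)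
    (hq : q ∈ goodSet J e x₀) : 0 < gramDet J e x₀ q := by
  have h1 : (stripPt e q).2 ∈ e.source := e.map_target hq.2.1
  have h2 : stripCoord e (stripPt e q) = q := stripCoord_stripPt hq.2.1
  have h3 := thinCoordDeriv_injective hε₀ he h1 (h2.symm ▸ hq)
  rw [h2] at h3
  exact gram_pos G.metric (cmap_mem hq.2.2)
    (linearIndependent_stdVec.map' (thinCoordDeriv J e x₀ q).toLinearMap
      (LinearMap.ker_eq_bot.2 h3))

theorem contDiffWithinAt_gramDet (hε₀ : 0 < ε₀)
    (he : e ∈ IsManifold.maximalAtlas 𝓘(ℝ, Eu 2) ∞ S) (hq : q ∈ goodSet J e x₀) :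
    ContDiffWithinAt ℝ ∞ (gramDet J e x₀) (strip (Eu 2) ε₀) q := by
  have h1 := contDiffWithinAt_thinCoord he hq
  have h2 := contDiffWithinAt_thinCoordDeriv hε₀ he hq
  have h3 : ContDiffWithinAt ℝ ∞ (fun q => chartMetric G.metric x₀ (thinCoord J e x₀ q))
      (strip (Eu 2) ε₀) q :=
    ContDiffAt.comp_contDiffWithinAt (g := chartMetric G.metric x₀) (f := thinCoord J e x₀) q
      ((contDiffOn_chartMetric G.metric x₀).contDiffAt
        ((isOpen_ctarget x₀).mem_nhds (cmap_mem hq.2.2))) h1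
  have h4 : ∀ i j, ContDiffWithinAt ℝ ∞ (fun q => chartMetric G.metric x₀ (thinCoord J e x₀ q)
      (thinCoordDeriv J e x₀ q (stdVec i)) (thinCoordDeriv J e x₀ q (stdVec j)))
      (strip (Eu 2) ε₀) q := fun i j =>
    (h3.clm_apply (h2.clm_apply contDiffWithinAt_const)).clm_apply
      (h2.clm_apply contDiffWithinAt_const)
  unfold gramDet
  simp only [Matrix.det_fin_three, Matrix.of_apply]
  exact (((((((h4 0 0).mul (h4 1 1)).mul (h4 2 2)).sub (((h4 0 0).mul (h4 1 2)).mul (h4 2 1))).sub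
    (((h4 0 1).mul (h4 1 0)).mul (h4 2 2))).add (((h4 0 1).mul (h4 1 2)).mul (h4 2 0))).add
    (((h4 0 2).mul (h4 1 0)).mul (h4 2 1))).sub (((h4 0 2).mul (h4 1 1)).mul (h4 2 0))

/-- The sign in `dvol` is locally constant up to the sign of `chartDet`, by continuity, as `Ω` does
not vanish on `T_pA'_ε` along `Σ`. The preferred charts, to which `basisVec` refers, may vary
discontinuously, and this is what `chartDet` accounts for. -/
theorem exists_sign (hε₀ : 0 < ε₀) (he : e ∈ IsManifold.maximalAtlas 𝓘(ℝ, Eu 2) ∞ S) {y₀ : Eu 2}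
    (hy₀ : y₀ ∈ e.target) : ∃ c : ℝ, (c = 1 ∨ c = -1) ∧ ∀ᶠ y in 𝓝 y₀,
      Real.sign (G.form (J.thin (0, e.symm y)) (J.dthin (0, e.symm y) (basisVec (0, e.symm y) 0))
        (J.dthin (0, e.symm y) (basisVec (0, e.symm y) 1))
        (J.dthin (0, e.symm y) (basisVec (0, e.symm y) 2))) =
      c * Real.sign (chartDet e (e.symm y)) := by
  set x₁ := J.thin (0, e.symm y₀) with hx₁
  have h0 : (0 : ℝ) ∈ Icc 0 ε₀ := ⟨le_rfl, hε₀.le⟩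
  have hgood : ((0 : ℝ), y₀) ∈ goodSet J e x₁ := ⟨⟨h0, trivial⟩, hy₀, mem_chart_source _ _⟩
  let Ψ : ℝ × Eu 2 → ℝ := fun q => chartForm G x₁ (thinCoord J e x₁ q)
    (thinCoordDeriv J e x₁ q (stdVec 0)) (thinCoordDeriv J e x₁ q (stdVec 1))
    (thinCoordDeriv J e x₁ q (stdVec 2))
  have hform : ∀ y, ((0 : ℝ), y) ∈ goodSet J e x₁ →
      G.form (J.thin (0, e.symm y)) (J.dthin (0, e.symm y) (basisVec (0, e.symm y) 0))
        (J.dthin (0, e.symm y) (basisVec (0, e.symm y) 1))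
        (J.dthin (0, e.symm y) (basisVec (0, e.symm y) 2)) =
      chartDet e (e.symm y) * Ψ (0, y) := by
    intro y hy
    have hs : ((0 : ℝ), e.symm y).2 ∈ e.source := e.map_target hy.2.1
    have hc : stripCoord e ((0 : ℝ), e.symm y) = (0, y) := stripCoord_stripPt (q := (0, y)) hy.2.1
    have hd := fun a => comps_dthin (p := ((0 : ℝ), e.symm y)) hε₀ he hs (hc.symm ▸ hy) a
    have hx : J.thin (0, e.symm y) ∈ csource x₁ := hy.2.2
    rw [form_eq_chartForm G hx, hd, hd, hd, stripDeriv_basisVec_zero, stripDeriv_basisVec_one, stripDeriv_basisVec_two,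
      map_add, map_add, map_smul, map_smul, map_smul, map_smul,
      chartForm_combination G (cmap_mem hx), hc]
    rfl
  have hne : Ψ (0, y₀) ≠ 0 := by
    have h1 := J.form_ne_zero hε₀ (e.symm y₀) (u := (EuclideanSpace.single 0 1 : Eu 2))
      (v := (EuclideanSpace.single 1 1 : Eu 2)) (fun w => ⟨_, _, eu2_eq w⟩)
      (fun h => by
        have := congrArg (fun v : Eu 2 => v 0) (show (EuclideanSpace.single 0 1 : Eu 2) = 0 from h)
        simp at this)
    intro h2
    have h3 := hform y₀ hgood
    rw [h2, mul_zero] at h3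
    exact h1 h3
  have hcont : ContinuousWithinAt Ψ (strip (Eu 2) ε₀) (0, y₀) := by
    have h1 := (contDiffWithinAt_thinCoord he hgood).continuousWithinAt
    have h2 := (contDiffWithinAt_thinCoordDeriv hε₀ he hgood).continuousWithinAt
    have h3 : ∀ j, ContinuousWithinAt (fun q => thinCoordDeriv J e x₁ q (stdVec j))
      (strip (Eu 2) ε₀) (0, y₀) := fun j => h2.clm_apply continuousWithinAt_const
    have hmem : thinCoord J e x₁ (0, y₀) ∈ ctarget x₁ := cmap_mem hgood.2.2
    have h4 : ContinuousWithinAt (fun q => chartCross G x₁ (thinCoord J e x₁ q)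
        (thinCoordDeriv J e x₁ q (stdVec 0)) (thinCoordDeriv J e x₁ q (stdVec 1)))
        (strip (Eu 2) ε₀) (0, y₀) :=
      ContinuousAt.comp_continuousWithinAt
        (f := fun q => (thinCoord J e x₁ q, thinCoordDeriv J e x₁ q (stdVec 0),
          thinCoordDeriv J e x₁ q (stdVec 1)))
        (g := fun z : Eu 7 × Eu 7 × Eu 7 => chartCross G x₁ z.1 z.2.1 z.2.2)
        ((contDiffOn_chartCross G x₁).continuousOn.continuousAt
          (((isOpen_ctarget x₁).prod isOpen_univ).mem_nhds ⟨hmem, trivial⟩))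
        (h1.prodMk ((h3 0).prodMk (h3 1)))
    have h5 : ContinuousWithinAt (fun q => chartMetric G.metric x₁ (thinCoord J e x₁ q))
        (strip (Eu 2) ε₀) (0, y₀) :=
      ((contDiffOn_chartMetric G.metric x₁).continuousOn.continuousAt
        ((isOpen_ctarget x₁).mem_nhds hmem)).comp_continuousWithinAt h1
    exact (h5.clm_apply h4).clm_apply (h3 2)
  have hι : Tendsto (fun y : Eu 2 => ((0 : ℝ), y)) (𝓝 y₀) (𝓝[strip (Eu 2) ε₀] (0, y₀)) :=
    tendsto_nhdsWithin_iff.2 ⟨(Continuous.prodMk_right (0 : ℝ)).continuousAt,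
      Eventually.of_forall fun y => ⟨h0, trivial⟩⟩
  have hgood' := hι.eventually (goodSet_mem_nhdsWithin hgood)
  have hΨ := hcont.tendsto.comp hι
  rcases lt_or_gt_of_ne hne with hneg | hpos
  · refine ⟨-1, Or.inr rfl, ?_⟩
    filter_upwards [hgood', hΨ.eventually (gt_mem_nhds hneg)] with y h1 h2
    rw [hform y h1, real_sign_mul, Real.sign_of_neg (show Ψ (0, y) < 0 from h2), mul_comm]
  · refine ⟨1, Or.inl rfl, ?_⟩
    filter_upwards [hgood', hΨ.eventually (lt_mem_nhds hpos)] with y h1 h2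
    rw [hform y h1, real_sign_mul, Real.sign_of_pos (show 0 < Ψ (0, y) from h2), mul_comm]

theorem gram_dthin (hε₀ : 0 < ε₀) (he : e ∈ IsManifold.maximalAtlas 𝓘(ℝ, Eu 2) ∞ S)
    (hp : p.2 ∈ e.source) (hq : stripCoord e p ∈ goodSet J e x₀) :
    Matrix.det (Matrix.of fun i j : Fin 3 => G.metric.inner (J.thin p)
      (J.dthin p (basisVec p i)) (J.dthin p (basisVec p j))) =
    chartDet e p.2 ^ 2 * gramDet J e x₀ (stripCoord e p) := by
  have hx : J.thin p ∈ csource x₀ := by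
    have := hq.2.2
    rwa [stripPt_stripCoord hp] at this
  have hθ : cmap x₀ (J.thin p) = thinCoord J e x₀ (stripCoord e p) := by
    unfold thinCoord
    rw [stripPt_stripCoord hp]
  have hd := fun a => comps_dthin hε₀ he hp hq a
  unfold gramDet chartDet
  rw [← gram_combination (chartMetric G.metric x₀ (thinCoord J e x₀ (stripCoord e p)))
    (fun i => thinCoordDeriv J e x₀ (stripCoord e p) (stdVec i))]
  have hv : ∀ i, comps x₀ (J.dthin p (basisVec p i)) =
      (![thinCoordDeriv J e x₀ (stripCoord e p) (stdVec 0),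
        chartCoeff e p.2 0 0 • thinCoordDeriv J e x₀ (stripCoord e p) (stdVec 1) +
          chartCoeff e p.2 0 1 • thinCoordDeriv J e x₀ (stripCoord e p) (stdVec 2),
        chartCoeff e p.2 1 0 • thinCoordDeriv J e x₀ (stripCoord e p) (stdVec 1) +
          chartCoeff e p.2 1 1 • thinCoordDeriv J e x₀ (stripCoord e p) (stdVec 2)] :
        Fin 3 → Eu 7) i := by
    intro i
    rw [hd]
    fin_cases i
    · exact congrArg _ stripDeriv_basisVec_zero
    · refine (congrArg _ stripDeriv_basisVec_one).trans ?_
      rw [map_add, map_smul, map_smul]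
      rfl
    · refine (congrArg _ stripDeriv_basisVec_two).trans ?_
      rw [map_add, map_smul, map_smul]
      rfl
  congr 2
  ext i j
  rw [inner_eq_chartMetric G.metric hx, hv, hv, hθ]

end HolomorphicCurve

end Coordinates

/-! ### The local formula for the deformation map -/

section LocalFormula

variable {M : Type*} [TopologicalSpace M] [ChartedSpace (Eu 7) M] [IsManifold 𝓘(ℝ, Eu 7) ∞ M]
variable {C : Type*} [TopologicalSpace C] [ChartedSpace (Eu 4) C] [IsManifold 𝓘(ℝ, Eu 4) ∞ C]
variable {S : Type*} [TopologicalSpace S] [ChartedSpace (Eu 2) S] [IsManifold 𝓘(ℝ, Eu 2) ∞ S]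
variable {G : G2Structure M} {ε₀ : ℝ} {K : CoassociativeFamily G C ε₀}
variable {J : HolomorphicCurve K S} {x₀ : M}

theorem AdaptedMetrics.smoothFamily (A : AdaptedMetrics K) (x₀ : M) :
    SmoothFamily (fun l : Icc (0 : ℝ) ε₀ => chartMetric (A.metric l) x₀) (ctarget x₀) where
  contDiffOn l := contDiffOn_chartMetric _ _
  continuousOn k := (A.continuousOn x₀ k).comp
    (f := fun p : Icc (0 : ℝ) ε₀ × Eu 7 => ((p.1 : ℝ), p.2)) (by fun_prop)
    fun p hp => ⟨p.1.2, hp.2⟩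

namespace HolomorphicCurve.HolderCharts

variable {H : J.HolderCharts} {i : Fin H.num} {q : ℝ × Eu 2}

/-- The frame of the normal bundle in a chart of `M`, as a family of linear maps `ℝ⁴ → ℝ⁷`. -/
def frameCoord (H : J.HolderCharts) (i : Fin H.num) (x₀ : M) (q : ℝ × Eu 2) : Eu 4 →L[ℝ] Eu 7 :=
  ∑ a, (EuclideanSpace.proj a : Eu 4 →L[ℝ] ℝ).smulRight
    (comps x₀ (H.frame i a (stripPt (H.chart i) q)))

theorem frameCoord_apply (v : Eu 4) : frameCoord H i x₀ q v =
    ∑ a, v a • comps x₀ (H.frame i a (stripPt (H.chart i) q)) := by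
  simp [frameCoord, sum_apply]

theorem frameCoord_single (a : Fin 4) : frameCoord H i x₀ q (EuclideanSpace.single a 1) =
    comps x₀ (H.frame i a (stripPt (H.chart i) q)) := by
  rw [frameCoord_apply, Finset.sum_eq_single a]
  · simp
  · intro b _ hb
    simp [hb]
  · simp

theorem contDiffWithinAt_frameCoord (hq : q ∈ goodSet J (H.chart i) x₀) :
    ContDiffWithinAt ℝ ∞ (frameCoord H i x₀) (strip (Eu 2) ε₀) q := by
  have h1 : ∀ a, ContDiffWithinAt ℝ ∞
      (fun q => comps x₀ (H.frame i a (stripPt (H.chart i) q))) (strip (Eu 2) ε₀) q := by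
    intro a
    refine contDiffWithinAt_comp_stripPt (f := fun p => comps x₀ (H.frame i a p))
      (H.chart_mem i) hq.2.1 ?_
    have hs : (stripPt (H.chart i) q).2 ∈ (H.chart i).source := (H.chart i).map_target hq.2.1
    have h2 := H.frame_smooth i a (stripPt (H.chart i) q) ⟨hq.1.1, hs⟩
    have h3 := ((Bundle.Trivialization.contMDiffWithinAt_iff (IB := 𝓘(ℝ, Eu 7))
      (e := trivializationAt (Eu 7) (TangentSpace 𝓘(ℝ, Eu 7)) x₀) hq.2.2).1 h2).2
    refine h3.mono_of_mem_nhdsWithin ?_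
    have h4 : ∀ᶠ p : ℝ × S in 𝓝 (stripPt (H.chart i) q), p.2 ∈ (H.chart i).source :=
      continuousAt_snd.eventually ((H.chart i).open_source.mem_nhds hs)
    filter_upwards [self_mem_nhdsWithin, h4.filter_mono nhdsWithin_le_nhds] with p h5 h6
    exact ⟨h5.1, h6⟩
  refine ContDiffWithinAt.sum fun a _ => ?_
  exact (((ContinuousLinearMap.smulRightL ℝ (Eu 4) (Eu 7))
    (EuclideanSpace.proj a : Eu 4 →L[ℝ] ℝ)).contDiff.contDiffAt).comp_contDiffWithinAt q (h1 a)

/-- The derivative of the frame in coordinates. -/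
def frameCoordDeriv (H : J.HolderCharts) (i : Fin H.num) (x₀ : M) (q : ℝ × Eu 2) :
    ℝ × Eu 2 →L[ℝ] Eu 4 →L[ℝ] Eu 7 :=
  fderivWithin ℝ (frameCoord H i x₀) (strip (Eu 2) ε₀) q

theorem hasFDerivWithinAt_frameCoord (hq : q ∈ goodSet J (H.chart i) x₀) :
    HasFDerivWithinAt (frameCoord H i x₀) (frameCoordDeriv H i x₀ q) (strip (Eu 2) ε₀) q :=
  ((contDiffWithinAt_frameCoord hq).differentiableWithinAt (by simp)).hasFDerivWithinAt

theorem contDiffWithinAt_frameCoordDeriv (hε₀ : 0 < ε₀) (hq : q ∈ goodSet J (H.chart i) x₀) :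
    ContDiffWithinAt ℝ ∞ (frameCoordDeriv H i x₀) (strip (Eu 2) ε₀) q :=
  (contDiffWithinAt_frameCoord hq).fderivWithin_right (uniqueDiffOn_strip hε₀) (by simp) hq.1

theorem eq_sum_frame (hε₀ : 0 < ε₀) (hq : q.1 ∈ Icc 0 ε₀) (hq' : q.2 ∈ (H.chart i).target)
    {V : J.Field} (hV : J.IsNormal (stripPt (H.chart i) q) (V (stripPt (H.chart i) q))) :
    V (stripPt (H.chart i) q) = ∑ a, H.local_ i V q a • H.frame i a (stripPt (H.chart i) q) := by
  have hs : stripPt (H.chart i) q ∈ Icc 0 ε₀ ×ˢ (H.chart i).source :=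
    ⟨hq, (H.chart i).map_target hq'⟩
  have h := IsNormal.eq_sum (p := stripPt (H.chart i) q) hε₀ hs.1
    (e := fun a => H.frame i a (stripPt (H.chart i) q)) (fun a => H.frame_normal i a _ hs)
    (fun a b => H.frame_orthonormal i a b _ hs) hV
  exact h

/-- In a chart of `M`, a normal field is the image of its components under `frameCoord`. -/
theorem comps_section (hε₀ : 0 < ε₀) (hq : q.1 ∈ Icc 0 ε₀) (hq' : q.2 ∈ (H.chart i).target)
    {V : J.Field} (hV : J.IsNormal (stripPt (H.chart i) q) (V (stripPt (H.chart i) q))) :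
    comps x₀ (V (stripPt (H.chart i) q)) = frameCoord H i x₀ q (H.local_ i V q) := by
  rw [frameCoord_apply]
  conv_lhs => rw [eq_sum_frame hε₀ hq hq' hV]
  rw [comps_sum]
  simp only [comps_smul]

/-- The map to the components in the frame `E`, scaled by `c`, for the metric `m`. -/
def coeffMap (c : ℝ) (m : BilinForm7) (E : Eu 4 →L[ℝ] Eu 7) : Eu 7 →L[ℝ] Eu 4 :=
  c • ∑ a, (m.flip (E (EuclideanSpace.single a 1))).smulRight (EuclideanSpace.single a 1)

theorem coeffMap_apply (c : ℝ) (m : BilinForm7) (E : Eu 4 →L[ℝ] Eu 7) (v : Eu 7) (a : Fin 4) :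
    coeffMap c m E v a = c * m v (E (EuclideanSpace.single a 1)) := by
  simp only [coeffMap, _root_.smul_apply, sum_apply, ContinuousLinearMap.smulRight_apply,
    ContinuousLinearMap.flip_apply, PiLp.smul_apply, smul_eq_mul]
  congr 1
  rw [WithLp.ofLp_sum, Finset.sum_apply, Finset.sum_eq_single a]
  · simp
  · intro b _ hb
    simp [hb.symm]
  · simp

theorem expCurve_zero {g : Metric7 M} {p : M} {w : TS 7 p} (h : ExpDefined g p w) :
    expCurve g p w 0 = p := by
  unfold expCurve
  rw [dif_pos h]
  exact h.choose_spec.2.apply_zero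

/-- The components depend on the base point of a vector, which for transported vectors is only
propositionally the right one. -/
theorem comps_congr {x y : M} (h : x = y) (v : Eu 7) :
    comps x₀ (show TS 7 x from v) = comps x₀ (show TS 7 y from v) := by
  subst h
  rfl

/-- If the exponential map and parallel transport are given by `X` and `Q` in a chart, then
`exp V` is differentiable, and the pullback of `τ` is an explicit function of the `1`-jet of `V`. -/
theorem comps_pullTau (hε₀ : 0 < ε₀) {ε : ℝ} (hε : ε ∈ Ioc 0 ε₀) {h : Metric7 M} {V : J.Field}
    (hV : ∀ p ∈ strip S ε, J.IsNormal p (V p)) (hq : q ∈ goodSet J (H.chart i) x₀) (hqε : q.1 ≤ ε)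
    {f' : ℝ × Eu 2 →L[ℝ] Eu 4}
    (hf : HasFDerivWithinAt (H.local_ i V) f' (strip (Eu 2) ε) q)
    {X : Eu 7 × Eu 7 → Eu 7} {Q : Eu 7 × Eu 7 → Eu 7 →L[ℝ] Eu 7} {z : Eu 7 × Eu 7}
    (hz : z = (thinCoord J (H.chart i) x₀ q, frameCoord H i x₀ q (H.local_ i V q)))
    (hX : DifferentiableAt ℝ X z)
    (hP : ∀ᶠ z' in 𝓝 z, IsExpFormula G.metric h x₀ z' (X z') (Q z'))
    {η : ℝ × Eu 2 → Eu 7} (hη : ∀ b, η b = fderiv ℝ X z (thinCoordDeriv J (H.chart i) x₀ q b,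
      frameCoordDeriv H i x₀ q b (H.local_ i V q) + frameCoord H i x₀ q (f' b))) :
    ExpDefined h (J.thin (stripPt (H.chart i) q)) (V (stripPt (H.chart i) q)) ∧
    MDifferentiableWithinAt (modelR 2) 𝓘(ℝ, Eu 7) (J.deform h V) (strip S ε)
      (stripPt (H.chart i) q) ∧
    comps x₀ (J.pullTau h ε V (stripPt (H.chart i) q) (basisVec _ 0) (basisVec _ 1)
      (basisVec _ 2)) = chartDet (H.chart i) (stripPt (H.chart i) q).2 •
      Q z (chartTau G x₀ (X z) (η (stdVec 0)) (η (stdVec 1)) (η (stdVec 2))) := by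
  set e := H.chart i with he
  have hem : e ∈ IsManifold.maximalAtlas 𝓘(ℝ, Eu 2) ∞ S := H.chart_mem i
  set p := stripPt e q with hp
  have hpq : stripCoord e p = q := stripCoord_stripPt hq.2.1
  have hps : p.2 ∈ e.source := e.map_target hq.2.1
  have hsub : strip (Eu 2) ε ⊆ strip (Eu 2) ε₀ := prod_mono_left (Icc_subset_Icc_right hε.2)
  have hqs : q ∈ strip (Eu 2) ε := ⟨⟨hq.1.1.1, hqε⟩, trivial⟩
  have hpstrip : p ∈ strip S ε := ⟨hqs.1, trivial⟩
  let ζ : ℝ × Eu 2 → Eu 7 × Eu 7 := fun q' =>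
    (thinCoord J e x₀ q', frameCoord H i x₀ q' (H.local_ i V q'))
  have hζq : ζ q = z := hz.symm
  have hζ := ((hasFDerivWithinAt_thinCoord hem hq).mono hsub).prodMk
    (((hasFDerivWithinAt_frameCoord hq).mono hsub).clm_apply hf)
  change HasFDerivWithinAt ζ _ _ _ at hζ
  have hc : HasFDerivWithinAt (fun q' => X (ζ q')) _ (strip (Eu 2) ε) q :=
    (show HasFDerivAt X (fderiv ℝ X z) (ζ q) by rw [hζq]; exact hX.hasFDerivAt).comp_hasFDerivWithinAt
      q hζ
  have hgood : ∀ᶠ q' in 𝓝[strip (Eu 2) ε] q, q' ∈ strip (Eu 2) ε ∧ q' ∈ goodSet J e x₀ ∧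
      IsExpFormula G.metric h x₀ (ζ q') (X (ζ q')) (Q (ζ q')) := by
    have h1 : Tendsto ζ (𝓝[strip (Eu 2) ε] q) (𝓝 z) := hζq ▸ hζ.continuousWithinAt
    filter_upwards [self_mem_nhdsWithin, nhdsWithin_mono _ hsub (goodSet_mem_nhdsWithin hq),
      h1.eventually hP] with q' h2 h3 h4
    exact ⟨h2, h3, h4⟩
  have hexp : ∀ q' ∈ strip (Eu 2) ε, q' ∈ goodSet J e x₀ →
      IsExpFormula G.metric h x₀ (ζ q') (X (ζ q')) (Q (ζ q')) →
      ExpDefined h (J.thin (stripPt e q')) (V (stripPt e q')) ∧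
      J.deform h V (stripPt e q') = chartPt x₀ (X (ζ q')) ∧
      ∀ w' : TS 7 (J.deform h V (stripPt e q')),
        comps x₀ (transportBack G.metric (expCurve h (J.thin (stripPt e q'))
          (V (stripPt e q'))) w') = Q (ζ q') (comps x₀ w') := fun q' h1 h2 h3 =>
    h3.2 _ h2.2.2 _ rfl (comps_section hε₀ h2.1.1 h2.2.1 (hV _ ⟨h1.1, trivial⟩))
  obtain ⟨-, -, hqP⟩ := hgood.self_of_nhdsWithin hqs
  obtain ⟨hdef, hdeform, htrans⟩ := hexp q hqs hq hqP
  have hev : ∀ᶠ p' in 𝓝[strip S ε] p, J.deform h V p' = chartPt x₀ (X (ζ (stripCoord e p'))) := by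
    have h1 : ∀ᶠ p' in 𝓝[strip S ε] p, p'.2 ∈ e.source :=
      (continuousAt_snd.eventually (e.open_source.mem_nhds hps)).filter_mono nhdsWithin_le_nhds
    have h2 := tendsto_stripCoord (ε := ε) hps
    rw [hpq] at h2
    filter_upwards [h1, h2.eventually hgood] with p' h3 h4
    have h5 := (hexp _ h4.1 h4.2.1 h4.2.2).2.1
    rwa [stripPt_stripCoord h3] at h5
  rw [← hpq] at hc
  have hct : X (ζ (stripCoord e p)) ∈ ctarget x₀ := by
    rw [hpq]
    exact hqP.1
  obtain ⟨hmd, hcomps⟩ := comps_mfderivWithin_strip hε.1 hem hpstrip hps hc hct hev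
  refine ⟨hdef, hmd, ?_⟩
  have hmem : J.deform h V p ∈ csource x₀ := by
    rw [hdeform]
    exact chartPt_mem hqP.1
  have hcm : cmap x₀ (J.deform h V p) = X z := by
    rw [hdeform, hζq, cmap_chartPt]
    rw [← hζq]
    exact hqP.1
  have hL : ∀ a : TangentSpace (modelR 2) p, comps x₀ (mfderivWithin (modelR 2) 𝓘(ℝ, Eu 7)
      (J.deform h V) (strip S ε) p a) = η (stripDeriv e p a) := by
    intro a
    rw [hcomps a, hη, hpq]
    simp [add_comm]
  have hηlin : ∀ (a b : ℝ) (u v : ℝ × Eu 2), η (a • u + b • v) = a • η u + b • η v := by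
    intro a b u v
    simp only [hη]
    rw [← map_smul, ← map_smul, ← map_add]
    congr 1
    refine Prod.ext ?_ ?_
    · simp
    · simp only [map_add, map_smul, _root_.add_apply, _root_.smul_apply, Prod.snd_add,
        Prod.smul_snd, smul_add]
      abel
  have h1 := htrans (G.tau (J.deform h V p)
    (mfderivWithin (modelR 2) 𝓘(ℝ, Eu 7) (J.deform h V) (strip S ε) p (basisVec p 0))
    (mfderivWithin (modelR 2) 𝓘(ℝ, Eu 7) (J.deform h V) (strip S ε) p (basisVec p 1))
    (mfderivWithin (modelR 2) 𝓘(ℝ, Eu 7) (J.deform h V) (strip S ε) p (basisVec p 2)))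
  rw [comps_tau G hmem, hL, hL, hL, stripDeriv_basisVec_zero, stripDeriv_basisVec_one,
    stripDeriv_basisVec_two, hηlin, hηlin, chartTau_combination, map_smul, hcm, hζq] at h1
  refine Eq.trans ?_ h1
  exact comps_congr (expCurve_zero hdef).symm _

/-- The value of `F` in terms of the pullback of `τ` in a chart: the determinant of the change of
coordinates cancels. -/
theorem F_eq_sum (hε₀ : 0 < ε₀) {ε : ℝ} {h : Metric7 M} {V : J.Field}
    (hq : q ∈ goodSet J (H.chart i) x₀) {T : Eu 7}
    (hT : comps x₀ (J.pullTau h ε V (stripPt (H.chart i) q) (basisVec _ 0) (basisVec _ 1)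
      (basisVec _ 2)) = chartDet (H.chart i) (stripPt (H.chart i) q).2 • T) {c : ℝ}
    (hc : Real.sign (G.form (J.thin (0, (H.chart i).symm q.2))
      (J.dthin (0, (H.chart i).symm q.2) (basisVec (0, (H.chart i).symm q.2) 0))
      (J.dthin (0, (H.chart i).symm q.2) (basisVec (0, (H.chart i).symm q.2) 1))
      (J.dthin (0, (H.chart i).symm q.2) (basisVec (0, (H.chart i).symm q.2) 2))) =
      c * Real.sign (chartDet (H.chart i) ((H.chart i).symm q.2))) :
    J.F h ε V (stripPt (H.chart i) q) = ∑ a,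
      coeffMap (c * Real.sqrt (gramDet J (H.chart i) x₀ q))⁻¹
        (chartMetric G.metric x₀ (thinCoord J (H.chart i) x₀ q)) (frameCoord H i x₀ q) T a •
        H.frame i a (stripPt (H.chart i) q) := by
  set e := H.chart i with he
  have hem : e ∈ IsManifold.maximalAtlas 𝓘(ℝ, Eu 2) ∞ S := H.chart_mem i
  set p := stripPt e q with hp
  have hpq : stripCoord e p = q := stripCoord_stripPt hq.2.1
  have hps : p.2 ∈ e.source := e.map_target hq.2.1
  have hs : p ∈ Icc 0 ε₀ ×ˢ e.source := ⟨hq.1.1, hps⟩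
  set Δ := chartDet e p.2 with hΔ
  have hΔ0 : Δ ≠ 0 := chartDet_ne_zero hem hps
  have hdvol : J.dvol p = Δ * (c * Real.sqrt (gramDet J e x₀ q)) := by
    unfold HolomorphicCurve.dvol
    rw [gram_dthin hε₀ hem hps (hpq.symm ▸ hq), hpq, Real.sqrt_mul (sq_nonneg _),
      Real.sqrt_sq_eq_abs]
    have h1 : Real.sign Δ * |Δ| = Δ := by
      rcases lt_or_gt_of_ne hΔ0 with h | h
      · rw [Real.sign_of_neg h, abs_of_neg h]; ring
      · rw [Real.sign_of_pos h, abs_of_pos h]; ring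
    have h2 : Real.sign (G.form (J.thin (0, p.2)) (J.dthin (0, p.2) (basisVec (0, p.2) 0))
      (J.dthin (0, p.2) (basisVec (0, p.2) 1)) (J.dthin (0, p.2) (basisVec (0, p.2) 2))) =
      c * Real.sign Δ := hc
    rw [h2]
    linear_combination (c * Real.sqrt (gramDet J e x₀ q)) * h1
  unfold HolomorphicCurve.F
  rw [normalProj_eq_sum (p := p) hε₀ hq.1.1 (e := fun a => H.frame i a p)
    (fun a => H.frame_normal i a _ hs) (fun a b => H.frame_orthonormal i a b _ hs), Finset.smul_sum]
  refine Finset.sum_congr rfl fun a _ => ?_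
  rw [smul_smul]
  congr 1
  rw [inner_eq_chartMetric G.metric hq.2.2, hT, coeffMap_apply, frameCoord_single, hdvol, mul_inv,
    map_smul, _root_.smul_apply, smul_eq_mul]
  change Δ⁻¹ * (c * Real.sqrt (gramDet J e x₀ q))⁻¹ *
    (Δ * chartMetric G.metric x₀ (thinCoord J e x₀ q) T (comps x₀ (H.frame i a p))) = _
  have : Δ⁻¹ * Δ = 1 := inv_mul_cancel₀ hΔ0
  linear_combination ((c * Real.sqrt (gramDet J e x₀ q))⁻¹ *
    chartMetric G.metric x₀ (thinCoord J e x₀ q) T (comps x₀ (H.frame i a p))) * this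

end HolomorphicCurve.HolderCharts

end LocalFormula

/-! ### The deformation map as a smooth function of jets -/

theorem tendsto_clm_apply {X E F : Type*} [NormedAddCommGroup E] [NormedSpace ℝ E]
    [NormedAddCommGroup F] [NormedSpace ℝ F] {l : Filter X} {A : X → E →L[ℝ] F} {v : X → E}
    {A₀ : E →L[ℝ] F} {v₀ : E} (hA : Tendsto A l (𝓝 A₀)) (hv : Tendsto v l (𝓝 v₀)) :
    Tendsto (fun x => A x (v x)) l (𝓝 (A₀ v₀)) :=
  ((isBoundedBilinearMap_apply (𝕜 := ℝ) (E := E) (F := F)).continuous.tendsto (A₀, v₀)).comp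
    (hA.prodMk_nhds hv)

/-- The values at a point of the coefficients of the local formula: the map to the components in
the frame, the point, the frame, and the derivatives of the last two. -/
abbrev JetParam : Type := (Eu 7 →L[ℝ] Eu 4) × Eu 7 × (Eu 4 →L[ℝ] Eu 7) ×
  (ℝ × Eu 2 →L[ℝ] Eu 7) × (ℝ × Eu 2 →L[ℝ] Eu 4 →L[ℝ] Eu 7)

/-- The `1`-jet at a point of the components of a section. -/
abbrev Jet : Type := Eu 4 × (ℝ × Eu 2 →L[ℝ] Eu 4)

/-- The position and the components in a chart of the value of a section. -/
def jetBase (k : JetParam × Jet) : Eu 7 × Eu 7 := (k.1.2.1, k.1.2.2.1 k.2.1)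

/-- The derivative of `jetBase` in the direction `b`. -/
def jetTangent (k : JetParam × Jet) (b : ℝ × Eu 2) : Eu 7 × Eu 7 :=
  (k.1.2.2.2.1 b, k.1.2.2.2.2 b k.2.1 + k.1.2.2.1 (k.2.2 b))

theorem contDiff_jetBase : ContDiff ℝ ∞ jetBase := by
  unfold jetBase
  fun_prop

theorem contDiff_jetTangent (b : ℝ × Eu 2) : ContDiff ℝ ∞ fun k => jetTangent k b := by
  unfold jetTangent
  have h1 : ContDiff ℝ ∞ fun k : JetParam × Jet => k.1.2.2.2.1 b :=
    ContDiff.clm_apply (by fun_prop) contDiff_const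
  have h2 : ContDiff ℝ ∞ fun k : JetParam × Jet => k.1.2.2.2.2 b :=
    ContDiff.clm_apply (by fun_prop) contDiff_const
  have h3 : ContDiff ℝ ∞ fun k : JetParam × Jet => k.2.2 b :=
    ContDiff.clm_apply (by fun_prop) contDiff_const
  have h4 : ContDiff ℝ ∞ fun k : JetParam × Jet => k.2.1 := by fun_prop
  have h5 : ContDiff ℝ ∞ fun k : JetParam × Jet => k.1.2.2.1 := by fun_prop
  exact h1.prodMk ((h2.clm_apply h4).add (h5.clm_apply h3))

section JetOp

variable {M : Type*} [TopologicalSpace M] [ChartedSpace (Eu 7) M] [IsManifold 𝓘(ℝ, Eu 7) ∞ M]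
variable {Λ : Type} [TopologicalSpace Λ] [CompactSpace Λ] [LocallyCompactSpace Λ]

/-- Values of the parallel transport and of the exponential map and its partial derivatives. -/
abbrev TauState : Type := (Eu 7 →L[ℝ] Eu 7) × Eu 7 × Eu 7 × Eu 7 × Eu 7

/-- The value of `τ`, transported back. -/
def tauOf (G : G2Structure M) (x₀ : M) (s : TauState) : Eu 7 :=
  s.1 (chartTau G x₀ s.2.1 s.2.2.1 s.2.2.2.1 s.2.2.2.2)

theorem contDiffOn_tauOf (G : G2Structure M) (x₀ : M) :
    ContDiffOn ℝ ∞ (tauOf G x₀) (univ ×ˢ ctarget x₀ ×ˢ univ) := by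
  have h1 : ContDiffOn ℝ ∞ (fun s : TauState => s.1) (univ ×ˢ ctarget x₀ ×ˢ univ) :=
    contDiffOn_fst
  have h2 : ContDiffOn ℝ ∞ (fun s : TauState => s.2) (univ ×ˢ ctarget x₀ ×ˢ univ) :=
    contDiffOn_snd
  exact h1.clm_apply ((contDiffOn_chartTau G x₀).comp h2 fun s hs => hs.2)

/-- All the values entering in the local formula, as continuous functions of the parameter. -/
def tauStateOf (X : Eu 7 × Eu 7 → C(Λ, Eu 7)) (Q : Eu 7 × Eu 7 → C(Λ, Eu 7 →L[ℝ] Eu 7))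
    (k : JetParam × Jet) : C(Λ, TauState) :=
  pairCLM (Q (jetBase k), pairCLM (X (jetBase k),
    pairCLM (fderiv ℝ X (jetBase k) (jetTangent k (stdVec 0)),
      pairCLM (fderiv ℝ X (jetBase k) (jetTangent k (stdVec 1)),
        fderiv ℝ X (jetBase k) (jetTangent k (stdVec 2))))))

/-- The components of the deformation map as a function of jets, with values in the continuous
functions of the parameter. -/
def jetOp (G : G2Structure M) (x₀ : M) (X : Eu 7 × Eu 7 → C(Λ, Eu 7))
    (Q : Eu 7 × Eu 7 → C(Λ, Eu 7 →L[ℝ] Eu 7)) (k : JetParam × Jet) : C(Λ, Eu 4) :=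
  pointwiseApply (ContinuousLinearMap.const ℝ Λ k.1.1)
    (superpose (fun _ => tauOf G x₀) (tauStateOf X Q k))

variable {G : G2Structure M} {x₀ : M} {X : Eu 7 × Eu 7 → C(Λ, Eu 7)}
  {Q : Eu 7 × Eu 7 → C(Λ, Eu 7 →L[ℝ] Eu 7)} {k₀ : JetParam × Jet}

theorem contDiffAt_jetOp (hX : ContDiffAt ℝ ∞ X (jetBase k₀)) (hQ : ContDiffAt ℝ ∞ Q (jetBase k₀))
    (hx : MapsTo (X (jetBase k₀)) univ (ctarget x₀)) : ContDiffAt ℝ ∞ (jetOp G x₀ X Q) k₀ := by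
  have hb := contDiff_jetBase.contDiffAt (x := k₀)
  have h1 : ContDiffAt ℝ ∞ (fun k => X (jetBase k)) k₀ := hX.comp k₀ hb
  have h2 : ContDiffAt ℝ ∞ (fun k => Q (jetBase k)) k₀ := hQ.comp k₀ hb
  have h3 : ContDiffAt ℝ ∞ (fun k => fderiv ℝ X (jetBase k)) k₀ :=
    ContDiffAt.comp (g := fderiv ℝ X) k₀ (hX.fderiv_right (by simp)) hb
  have h4 : ∀ b, ContDiffAt ℝ ∞ (fun k => fderiv ℝ X (jetBase k) (jetTangent k b)) k₀ :=
    fun b => h3.clm_apply (contDiff_jetTangent b).contDiffAt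
  have h5 : ContDiffAt ℝ ∞ (tauStateOf X Q) k₀ :=
    contDiffAt_pairCLM h2 (contDiffAt_pairCLM h1 (contDiffAt_pairCLM (h4 _)
      (contDiffAt_pairCLM (h4 _) (h4 _))))
  have hO : IsOpen ((univ ×ˢ ctarget x₀ ×ˢ univ : Set TauState)) :=
    isOpen_univ.prod ((isOpen_ctarget x₀).prod isOpen_univ)
  have hmaps : MapsTo (tauStateOf X Q k₀) univ (univ ×ˢ ctarget x₀ ×ˢ univ) := by
    intro l _
    simp only [tauStateOf, pairCLM_apply]
    exact ⟨trivial, hx (mem_univ l), trivial⟩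
  have h6 : ContDiffAt ℝ ∞ (fun k => superpose (fun _ : Λ => tauOf G x₀) (tauStateOf X Q k)) k₀ :=
    ((SmoothFamily.of_contDiffOn hO (contDiffOn_tauOf G x₀)).contDiffAt_superpose hO hmaps).comp
      k₀ h5
  have h7 : ContDiffAt ℝ ∞ (fun k : JetParam × Jet =>
      (ContinuousLinearMap.const ℝ Λ k.1.1 : C(Λ, Eu 7 →L[ℝ] Eu 4))) k₀ :=
    ((ContinuousLinearMap.const ℝ Λ :
      (Eu 7 →L[ℝ] Eu 4) →L[ℝ] C(Λ, Eu 7 →L[ℝ] Eu 4)).contDiff.contDiffAt).comp k₀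
      (by fun_prop : ContDiffAt ℝ ∞ (fun k : JetParam × Jet => k.1.1) k₀)
  have h8 : ContDiffAt ℝ ∞ (fun k : JetParam × Jet =>
      pointwiseApply (ContinuousLinearMap.const ℝ Λ k.1.1 : C(Λ, Eu 7 →L[ℝ] Eu 4))) k₀ :=
    ((pointwiseApply (K := Λ) (E := Eu 7) (F := Eu 4)).contDiff.contDiffAt).comp k₀ h7
  exact h8.clm_apply h6

theorem jetOp_apply {k : JetParam × Jet} {l : Λ}
    (hx : MapsTo (X (jetBase k)) univ (ctarget x₀)) : jetOp G x₀ X Q k l =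
      k.1.1 (Q (jetBase k) l (chartTau G x₀ (X (jetBase k) l)
        (fderiv ℝ X (jetBase k) (jetTangent k (stdVec 0)) l)
        (fderiv ℝ X (jetBase k) (jetTangent k (stdVec 1)) l)
        (fderiv ℝ X (jetBase k) (jetTangent k (stdVec 2)) l))) := by
  have hO : IsOpen ((univ ×ˢ ctarget x₀ ×ˢ univ : Set TauState)) :=
    isOpen_univ.prod ((isOpen_ctarget x₀).prod isOpen_univ)
  have hmaps : MapsTo (tauStateOf X Q k) univ (univ ×ˢ ctarget x₀ ×ˢ univ) := by
    intro l _
    simp only [tauStateOf, pairCLM_apply]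
    exact ⟨trivial, hx (mem_univ l), trivial⟩
  unfold jetOp
  rw [pointwiseApply_apply,
    (SmoothFamily.of_contDiffOn hO (contDiffOn_tauOf G x₀)).superpose_apply hmaps]
  simp only [tauStateOf, pairCLM_apply, tauOf]
  rfl

end JetOp

section LocalFormula

variable {M : Type*} [TopologicalSpace M] [T2Space M] [ChartedSpace (Eu 7) M]
  [IsManifold 𝓘(ℝ, Eu 7) ∞ M]
variable {C : Type*} [TopologicalSpace C] [ChartedSpace (Eu 4) C] [IsManifold 𝓘(ℝ, Eu 4) ∞ C]
variable {S : Type*} [TopologicalSpace S] [ChartedSpace (Eu 2) S] [IsManifold 𝓘(ℝ, Eu 2) ∞ S]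
variable {G : G2Structure M} {ε₀ : ℝ} {K : CoassociativeFamily G C ε₀}
variable {J : HolomorphicCurve K S}

namespace HolomorphicCurve.HolderCharts

variable {H : J.HolderCharts} {i : Fin H.num}

/-- The `1`-jet at `q` of the components of `V`, on the strip of width `ε`. -/
def jetOf (H : J.HolderCharts) (i : Fin H.num) (ε : ℝ) (V : J.Field) (q : ℝ × Eu 2) : Jet :=
  (H.local_ i V q, fderivWithin ℝ (H.local_ i V) (strip (Eu 2) ε) q)

/-- The coefficients of the local formula, with the sign `c` of the volume form. -/
def jetParam (H : J.HolderCharts) (i : Fin H.num) (x₀ : M) (c : ℝ) (q : ℝ × Eu 2) : JetParam :=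
  (coeffMap (c * Real.sqrt (gramDet J (H.chart i) x₀ q))⁻¹
    (chartMetric G.metric x₀ (thinCoord J (H.chart i) x₀ q)) (frameCoord H i x₀ q),
    thinCoord J (H.chart i) x₀ q, frameCoord H i x₀ q, thinCoordDeriv J (H.chart i) x₀ q,
    frameCoordDeriv H i x₀ q)

theorem contDiffWithinAt_coeffMap {s : Set (ℝ × Eu 2)} {q : ℝ × Eu 2} {c : ℝ × Eu 2 → ℝ}
    {m : ℝ × Eu 2 → BilinForm7} {E : ℝ × Eu 2 → Eu 4 →L[ℝ] Eu 7} (hc : ContDiffWithinAt ℝ ∞ c s q)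
    (hm : ContDiffWithinAt ℝ ∞ m s q) (hE : ContDiffWithinAt ℝ ∞ E s q) :
    ContDiffWithinAt ℝ ∞ (fun q => coeffMap (c q) (m q) (E q)) s q := by
  unfold coeffMap
  refine hc.smul (ContDiffWithinAt.sum fun a _ => ?_)
  have h1 : ContDiffWithinAt ℝ ∞ (fun q => (m q).flip) s q :=
    ((ContinuousLinearMap.flipₗᵢ ℝ (Eu 7) (Eu 7) ℝ).contDiff.contDiffAt).comp_contDiffWithinAt q hm
  have h2 : ContDiffWithinAt ℝ ∞ (fun q => (m q).flip (E q (EuclideanSpace.single a 1))) s q :=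
    h1.clm_apply (hE.clm_apply contDiffWithinAt_const)
  exact (((ContinuousLinearMap.smulRightL ℝ (Eu 7) (Eu 4)).flip
    (EuclideanSpace.single a 1)).contDiff.contDiffAt).comp_contDiffWithinAt q h2

theorem contDiffWithinAt_jetParam (hε₀ : 0 < ε₀) {x₀ : M} {c : ℝ} (hc : c ≠ 0) {q : ℝ × Eu 2}
    (hq : q ∈ goodSet J (H.chart i) x₀) :
    ContDiffWithinAt ℝ ∞ (jetParam H i x₀ c) (strip (Eu 2) ε₀) q := by
  have h1 := contDiffWithinAt_thinCoord (H.chart_mem i) hq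
  have h2 := contDiffWithinAt_frameCoord hq
  have hpos := gramDet_pos hε₀ (H.chart_mem i) hq
  have h3 : ContDiffWithinAt ℝ ∞
      (fun q => (c * Real.sqrt (gramDet J (H.chart i) x₀ q))⁻¹) (strip (Eu 2) ε₀) q :=
    (contDiffWithinAt_const.mul ((contDiffWithinAt_gramDet hε₀ (H.chart_mem i) hq).sqrt
      hpos.ne')).inv (mul_ne_zero hc (Real.sqrt_pos.2 hpos).ne')
  have h4 : ContDiffWithinAt ℝ ∞ (fun q => chartMetric G.metric x₀
      (thinCoord J (H.chart i) x₀ q)) (strip (Eu 2) ε₀) q :=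
    ContDiffAt.comp_contDiffWithinAt (g := chartMetric G.metric x₀)
      (f := thinCoord J (H.chart i) x₀) q
      ((contDiffOn_chartMetric G.metric x₀).contDiffAt
        ((isOpen_ctarget x₀).mem_nhds (cmap_mem hq.2.2))) h1
  exact (contDiffWithinAt_coeffMap h3 h4 h2).prodMk (h1.prodMk (h2.prodMk
    ((contDiffWithinAt_thinCoordDeriv hε₀ (H.chart_mem i) hq).prodMk
      (contDiffWithinAt_frameCoordDeriv hε₀ hq))))

set_option maxHeartbeats 800000 in
/-- Near every point, the deformation map is a smooth function of the `1`-jet of the section, with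
values in the continuous functions of the parameter `ε` of the metrics. -/
theorem exists_local_formula (hε₀ : 0 < ε₀) (A : AdaptedMetrics K) {q₀ : ℝ × Eu 2}
    (hq₀ : q₀.1 ∈ Icc 0 ε₀) (hq₀' : q₀.2 ∈ (H.chart i).target) :
    ∃ (κ : ℝ × Eu 2 → JetParam) (Ψ : JetParam × Jet → C(Icc (0 : ℝ) ε₀, Eu 4)),
      ContDiffAt ℝ ∞ Ψ (κ q₀, 0) ∧ ContDiffWithinAt ℝ ∞ κ (strip (Eu 2) ε₀) q₀ ∧
      ∃ δ > 0, ∀ᶠ q in 𝓝[strip (Eu 2) ε₀] q₀, ∀ (ε : ℝ) (hε : ε ∈ Ioc 0 ε₀) (V : J.Field),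
        q.1 ≤ ε → (∀ p ∈ strip S ε, J.IsNormal p (V p)) →
        DifferentiableWithinAt ℝ (H.local_ i V) (strip (Eu 2) ε) q → ‖H.local_ i V q‖ < δ →
        ExpDefined (A.metric ε) (J.thin (stripPt (H.chart i) q)) (V (stripPt (H.chart i) q)) ∧
        MDifferentiableWithinAt (modelR 2) 𝓘(ℝ, Eu 7) (J.deform (A.metric ε) V) (strip S ε)
          (stripPt (H.chart i) q) ∧
        J.F (A.metric ε) ε V (stripPt (H.chart i) q) =
          ∑ a, Ψ (κ q, jetOf H i ε V q) ⟨ε, hε.1.le, hε.2⟩ a •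
            H.frame i a (stripPt (H.chart i) q) := by
  set e := H.chart i with he
  have hem : e ∈ IsManifold.maximalAtlas 𝓘(ℝ, Eu 2) ∞ S := H.chart_mem i
  set x₀ := J.thin (stripPt e q₀) with hx₀
  have hgood₀ : q₀ ∈ goodSet J e x₀ := ⟨⟨hq₀, trivial⟩, hq₀', mem_chart_source _ _⟩
  obtain ⟨X, Q, hX, hQ, hXQ⟩ := exists_exp_family G.metric (A.smoothFamily x₀)
    (y₀ := thinCoord J e x₀ q₀) (cmap_mem hgood₀.2.2)
  obtain ⟨c, hc, hsign⟩ := exists_sign (J := J) hε₀ hem hq₀'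
  have hc0 : c ≠ 0 := by rcases hc with rfl | rfl <;> norm_num
  have hbase : jetBase (jetParam H i x₀ c q₀, 0) = (thinCoord J e x₀ q₀, 0) :=
    Prod.ext rfl (map_zero (frameCoord H i x₀ q₀))
  have hX0 : MapsTo (X (thinCoord J e x₀ q₀, 0)) univ (ctarget x₀) := fun l _ =>
    (hXQ.self_of_nhds l).1
  refine ⟨jetParam H i x₀ c, jetOp G x₀ X Q,
    contDiffAt_jetOp (by rw [hbase]; exact hX) (by rw [hbase]; exact hQ) (by rw [hbase]; exact hX0),
    contDiffWithinAt_jetParam hε₀ hc0 hgood₀, ?_⟩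
  have hXd : ∀ᶠ z in 𝓝 (thinCoord J e x₀ q₀, (0 : Eu 7)), DifferentiableAt ℝ X z := by
    have h1 : ContDiffAt ℝ 1 X (thinCoord J e x₀ q₀, (0 : Eu 7)) := hX.of_le (by simp)
    filter_upwards [h1.eventually (by simp)] with z hz
    exact hz.differentiableAt (by simp)
  have hcont : Tendsto (fun u : (ℝ × Eu 2) × Eu 4 =>
      ((thinCoord J e x₀ u.1, frameCoord H i x₀ u.1 u.2) : Eu 7 × Eu 7))
      (𝓝[strip (Eu 2) ε₀] q₀ ×ˢ 𝓝 0) (𝓝 (thinCoord J e x₀ q₀, 0)) := by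
    have h1 : Tendsto (thinCoord J e x₀) (𝓝[strip (Eu 2) ε₀] q₀) (𝓝 (thinCoord J e x₀ q₀)) :=
      (contDiffWithinAt_thinCoord hem hgood₀).continuousWithinAt
    have h2 : Tendsto (frameCoord H i x₀) (𝓝[strip (Eu 2) ε₀] q₀) (𝓝 (frameCoord H i x₀ q₀)) :=
      (contDiffWithinAt_frameCoord hgood₀).continuousWithinAt
    have h3 : Tendsto (fun u : (ℝ × Eu 2) × Eu 4 => frameCoord H i x₀ u.1 u.2)
        (𝓝[strip (Eu 2) ε₀] q₀ ×ˢ 𝓝 0) (𝓝 (frameCoord H i x₀ q₀ 0)) :=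
      tendsto_clm_apply (h2.comp tendsto_fst) tendsto_snd
    rw [map_zero] at h3
    exact (h1.comp tendsto_fst).prodMk_nhds h3
  have hev := hcont.eventually (hXQ.eventually_nhds.and hXd)
  obtain ⟨pa, hpa, pb, hpb, hab⟩ := eventually_prod_iff.1 hev
  obtain ⟨δ, hδ, hδb⟩ := Metric.eventually_nhds_iff.1 hpb
  refine ⟨δ, hδ, ?_⟩
  have hsign' : ∀ᶠ q in 𝓝[strip (Eu 2) ε₀] q₀, _ :=
    (continuousAt_snd.eventually hsign).filter_mono nhdsWithin_le_nhds
  filter_upwards [hpa, hsign', goodSet_mem_nhdsWithin hgood₀] with q h1 h2 hq ε hε V hqε hV hf hfδ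
  obtain ⟨h3, h4⟩ := hab h1 (hδb (by rwa [dist_zero_right]))
  simp only [] at h3 h4
  have hP := h3.self_of_nhds
  set z : Eu 7 × Eu 7 := (thinCoord J e x₀ q, frameCoord H i x₀ q (H.local_ i V q)) with hz
  let l : Icc (0 : ℝ) ε₀ := ⟨ε, hε.1.le, hε.2⟩
  have hzb : jetBase (jetParam H i x₀ c q, jetOf H i ε V q) = z := rfl
  have hXl : HasFDerivAt (fun z => X z l) ((ContinuousMap.evalCLM ℝ l :
      C(Icc (0 : ℝ) ε₀, Eu 7) →L[ℝ] Eu 7) ∘L fderiv ℝ X z) z :=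
    (ContinuousMap.evalCLM ℝ l : C(Icc (0 : ℝ) ε₀, Eu 7) →L[ℝ] Eu 7).hasFDerivAt.comp z
      h4.hasFDerivAt
  obtain ⟨h5, h6, h7⟩ := comps_pullTau (H := H) (i := i) (x₀ := x₀) hε₀ hε hV hq hqε
    hf.hasFDerivWithinAt (X := fun z => X z l) (Q := fun z => Q z l) hz hXl.differentiableAt
    (h3.mono fun z hz => hz l)
    (η := fun b => fderiv ℝ X z (jetTangent (jetParam H i x₀ c q, jetOf H i ε V q) b) l)
    (fun b => by
      rw [hXl.fderiv]
      rfl)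
  refine ⟨h5, h6, ?_⟩
  have hval := jetOp_apply (G := G) (x₀ := x₀) (X := X) (Q := Q)
    (k := (jetParam H i x₀ c q, jetOf H i ε V q)) (l := l)
    (by rw [hzb]; exact fun l _ => (hP l).1)
  rw [hzb] at hval
  rw [F_eq_sum hε₀ hq h7 h2]
  refine Finset.sum_congr rfl fun a _ => ?_
  change _ = jetOp G x₀ X Q (jetParam H i x₀ c q, jetOf H i ε V q) l a • _
  rw [hval]
  rfl

end HolomorphicCurve.HolderCharts

end LocalFormula

/-! ### Sections of the normal bundle -/

section Sections

variable {M : Type*} [TopologicalSpace M] [ChartedSpace (Eu 7) M] [IsManifold 𝓘(ℝ, Eu 7) ∞ M]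
variable {C : Type*} [TopologicalSpace C] [ChartedSpace (Eu 4) C] [IsManifold 𝓘(ℝ, Eu 4) ∞ C]
variable {S : Type*} [TopologicalSpace S] [ChartedSpace (Eu 2) S] [IsManifold 𝓘(ℝ, Eu 2) ∞ S]
variable {G : G2Structure M} {ε₀ : ℝ} {K : CoassociativeFamily G C ε₀}
variable {J : HolomorphicCurve K S}

namespace HolomorphicCurve.HolderCharts

variable {H : J.HolderCharts} {i : Fin H.num} {ε : ℝ} {q : ℝ × Eu 2} {V V' : J.Field}

/-- `V` is a `C¹` section of the normal bundle of `A'_ε`. -/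
structure IsC1Section (H : J.HolderCharts) (ε : ℝ) (V : J.Field) : Prop where
  normal : ∀ p ∈ strip S ε, J.IsNormal p (V p)
  contDiffOn : ∀ i, ContDiffOn ℝ 1 (H.local_ i V) (H.patch ε i)

theorem local_add (i : Fin H.num) (V V' : J.Field) (q : ℝ × Eu 2) :
    H.local_ i (V + V') q = H.local_ i V q + H.local_ i V' q := by
  ext a
  change innerBilin G.metric _ (V _ + V' _) _ =
    innerBilin G.metric _ (V _) _ + innerBilin G.metric _ (V' _) _
  rw [map_add, LinearMap.add_apply]

theorem local_smul (i : Fin H.num) (c : ℝ) (V : J.Field) (q : ℝ × Eu 2) :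
    H.local_ i (c • V) q = c • H.local_ i V q := by
  ext a
  change innerBilin G.metric _ (c • V _) _ = c * innerBilin G.metric _ (V _) _
  rw [map_smul, LinearMap.smul_apply, smul_eq_mul]

theorem local_sub (i : Fin H.num) (V V' : J.Field) (q : ℝ × Eu 2) :
    H.local_ i (V - V') q = H.local_ i V q - H.local_ i V' q := by
  have h : V - V' = V + (-1 : ℝ) • V' := by
    rw [neg_one_smul, sub_eq_add_neg]
  rw [h, local_add, local_smul, neg_one_smul, sub_eq_add_neg]

theorem local_zero (i : Fin H.num) (q : ℝ × Eu 2) : H.local_ i (0 : J.Field) q = 0 := by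
  have h := local_smul (H := H) i 0 (0 : J.Field) q
  rwa [zero_smul, zero_smul] at h

theorem IsC1Section.add (hV : IsC1Section H ε V) (hV' : IsC1Section H ε V') :
    IsC1Section H ε (V + V') where
  normal p hp := (hV.normal p hp).add (hV'.normal p hp)
  contDiffOn i := ((hV.contDiffOn i).add (hV'.contDiffOn i)).congr fun q _ => local_add i V V' q

theorem IsC1Section.smul (hV : IsC1Section H ε V) (c : ℝ) : IsC1Section H ε (c • V) where
  normal p hp := (hV.normal p hp).smul c
  contDiffOn i := ((hV.contDiffOn i).const_smul c).congr fun q _ => local_smul i c V q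

theorem isC1Section_zero : IsC1Section H ε (0 : J.Field) where
  normal _ _ _ := map_zero _
  contDiffOn i := contDiffOn_const.congr fun q _ => local_zero i q

theorem patch_subset_strip : H.patch ε i ⊆ strip (Eu 2) ε := fun _ hq => ⟨hq.1, trivial⟩

theorem mem_target_of_mem_patch (hq : q ∈ H.patch ε i) : q.2 ∈ (H.chart i).target :=
  H.disc_subset i hq.2

theorem convex_patch : Convex ℝ (H.patch ε i) :=
  (convex_Icc 0 ε).prod (convex_closedBall _ _)

theorem isCompact_patch : IsCompact (H.patch ε i) :=
  isCompact_Icc.prod (isCompact_closedBall _ _)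

theorem uniqueDiffOn_patch (hε : 0 < ε) : UniqueDiffOn ℝ (H.patch ε i) := by
  refine (uniqueDiffOn_Icc hε).prod (uniqueDiffOn_convex (convex_closedBall _ _) ?_)
  rw [interior_closedBall']
  exact ⟨H.center i, Metric.mem_ball_self (H.radius_pos i)⟩

/-- Every point of a strip is in the interior of some patch. -/
theorem exists_patch (p : ℝ × S) (hp : p ∈ strip S ε) : ∃ j, p.2 ∈ (H.chart j).source ∧
    stripCoord (H.chart j) p ∈ H.patch ε j ∧
    H.patch ε j ∈ 𝓝[strip (Eu 2) ε] stripCoord (H.chart j) p := by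
  obtain ⟨j, hj, hjb⟩ := H.cover p.2
  refine ⟨j, hj, ⟨hp.1, Metric.ball_subset_closedBall hjb⟩, ?_⟩
  have h1 : ∀ᶠ q : ℝ × Eu 2 in 𝓝 (stripCoord (H.chart j) p),
      q.2 ∈ Metric.ball (H.center j) (H.radius j) :=
    continuousAt_snd.eventually (Metric.isOpen_ball.mem_nhds hjb)
  filter_upwards [self_mem_nhdsWithin, h1.filter_mono nhdsWithin_le_nhds] with q h2 h3
  exact ⟨h2.1, Metric.ball_subset_closedBall h3⟩

/-- The components of a section in a frame are differentiable also on the boundary of the disc,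
within the strip: the section is differentiable there by means of another frame. -/
theorem IsC1Section.differentiableWithinAt_local (hε₀ : 0 < ε₀) (hε : ε ∈ Ioc 0 ε₀)
    (hV : IsC1Section H ε V) (hq : q ∈ strip (Eu 2) ε) (hq' : q.2 ∈ (H.chart i).target) :
    DifferentiableWithinAt ℝ (H.local_ i V) (strip (Eu 2) ε) q := by
  have hsub : strip (Eu 2) ε ⊆ strip (Eu 2) ε₀ := prod_mono_left (Icc_subset_Icc_right hε.2)
  set p := stripPt (H.chart i) q with hp
  have hpstrip : p ∈ strip S ε := ⟨hq.1, trivial⟩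
  have hpε₀ : p ∈ strip S ε₀ := ⟨⟨hq.1.1, hq.1.2.trans hε.2⟩, trivial⟩
  obtain ⟨j, hj, hjp, hjn⟩ := exists_patch (H := H) p hpstrip
  set qj := stripCoord (H.chart j) p with hqj
  set x₀ := J.thin p with hx₀
  have hgi : q ∈ goodSet J (H.chart i) x₀ := ⟨hsub hq, hq', mem_chart_source _ _⟩
  have hgj : qj ∈ goodSet J (H.chart j) x₀ := by
    refine ⟨⟨hpε₀.1, trivial⟩, (H.chart j).map_source hj, ?_⟩
    rw [hqj, stripPt_stripCoord hj]
    exact mem_chart_source _ _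
  have h1 : DifferentiableWithinAt ℝ (H.local_ j V) (strip (Eu 2) ε) qj :=
    (((hV.contDiffOn j).differentiableOn (by simp)) qj hjp).mono_of_mem_nhdsWithin hjn
  have h2 := ((hasFDerivWithinAt_frameCoord hgj).mono hsub).clm_apply h1.hasFDerivWithinAt
  have h3 := hasMFDerivWithinAt_comp_stripCoord (H.chart_mem j) hj h2
  have h4 : MDifferentiableWithinAt (modelR 2) 𝓘(ℝ, Eu 7) (fun p => comps x₀ (V p))
      (strip S ε) p := by
    refine h3.mdifferentiableWithinAt.congr_of_eventuallyEq_of_mem ?_ hpstrip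
    have h5 : ∀ᶠ p' : ℝ × S in 𝓝[strip S ε] p, p'.2 ∈ (H.chart j).source :=
      (continuousAt_snd.eventually ((H.chart j).open_source.mem_nhds hj)).filter_mono
        nhdsWithin_le_nhds
    filter_upwards [h5, self_mem_nhdsWithin] with p' h6 h7
    have h8 := comps_section (H := H) (i := j) (x₀ := x₀) (q := stripCoord (H.chart j) p') (V := V)
      hε₀ ⟨h7.1.1, h7.1.2.trans hε.2⟩ ((H.chart j).map_source h6)
      (hV.normal _ ⟨h7.1, trivial⟩)
    rwa [stripPt_stripCoord h6] at h8
  have hmaps : MapsTo (stripPt (H.chart i)) (strip (Eu 2) ε) (strip S ε) :=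
    fun q hq => ⟨hq.1, trivial⟩
  have h5 : DifferentiableWithinAt ℝ (fun q => comps x₀ (V (stripPt (H.chart i) q)))
      (strip (Eu 2) ε) q := by
    rw [← mdifferentiableWithinAt_iff_differentiableWithinAt]
    exact h4.comp q ((contMDiffAt_stripPt (H.chart_mem i) hq').mdifferentiableAt
      (by simp)).mdifferentiableWithinAt hmaps
  have h6 : DifferentiableWithinAt ℝ (fun q => chartMetric G.metric x₀
      (thinCoord J (H.chart i) x₀ q)) (strip (Eu 2) ε) q := by
    have h7 := (contDiffOn_chartMetric G.metric x₀).contDiffAt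
      ((isOpen_ctarget x₀).mem_nhds (cmap_mem hgi.2.2))
    exact DifferentiableAt.comp_differentiableWithinAt (g := chartMetric G.metric x₀)
      (f := thinCoord J (H.chart i) x₀) q (h7.differentiableAt (by simp))
      ((hasFDerivWithinAt_thinCoord (H.chart_mem i) hgi).mono hsub).differentiableWithinAt
  have h7 : DifferentiableWithinAt ℝ (frameCoord H i x₀) (strip (Eu 2) ε) q :=
    ((hasFDerivWithinAt_frameCoord hgi).mono hsub).differentiableWithinAt
  rw [differentiableWithinAt_euclidean]
  intro a
  have h8 : DifferentiableWithinAt ℝ (fun q => chartMetric G.metric x₀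
      (thinCoord J (H.chart i) x₀ q) (comps x₀ (V (stripPt (H.chart i) q)))
      (frameCoord H i x₀ q (EuclideanSpace.single a 1))) (strip (Eu 2) ε) q :=
    (h6.clm_apply h5).clm_apply (h7.clm_apply (differentiableWithinAt_const _))
  refine h8.congr_of_eventuallyEq_of_mem ?_ hq
  filter_upwards [nhdsWithin_mono _ hsub (goodSet_mem_nhdsWithin hgi)] with q' h9
  rw [frameCoord_single]
  exact inner_eq_chartMetric G.metric h9.2.2 _ _

theorem fderivWithin_patch (hε₀ : 0 < ε₀) (hε : ε ∈ Ioc 0 ε₀) (hV : IsC1Section H ε V)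
    (hq : q ∈ H.patch ε i) : fderivWithin ℝ (H.local_ i V) (H.patch ε i) q =
      fderivWithin ℝ (H.local_ i V) (strip (Eu 2) ε) q :=
  fderivWithin_subset patch_subset_strip (uniqueDiffOn_patch hε.1 q hq)
    (hV.differentiableWithinAt_local hε₀ hε (patch_subset_strip hq) (mem_target_of_mem_patch hq))

theorem jetOf_add_smul (hε₀ : 0 < ε₀) (hε : ε ∈ Ioc 0 ε₀) (hV : IsC1Section H ε V)
    (hV' : IsC1Section H ε V') (hq : q ∈ H.patch ε i) (r : ℝ) :
    jetOf H i ε (V + r • V') q = jetOf H i ε V q + r • jetOf H i ε V' q := by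
  have hs := patch_subset_strip hq
  have h1 := (hV.differentiableWithinAt_local hε₀ hε hs
    (mem_target_of_mem_patch hq)).hasFDerivWithinAt
  have h2 := (hV'.differentiableWithinAt_local hε₀ hε hs
    (mem_target_of_mem_patch hq)).hasFDerivWithinAt
  have h3 : HasFDerivWithinAt (H.local_ i (V + r • V')) _ (strip (Eu 2) ε) q :=
    (h1.add (h2.const_smul r)).congr (fun q _ => by rw [local_add, local_smul]; rfl)
      (by rw [local_add, local_smul]; rfl)
  refine Prod.ext ?_ ?_
  · change H.local_ i (V + r • V') q = H.local_ i V q + r • H.local_ i V' q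
    rw [local_add, local_smul]
  · exact h3.fderivWithin (uniqueDiffOn_strip hε.1 q hs)

theorem jetOf_zero (hε : 0 < ε) (hq : q ∈ strip (Eu 2) ε) :
    jetOf H i ε (0 : J.Field) q = 0 := by
  have h3 : HasFDerivWithinAt (H.local_ i (0 : J.Field)) (0 : ℝ × Eu 2 →L[ℝ] Eu 4)
      (strip (Eu 2) ε) q :=
    (hasFDerivWithinAt_const (0 : Eu 4) q _).congr (fun q _ => local_zero i q) (local_zero i q)
  exact Prod.ext (local_zero i q) (h3.fderivWithin (uniqueDiffOn_strip hε q hq))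

/-- The components of a combination of the frame fields. -/
theorem local_eq_of_eq_sum (hq : q.1 ∈ Icc 0 ε₀) (hq' : q.2 ∈ (H.chart i).target) {c : Eu 4}
    (h : V (stripPt (H.chart i) q) = ∑ a, c a • H.frame i a (stripPt (H.chart i) q)) :
    H.local_ i V q = c := by
  have hs : stripPt (H.chart i) q ∈ Icc 0 ε₀ ×ˢ (H.chart i).source :=
    ⟨hq, (H.chart i).map_target hq'⟩
  ext a
  change innerBilin G.metric _ (V (stripPt (H.chart i) q)) (H.frame i a (stripPt (H.chart i) q)) = _
  have ho : ∀ b, innerBilin G.metric _ (H.frame i b (stripPt (H.chart i) q))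
    (H.frame i a (stripPt (H.chart i) q)) = if b = a then 1 else 0 := fun b =>
    H.frame_orthonormal i b a _ hs
  rw [h, map_sum, LinearMap.sum_apply]
  simp [ho]

end HolomorphicCurve.HolderCharts

end Sections

/-! ### Second order estimates -/

section Estimates

variable {P W Z : Type*} [NormedAddCommGroup P] [NormedSpace ℝ P] [NormedAddCommGroup W]
  [NormedSpace ℝ W] [NormedAddCommGroup Z] [NormedSpace ℝ Z]

/-- The partial derivative with respect to the second variable. -/
def partialSnd (Ψ : P × W → Z) (k : P × W) : W →L[ℝ] Z :=
  fderiv ℝ Ψ k ∘L ContinuousLinearMap.inr ℝ P W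

/-- The change of the derivative with respect to the second variable from its value at `0`. -/
def derivIncr (Ψ : P × W → Z) (k : P) (w : W) : W →L[ℝ] Z :=
  partialSnd Ψ (k, w) - partialSnd Ψ (k, 0)

/-- Near a point of smoothness, `derivIncr` is Lipschitz in the second variable, and its dependence
on the first variable is Lipschitz with a constant proportional to the second. -/
theorem exists_derivIncr_bound {Ψ : P × W → Z} {k₀ : P} (hΨ : ContDiffAt ℝ ∞ Ψ (k₀, 0)) :
    ∃ ρ > 0, ∃ B : ℝ, 0 ≤ B ∧
      (∀ k ∈ Metric.ball k₀ ρ, ∀ w ∈ Metric.ball (0 : W) ρ, DifferentiableAt ℝ Ψ (k, w)) ∧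
      ∀ k ∈ Metric.ball k₀ ρ, ∀ k' ∈ Metric.ball k₀ ρ, ∀ w ∈ Metric.ball (0 : W) ρ,
        ∀ w' ∈ Metric.ball (0 : W) ρ, ‖derivIncr Ψ k w - derivIncr Ψ k' w'‖ ≤
          B * (‖w - w'‖ + ‖k - k'‖ * ‖w'‖) := by
  have hG : ContDiffAt ℝ ∞ (partialSnd Ψ) (k₀, 0) :=
    (hΨ.fderiv_right (m := ∞) (by simp)).clm_comp contDiffAt_const
  have hDG : ContDiffAt ℝ ∞ (fderiv ℝ (partialSnd Ψ)) (k₀, 0) :=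
    hG.fderiv_right (m := ∞) (by simp)
  obtain ⟨B₁, t₁, ht₁, hB₁⟩ := (hG.of_le (m := 1) (by simp)).exists_lipschitzOnWith
  obtain ⟨B₂, t₂, ht₂, hB₂⟩ := (hDG.of_le (m := 1) (by simp)).exists_lipschitzOnWith
  have h1 : ∀ᶠ k in 𝓝 (k₀, (0 : W)), DifferentiableAt ℝ Ψ k := by
    filter_upwards [(hΨ.of_le (m := 1) (by simp)).eventually (by simp)] with k hk
    exact hk.differentiableAt (by simp)
  have h2 : ∀ᶠ k in 𝓝 (k₀, (0 : W)), DifferentiableAt ℝ (partialSnd Ψ) k := by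
    filter_upwards [(hG.of_le (m := 1) (by simp)).eventually (by simp)] with k hk
    exact hk.differentiableAt (by simp)
  obtain ⟨ρ, hρ, hball⟩ := Metric.eventually_nhds_iff_ball.1
    (((h1.and h2).and ht₁).and ht₂)
  have hmem : ∀ k ∈ Metric.ball k₀ ρ, ∀ w ∈ Metric.ball (0 : W) ρ,
      (k, w) ∈ Metric.ball (k₀, (0 : W)) ρ := by
    intro k hk w hw
    rw [← ball_prod_same]
    exact ⟨hk, hw⟩
  have h0 : (0 : W) ∈ Metric.ball (0 : W) ρ := Metric.mem_ball_self hρ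
  refine ⟨ρ, hρ, B₁ + B₂, by positivity, fun k hk w hw => (hball _ (hmem k hk w hw)).1.1.1,
    fun k hk k' hk' w hw w' hw' => ?_⟩
  have e1 : ‖partialSnd Ψ (k, w) - partialSnd Ψ (k, w')‖ ≤ B₁ * ‖w - w'‖ := by
    have h := hB₁.norm_sub_le (hball _ (hmem k hk w hw)).1.2 (hball _ (hmem k hk w' hw')).1.2
    rwa [Prod.mk_sub_mk, sub_self, Prod.norm_mk, norm_zero,
      max_eq_right (norm_nonneg _)] at h
  have e2 : ‖(partialSnd Ψ (k, w') - partialSnd Ψ (k', w')) -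
      (partialSnd Ψ (k, 0) - partialSnd Ψ (k', 0))‖ ≤ (B₂ * ‖k - k'‖) * ‖w' - 0‖ := by
    refine (convex_ball (0 : W) ρ).norm_image_sub_le_of_norm_hasFDerivWithin_le
      (f := fun w => partialSnd Ψ (k, w) - partialSnd Ψ (k', w))
      (f' := fun w => fderiv ℝ (partialSnd Ψ) (k, w) ∘L ContinuousLinearMap.inr ℝ P W -
        fderiv ℝ (partialSnd Ψ) (k', w) ∘L ContinuousLinearMap.inr ℝ P W)
      (fun v hv => ?_) (fun v hv => ?_) h0 hw'
    · have hd : ∀ k ∈ Metric.ball k₀ ρ, HasFDerivAt (fun w => partialSnd Ψ (k, w))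
          (fderiv ℝ (partialSnd Ψ) (k, v) ∘L ContinuousLinearMap.inr ℝ P W) v := fun k hk =>
        (hball _ (hmem k hk v hv)).1.1.2.hasFDerivAt.comp v (hasFDerivAt_prodMk_right k v)
      exact ((hd k hk).sub (hd k' hk')).hasFDerivWithinAt
    · rw [← ContinuousLinearMap.sub_comp]
      refine (ContinuousLinearMap.opNorm_comp_le _ _).trans ?_
      have h := hB₂.norm_sub_le (hball _ (hmem k hk v hv)).2 (hball _ (hmem k' hk' v hv)).2
      rw [Prod.mk_sub_mk, sub_self, Prod.norm_mk, norm_zero, max_eq_left (norm_nonneg _)] at h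
      calc _ ≤ (B₂ * ‖k - k'‖) * 1 := by
            gcongr
            exact ContinuousLinearMap.norm_inr_le_one _ _ _
        _ = _ := mul_one _
  -- The second difference vanishes for `w' = 0`, whence the factor `‖w'‖`.
  have e3 : derivIncr Ψ k w - derivIncr Ψ k' w' =
      (partialSnd Ψ (k, w) - partialSnd Ψ (k, w')) +
      ((partialSnd Ψ (k, w') - partialSnd Ψ (k', w')) -
      (partialSnd Ψ (k, 0) - partialSnd Ψ (k', 0))) := by
    unfold derivIncr
    abel
  rw [e3]
  rw [sub_zero] at e2
  refine (norm_add_le _ _).trans ((add_le_add e1 e2).trans ?_)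
  have n1 : 0 ≤ ‖w - w'‖ := norm_nonneg _
  have n2 : 0 ≤ ‖k - k'‖ * ‖w'‖ := by positivity
  have b1 : (0 : ℝ) ≤ B₁ := B₁.2
  have b2 : (0 : ℝ) ≤ B₂ := B₂.2
  nlinarith [mul_nonneg b1 n2, mul_nonneg b2 n1]

end Estimates

/-! ### Local estimates -/

section Estimates

variable {P W Z : Type*} [NormedAddCommGroup P] [NormedSpace ℝ P] [NormedAddCommGroup W]
  [NormedSpace ℝ W] [NormedAddCommGroup Z] [NormedSpace ℝ Z]

/-- The bounds of `exists_derivIncr_bound` for the values of the derivatives. -/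
theorem exists_derivIncr_apply_bound {Ψ : P × W → Z} {k₀ : P} (hΨ : ContDiffAt ℝ ∞ Ψ (k₀, 0)) :
    ∃ ρ > 0, ∃ B : ℝ, 0 ≤ B ∧
      (∀ k ∈ Metric.ball k₀ ρ, ∀ w ∈ Metric.ball (0 : W) ρ, DifferentiableAt ℝ Ψ (k, w)) ∧
      (∀ k ∈ Metric.ball k₀ ρ, ∀ w ∈ Metric.ball (0 : W) ρ, ∀ v : W,
        ‖derivIncr Ψ k w v‖ ≤ B * ‖w‖ * ‖v‖) ∧
      ∀ k ∈ Metric.ball k₀ ρ, ∀ k' ∈ Metric.ball k₀ ρ, ∀ w ∈ Metric.ball (0 : W) ρ,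
        ∀ w' ∈ Metric.ball (0 : W) ρ, ∀ v v' : W,
          ‖derivIncr Ψ k w v - derivIncr Ψ k' w' v'‖ ≤
            B * (‖w - w'‖ + ‖k - k'‖ * ‖w'‖) * ‖v‖ + B * ‖w'‖ * ‖v - v'‖ := by
  obtain ⟨ρ, hρ, B, hB, hdiff, hincr⟩ := exists_derivIncr_bound hΨ
  have h0 : (0 : W) ∈ Metric.ball (0 : W) ρ := Metric.mem_ball_self hρ
  have h1 : ∀ k ∈ Metric.ball k₀ ρ, ∀ w ∈ Metric.ball (0 : W) ρ,
      ‖derivIncr Ψ k w‖ ≤ B * ‖w‖ := by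
    intro k hk w hw
    have h3 := hincr k hk k hk w hw 0 h0
    have h4 : derivIncr Ψ k 0 = 0 := sub_self _
    rwa [h4, sub_zero, sub_zero, norm_zero, mul_zero, add_zero] at h3
  have h2 : ∀ k ∈ Metric.ball k₀ ρ, ∀ w ∈ Metric.ball (0 : W) ρ, ∀ v : W,
      ‖derivIncr Ψ k w v‖ ≤ B * ‖w‖ * ‖v‖ := fun k hk w hw v =>
    (ContinuousLinearMap.le_opNorm _ _).trans
      (mul_le_mul_of_nonneg_right (h1 k hk w hw) (norm_nonneg _))
  refine ⟨ρ, hρ, B, hB, hdiff, h2, fun k hk k' hk' w hw w' hw' v v' => ?_⟩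
  have e3 : derivIncr Ψ k w v - derivIncr Ψ k' w' v' =
      (derivIncr Ψ k w - derivIncr Ψ k' w') v + derivIncr Ψ k' w' (v - v') := by
    rw [_root_.sub_apply, map_sub]
    abel
  rw [e3]
  exact (norm_add_le _ _).trans (add_le_add ((ContinuousLinearMap.le_opNorm _ _).trans
    (mul_le_mul_of_nonneg_right (hincr k hk k' hk' w hw w' hw') (norm_nonneg _)))
    (h2 k' hk' w' hw' _))

/-- The derivative, along a line in the second variable, of a combination of fixed vectors. -/
theorem hasDerivAt_sum_smul {Λ : Type*} [TopologicalSpace Λ] [CompactSpace Λ] {n : ℕ}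
    {Ψ : P × W → C(Λ, Eu n)} {k : P} {w₀ w : W} (hΨ : DifferentiableAt ℝ Ψ (k, w₀)) (l : Λ)
    (v : Fin n → Z) : HasDerivAt (fun r : ℝ => ∑ a, Ψ (k, w₀ + r • w) l a • v a)
      (∑ a, partialSnd Ψ (k, w₀) w l a • v a) 0 := by
  have hline : HasDerivAt (fun r : ℝ => ((k, w₀ + r • w) : P × W)) (0, w) 0 := by
    have h : HasDerivAt (fun r : ℝ => w₀ + r • w) w 0 := by
      simpa using ((hasDerivAt_id (0 : ℝ)).smul_const w).const_add w₀
    exact (hasDerivAt_const (0 : ℝ) k).prodMk h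
  have h0 : HasFDerivAt Ψ (fderiv ℝ Ψ (k, w₀)) (k, w₀ + (0 : ℝ) • w) := by
    rw [zero_smul, add_zero]
    exact hΨ.hasFDerivAt
  have h1 : HasDerivAt (fun r : ℝ => Ψ (k, w₀ + r • w)) (partialSnd Ψ (k, w₀) w) 0 :=
    HasFDerivAt.comp_hasDerivAt (f := fun r : ℝ => ((k, w₀ + r • w) : P × W)) (0 : ℝ) h0 hline
  refine HasDerivAt.fun_sum fun a _ => HasDerivAt.smul_const ?_ _
  exact ((EuclideanSpace.proj a : Eu n →L[ℝ] ℝ) ∘L (ContinuousMap.evalCLM ℝ l :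
    C(Λ, Eu n) →L[ℝ] Eu n)).hasFDerivAt.comp_hasDerivAt (0 : ℝ) h1

theorem deriv_eq_of_eq_sum {Λ : Type*} [TopologicalSpace Λ] [CompactSpace Λ] {n : ℕ}
    {Ψ : P × W → C(Λ, Eu n)} {k : P} {w₀ w : W} (hΨ : DifferentiableAt ℝ Ψ (k, w₀)) (l : Λ)
    (v : Fin n → Z) {f : ℝ → Z} (hf : ∀ᶠ r in 𝓝 0, f r = ∑ a, Ψ (k, w₀ + r • w) l a • v a) :
    DifferentiableAt ℝ f 0 ∧ deriv f 0 = ∑ a, partialSnd Ψ (k, w₀) w l a • v a :=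
  have h := (hasDerivAt_sum_smul hΨ l v).congr_of_eventuallyEq hf
  ⟨h.differentiableAt, h.deriv⟩

end Estimates

section LocalEstimates

variable {M : Type*} [TopologicalSpace M] [ChartedSpace (Eu 7) M] [IsManifold 𝓘(ℝ, Eu 7) ∞ M]
variable {C : Type*} [TopologicalSpace C] [ChartedSpace (Eu 4) C] [IsManifold 𝓘(ℝ, Eu 4) ∞ C]
variable {S : Type*} [TopologicalSpace S] [ChartedSpace (Eu 2) S] [IsManifold 𝓘(ℝ, Eu 2) ∞ S]
variable {G : G2Structure M} {ε₀ : ℝ} {K : CoassociativeFamily G C ε₀}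
variable {J : HolomorphicCurve K S}

namespace HolomorphicCurve.HolderCharts

variable {H : J.HolderCharts} {i : Fin H.num} {ε : ℝ} {q : ℝ × Eu 2} {V₀ V : J.Field}

/-- The `1`-jets of the components of `V` on a patch are bounded by `n`, and `α`-Hölder with
constant `n`. -/
structure JetBound (H : J.HolderCharts) (i : Fin H.num) (α : ℝ≥0) (ε : ℝ) (V : J.Field)
    (n : ℝ) : Prop where
  bound : ∀ q ∈ H.patch ε i, ‖jetOf H i ε V q‖ ≤ n
  holder : ∀ q ∈ H.patch ε i, ∀ q' ∈ H.patch ε i,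
    ‖jetOf H i ε V q - jetOf H i ε V q'‖ ≤ n * dist q q' ^ (α : ℝ)

/-- The derivative of the deformation map is the derivative of the local formula. -/
theorem differentiableAt_F (hε₀ : 0 < ε₀) (A : AdaptedMetrics K) (hε : ε ∈ Ioc 0 ε₀)
    {Ψ : JetParam × Jet → C(Icc (0 : ℝ) ε₀, Eu 4)} {k : JetParam} {δ : ℝ}
    (hV₀ : IsC1Section H ε V₀) (hV : IsC1Section H ε V) (hq : q ∈ H.patch ε i)
    (hform : ∀ V : J.Field, IsC1Section H ε V → ‖H.local_ i V q‖ < δ →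
      J.F (A.metric ε) ε V (stripPt (H.chart i) q) =
        ∑ a, Ψ (k, jetOf H i ε V q) ⟨ε, hε.1.le, hε.2⟩ a • H.frame i a (stripPt (H.chart i) q))
    (hδ : ‖H.local_ i V₀ q‖ < δ) (hΨ : DifferentiableAt ℝ Ψ (k, jetOf H i ε V₀ q)) :
    DifferentiableAt ℝ (fun r : ℝ => J.F (A.metric ε) ε (V₀ + r • V) (stripPt (H.chart i) q)) 0 ∧
      H.local_ i (J.F' (A.metric ε) ε V₀ V) q =
        partialSnd Ψ (k, jetOf H i ε V₀ q) (jetOf H i ε V q) ⟨ε, hε.1.le, hε.2⟩ := by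
  have hev : ∀ᶠ r : ℝ in 𝓝 0, J.F (A.metric ε) ε (V₀ + r • V) (stripPt (H.chart i) q) =
      ∑ a, Ψ (k, jetOf H i ε V₀ q + r • jetOf H i ε V q) ⟨ε, hε.1.le, hε.2⟩ a •
        H.frame i a (stripPt (H.chart i) q) := by
    have hc : ContinuousAt (fun r : ℝ => ‖H.local_ i V₀ q + r • H.local_ i V q‖) 0 := by fun_prop
    have hlt : ∀ᶠ r : ℝ in 𝓝 0, ‖H.local_ i V₀ q + r • H.local_ i V q‖ < δ :=
      hc.eventually_lt continuousAt_const (by simpa using hδ)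
    filter_upwards [hlt] with r hr
    rw [hform _ (hV₀.add (hV.smul r)) (by rwa [local_add, local_smul]),
      jetOf_add_smul hε₀ hε hV₀ hV hq]
  have h2 := deriv_eq_of_eq_sum (Z := Eu 7) hΨ ⟨ε, hε.1.le, hε.2⟩
    (fun a => H.frame i a (stripPt (H.chart i) q)) hev
  exact ⟨h2.1, local_eq_of_eq_sum ⟨hq.1.1, hq.1.2.trans hε.2⟩ (mem_target_of_mem_patch hq) h2.2⟩

/-- On the part of the patches `[0, ε] × disc` in `U`, and with the constant `B` for all `ε`, the
deformed maps are defined, and the derivative of the deformation map changes by at most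
`B n₀ n₁` in `C^α`, if the `C^{1, α}` norms of `V₀` and `V` are at most `n₀ < B⁻¹` and `n₁`. -/
def EstimateOn (H : J.HolderCharts) (i : Fin H.num) (A : AdaptedMetrics K) (α : ℝ≥0)
    (U : Set (ℝ × Eu 2)) (B : ℝ) : Prop :=
  ∀ ε ∈ Ioc 0 ε₀, ∀ V₀ V : J.Field, IsC1Section H ε V₀ → IsC1Section H ε V → ∀ n₀ n₁ : ℝ,
    JetBound H i α ε V₀ n₀ → JetBound H i α ε V n₁ → B * n₀ < 1 →
    (∀ q ∈ U ∩ H.patch ε i,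
      ExpDefined (A.metric ε) (J.thin (stripPt (H.chart i) q)) (V₀ (stripPt (H.chart i) q)) ∧
      MDifferentiableWithinAt (modelR 2) 𝓘(ℝ, Eu 7) (J.deform (A.metric ε) V₀) (strip S ε)
        (stripPt (H.chart i) q) ∧
      DifferentiableAt ℝ
        (fun r : ℝ => J.F (A.metric ε) ε (V₀ + r • V) (stripPt (H.chart i) q)) 0 ∧
      ‖H.local_ i (J.F' (A.metric ε) ε V₀ V - J.F' (A.metric ε) ε 0 V) q‖ ≤ B * n₀ * n₁) ∧
    ∀ q ∈ U ∩ H.patch ε i, ∀ q' ∈ U ∩ H.patch ε i,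
      ‖H.local_ i (J.F' (A.metric ε) ε V₀ V - J.F' (A.metric ε) ε 0 V) q -
        H.local_ i (J.F' (A.metric ε) ε V₀ V - J.F' (A.metric ε) ε 0 V) q'‖ ≤
        B * n₀ * n₁ * dist q q' ^ (α : ℝ)

/-- The estimate near a point of a patch. -/
theorem exists_local_estimate [T2Space M] (hε₀ : 0 < ε₀) (A : AdaptedMetrics K) {α : ℝ≥0}
    (hα : α ≤ 1) {q₀ : ℝ × Eu 2} (hq₀ : q₀ ∈ H.patch ε₀ i) :
    ∃ U ∈ 𝓝 q₀, ∃ B > 0, EstimateOn H i A α U B := by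
  obtain ⟨κ, Ψ, hΨ, hκ, δ, hδ, hform⟩ :=
    exists_local_formula (H := H) (i := i) hε₀ A hq₀.1 (mem_target_of_mem_patch hq₀)
  obtain ⟨ρ, hρ, B₁, hB₁, hdiff, hval, hincr⟩ := exists_derivIncr_apply_bound hΨ
  obtain ⟨B₂, t, ht, hB₂⟩ := (hκ.of_le (m := 1) (by simp)).exists_lipschitzOnWith
    ((convex_Icc 0 ε₀).prod convex_univ)
  have hκρ := hκ.continuousWithinAt.eventually (Metric.ball_mem_nhds (κ q₀) hρ)
  obtain ⟨U, hU, hUsub⟩ := mem_nhdsWithin_iff_exists_mem_nhds_inter.1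
    ((hform.and hκρ).and ht)
  have hb₂ : (0 : ℝ) ≤ B₂ := B₂.2
  refine ⟨U ∩ Metric.ball q₀ (1 / 2), inter_mem hU (Metric.ball_mem_nhds _ (by norm_num)),
    1 / δ + 1 / ρ + B₁ * (2 + B₂), by positivity, ?_⟩
  intro ε hε V₀ V hV₀ hV n₀ n₁ hn₀ hn₁ hB
  -- The terms `1 / δ` and `1 / ρ` ensure that jets bounded by `n₀` are in the domain of the local
  -- formula and in the ball of the derivative bounds.
  set B := 1 / δ + 1 / ρ + B₁ * (2 + B₂) with hBdef
  have p1 : 0 ≤ 1 / δ := by positivity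
  have p2 : 0 ≤ 1 / ρ := by positivity
  have p3 : 0 ≤ B₁ * (2 + B₂) := by positivity
  set l : Icc (0 : ℝ) ε₀ := ⟨ε, hε.1.le, hε.2⟩ with hl
  set φ := H.local_ i (J.F' (A.metric ε) ε V₀ V - J.F' (A.metric ε) ε 0 V) with hφ
  have hprop : ∀ q ∈ (U ∩ Metric.ball q₀ (1 / 2)) ∩ H.patch ε i,
      (∀ V : J.Field, IsC1Section H ε V → ‖H.local_ i V q‖ < δ →
        ExpDefined (A.metric ε) (J.thin (stripPt (H.chart i) q)) (V (stripPt (H.chart i) q)) ∧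
        MDifferentiableWithinAt (modelR 2) 𝓘(ℝ, Eu 7) (J.deform (A.metric ε) V) (strip S ε)
          (stripPt (H.chart i) q) ∧
        J.F (A.metric ε) ε V (stripPt (H.chart i) q) = ∑ a, Ψ (κ q, jetOf H i ε V q) l a •
            H.frame i a (stripPt (H.chart i) q)) ∧
      κ q ∈ Metric.ball (κ q₀) ρ ∧ q ∈ t := by
    intro q hq
    have hqs := patch_subset_strip hq.2
    obtain ⟨⟨h1, h2⟩, h3⟩ := hUsub ⟨hq.1.1, ⟨⟨hqs.1.1, hqs.1.2.trans hε.2⟩, trivial⟩⟩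
    exact ⟨fun V hV hlt => h1 ε hε V hqs.1.2 hV.normal
      (hV.differentiableWithinAt_local hε₀ hε hqs (mem_target_of_mem_patch hq.2)) hlt, h2, h3⟩
  have hsmall : ∀ q ∈ H.patch ε i, ‖jetOf H i ε V₀ q‖ ≤ n₀ ∧ ‖jetOf H i ε V₀ q‖ < δ ∧
      ‖jetOf H i ε V₀ q‖ < ρ := by
    intro q hq
    have h1 := hn₀.bound q hq
    have h0 : 0 ≤ n₀ := (norm_nonneg _).trans h1
    have h2 : 1 / δ * n₀ ≤ B * n₀ := mul_le_mul_of_nonneg_right (by linarith) h0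
    have h3 : 1 / ρ * n₀ ≤ B * n₀ := mul_le_mul_of_nonneg_right (by linarith) h0
    refine ⟨h1, h1.trans_lt ?_, h1.trans_lt ?_⟩
    · have : 1 / δ * n₀ < 1 := h2.trans_lt hB
      rwa [one_div_mul_eq_div, div_lt_one hδ] at this
    · have : 1 / ρ * n₀ < 1 := h3.trans_lt hB
      rwa [one_div_mul_eq_div, div_lt_one hρ] at this
  have hlocal : ∀ V : J.Field, ∀ q, ‖H.local_ i V q‖ ≤ ‖jetOf H i ε V q‖ := fun V q =>
    norm_fst_le (jetOf H i ε V q)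
  have h0ρ : (0 : Jet) ∈ Metric.ball (0 : Jet) ρ := Metric.mem_ball_self hρ
  have hjetρ : ∀ q ∈ H.patch ε i, jetOf H i ε V₀ q ∈ Metric.ball (0 : Jet) ρ := fun q hq => by
    rw [mem_ball_zero_iff]
    exact (hsmall q hq).2.2
  have hφq : ∀ q ∈ (U ∩ Metric.ball q₀ (1 / 2)) ∩ H.patch ε i,
      φ q = derivIncr Ψ (κ q) (jetOf H i ε V₀ q) (jetOf H i ε V q) l := by
    intro q hq
    obtain ⟨h1, h2, -⟩ := hprop q hq
    have e1 := (differentiableAt_F hε₀ A hε hV₀ hV hq.2 (fun V hV hlt => (h1 V hV hlt).2.2)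
      ((hlocal _ q).trans_lt (hsmall q hq.2).2.1) (hdiff _ h2 _ (hjetρ q hq.2))).2
    have e2 := (differentiableAt_F hε₀ A hε isC1Section_zero hV hq.2
      (fun V hV hlt => (h1 V hV hlt).2.2) (by rw [local_zero, norm_zero]; exact hδ)
      (by rw [jetOf_zero hε.1 (patch_subset_strip hq.2)]; exact hdiff _ h2 _ h0ρ)).2
    rw [jetOf_zero hε.1 (patch_subset_strip hq.2)] at e2
    rw [hφ, local_sub, e1, e2]
    rfl
  refine ⟨fun q hq => ?_, fun q hq q' hq' => ?_⟩
  · obtain ⟨h1, h2, -⟩ := hprop q hq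
    have hlt := (hlocal V₀ q).trans_lt (hsmall q hq.2).2.1
    obtain ⟨h3, h4, -⟩ := h1 V₀ hV₀ hlt
    refine ⟨h3, h4, (differentiableAt_F hε₀ A hε hV₀ hV hq.2
      (fun V hV hlt => (h1 V hV hlt).2.2) hlt (hdiff _ h2 _ (hjetρ q hq.2))).1, ?_⟩
    have hn₀' : 0 ≤ n₀ := (norm_nonneg _).trans (hn₀.bound q hq.2)
    have hn₁' : 0 ≤ n₁ := (norm_nonneg _).trans (hn₁.bound q hq.2)
    rw [hφq q hq]
    calc _ ≤ ‖derivIncr Ψ (κ q) (jetOf H i ε V₀ q) (jetOf H i ε V q)‖ :=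
          ContinuousMap.norm_coe_le_norm _ l
      _ ≤ B₁ * ‖jetOf H i ε V₀ q‖ * ‖jetOf H i ε V q‖ := hval _ h2 _ (hjetρ q hq.2) _
      _ ≤ (B₁ * n₀) * n₁ := by
          gcongr
          · exact (hsmall q hq.2).1
          · exact hn₁.bound q hq.2
      _ ≤ B * n₀ * n₁ := by
          gcongr
          rw [hBdef]
          nlinarith
  · have hn₀' : 0 ≤ n₀ := (norm_nonneg _).trans (hn₀.bound q hq.2)
    have hn₁' : 0 ≤ n₁ := (norm_nonneg _).trans (hn₁.bound q hq.2)
    obtain ⟨-, h2, h3⟩ := hprop q hq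
    obtain ⟨-, h2', h3'⟩ := hprop q' hq'
    set d := dist q q' ^ (α : ℝ) with hd
    have hd0 : 0 ≤ d := by positivity
    -- Lipschitz bounds imply Hölder bounds, as the points have distance at most `1`.
    have hdd : dist q q' ≤ d := by
      have h4 : dist q q' ≤ 1 := by
        have := dist_triangle_right q q' q₀
        have e1 := Metric.mem_ball.1 hq.1.2
        have e2 := Metric.mem_ball.1 hq'.1.2
        linarith
      rcases (dist_nonneg (x := q) (y := q')).eq_or_lt with h5 | h5
      · rw [← h5]
        exact hd0
      · have := Real.rpow_le_rpow_of_exponent_ge h5 h4 (show (α : ℝ) ≤ 1 from hα)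
        rwa [Real.rpow_one] at this
    have hκd : ‖κ q - κ q'‖ ≤ B₂ * d := by
      refine (hB₂.norm_sub_le h3 h3').trans ?_
      rw [← dist_eq_norm]
      gcongr
    rw [hφq q hq, hφq q' hq']
    have e2 : ∀ x y : C(Icc (0 : ℝ) ε₀, Eu 4), ‖x l - y l‖ ≤ ‖x - y‖ := fun x y =>
      ContinuousMap.norm_coe_le_norm (x - y) l
    refine (e2 _ _).trans
      ((hincr _ h2 _ h2' _ (hjetρ q hq.2) _ (hjetρ q' hq'.2) _ _).trans ?_)
    have b1 := hn₀.holder q hq.2 q' hq'.2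
    have b2 := hn₁.holder q hq.2 q' hq'.2
    have b3 := hn₀.bound q' hq'.2
    have b4 := hn₁.bound q hq.2
    rw [← hd] at b1 b2
    generalize ‖jetOf H i ε V₀ q - jetOf H i ε V₀ q'‖ = c1 at b1 ⊢
    have p8 := norm_nonneg (jetOf H i ε V q - jetOf H i ε V q')
    generalize ‖jetOf H i ε V q - jetOf H i ε V q'‖ = c2 at b2 p8 ⊢
    have p5 := norm_nonneg (jetOf H i ε V₀ q')
    have p6 := norm_nonneg (jetOf H i ε V q)
    have p7 := norm_nonneg (κ q - κ q')
    generalize ‖jetOf H i ε V₀ q'‖ = c3 at b3 p5 ⊢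
    generalize ‖jetOf H i ε V q‖ = c4 at b4 p6 ⊢
    generalize ‖κ q - κ q'‖ = c5 at hκd p7 ⊢
    calc B₁ * (c1 + c5 * c3) * c4 + B₁ * c3 * c2
        ≤ B₁ * (n₀ * d + (B₂ * d) * n₀) * n₁ + (B₁ * n₀) * (n₁ * d) := by gcongr
      _ = (B₁ * (2 + B₂)) * n₀ * n₁ * d := by ring
      _ ≤ B * n₀ * n₁ * d := by
          gcongr
          linarith

end HolomorphicCurve.HolderCharts

end LocalEstimates

/-! ### Hölder norms -/

section HolderNorms

variable {X Y : Type*} [NormedAddCommGroup X] [NormedSpace ℝ X] [NormedAddCommGroup Y]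
  [NormedSpace ℝ Y] {α N : ℝ≥0} {D : Set X} {f : X → Y}

theorem holderNorm_bounds (h : holderNorm α D f ≤ N) : (∀ x ∈ D, ‖f x‖ ≤ N) ∧
    ∀ x ∈ D, ∀ x' ∈ D, ‖f x - f x'‖ ≤ N * dist x x' ^ (α : ℝ) := by
  have h1 : (⨆ x ∈ D, ‖f x‖ₑ) ≤ N := le_self_add.trans h
  have h2 : eHolderNorm α (D.domRestrict f) ≤ N := le_add_self.trans h
  refine ⟨fun x hx => ?_, fun x hx x' hx' => ?_⟩
  · have h3 : ‖f x‖ₑ ≤ N := (le_iSup₂ (f := fun x (_ : x ∈ D) => ‖f x‖ₑ) x hx).trans h1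
    rw [enorm_eq_nnnorm, ENNReal.coe_le_coe] at h3
    exact_mod_cast h3
  · have hm : MemHolder α (D.domRestrict f) :=
      eHolderNorm_lt_top.1 (h2.trans_lt ENNReal.coe_lt_top)
    rw [← hm.coe_nnHolderNorm_eq_eHolderNorm, ENNReal.coe_le_coe] at h2
    have h3 := hm.holderWith.dist_le ⟨x, hx⟩ ⟨x', hx'⟩
    rw [dist_eq_norm] at h3
    refine h3.trans ?_
    rw [Subtype.dist_eq]
    gcongr

theorem holderNorm_le (h : ∀ x ∈ D, ‖f x‖ ≤ N)
    (h' : ∀ x ∈ D, ∀ x' ∈ D, ‖f x - f x'‖ ≤ N * dist x x' ^ (α : ℝ)) :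
    holderNorm α D f ≤ N + N := by
  refine add_le_add (iSup₂_le fun x hx => ?_) (HolderWith.eHolderNorm_le fun x x' => ?_)
  · rw [enorm_eq_nnnorm, ENNReal.coe_le_coe]
    exact_mod_cast h x hx
  · have h1 := h' x x.2 x' x'.2
    rw [edist_nndist, edist_nndist, ← ENNReal.coe_rpow_of_nonneg _ α.coe_nonneg, ← ENNReal.coe_mul,
      ENNReal.coe_le_coe, ← NNReal.coe_le_coe, NNReal.coe_mul, NNReal.coe_rpow, coe_nndist,
      coe_nndist, dist_eq_norm]
    exact h1

/-- On a convex set a `C^1` function bounded in `C^{1, α}` is Hölder continuous with its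
derivative; the factor `2` is for points at distance at least `1`. -/
theorem holderNormOne_bounds (hα : α ≤ 1) (hD : Convex ℝ D) (hf : DifferentiableOn ℝ f D)
    (h : holderNormOne α D f ≤ N) :
    (∀ x ∈ D, ‖f x‖ ≤ N ∧ ‖fderivWithin ℝ f D x‖ ≤ N) ∧
    ∀ x ∈ D, ∀ x' ∈ D, ‖f x - f x'‖ ≤ 2 * N * dist x x' ^ (α : ℝ) ∧
      ‖fderivWithin ℝ f D x - fderivWithin ℝ f D x'‖ ≤ N * dist x x' ^ (α : ℝ) := by
  have h1 : (⨆ x ∈ D, ‖f x‖ₑ) ≤ N := le_self_add.trans h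
  obtain ⟨h2, h3⟩ := holderNorm_bounds (le_add_self.trans h)
  have h4 : ∀ x ∈ D, ‖f x‖ ≤ N := fun x hx => by
    have h3 : ‖f x‖ₑ ≤ N := (le_iSup₂ (f := fun x (_ : x ∈ D) => ‖f x‖ₑ) x hx).trans h1
    rw [enorm_eq_nnnorm, ENNReal.coe_le_coe] at h3
    exact_mod_cast h3
  refine ⟨fun x hx => ⟨h4 x hx, h2 x hx⟩, fun x hx x' hx' => ⟨?_, h3 x hx x' hx'⟩⟩
  have hN : (0 : ℝ) ≤ N := N.2
  rcases le_total (dist x x') 1 with hd | hd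
  · have h5 : ‖f x - f x'‖ ≤ N * ‖x - x'‖ :=
      hD.norm_image_sub_le_of_norm_fderivWithin_le hf h2 hx' hx
    rw [← dist_eq_norm x x'] at h5
    have h6 : dist x x' ≤ dist x x' ^ (α : ℝ) := by
      rcases (dist_nonneg (x := x) (y := x')).eq_or_lt with h6 | h6
      · rw [← h6]
        positivity
      · have := Real.rpow_le_rpow_of_exponent_ge h6 hd (show (α : ℝ) ≤ 1 from hα)
        rwa [Real.rpow_one] at this
    nlinarith [dist_nonneg (x := x) (y := x')]
  · have h6 : 1 ≤ dist x x' ^ (α : ℝ) := Real.one_le_rpow hd α.2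
    have h7 := (norm_sub_le (f x) (f x')).trans (add_le_add (h4 x hx) (h4 x' hx'))
    nlinarith

end HolderNorms

section GlobalEstimates

variable {M : Type*} [TopologicalSpace M] [ChartedSpace (Eu 7) M] [IsManifold 𝓘(ℝ, Eu 7) ∞ M]
variable {C : Type*} [TopologicalSpace C] [ChartedSpace (Eu 4) C] [IsManifold 𝓘(ℝ, Eu 4) ∞ C]
variable {S : Type*} [TopologicalSpace S] [ChartedSpace (Eu 2) S] [IsManifold 𝓘(ℝ, Eu 2) ∞ S]
variable {G : G2Structure M} {ε₀ : ℝ} {K : CoassociativeFamily G C ε₀}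
variable {J : HolomorphicCurve K S}

namespace HolomorphicCurve.HolderCharts

variable {H : J.HolderCharts} {i : Fin H.num} {ε : ℝ} {V : J.Field} {α : ℝ≥0}

/-- The norms are defined by derivatives within a patch, the jets by derivatives within a strip, and
both agree on the patch. -/
theorem jetBound_of_normOne_le (hε₀ : 0 < ε₀) (hε : ε ∈ Ioc 0 ε₀) (hα : α ≤ 1)
    (hV : IsC1Section H ε V) {N : ℝ≥0} (h : H.normOne α ε V ≤ N) :
    JetBound H i α ε V (2 * N) := by
  have hN : (0 : ℝ) ≤ N := N.2
  obtain ⟨h1, h2⟩ := holderNormOne_bounds hα convex_patch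
    ((hV.contDiffOn i).differentiableOn one_ne_zero)
    ((le_iSup (fun i => holderNormOne α (H.patch ε i) (H.local_ i V)) i).trans h)
  refine ⟨fun q hq => ?_, fun q hq q' hq' => ?_⟩
  · obtain ⟨h3, h4⟩ := h1 q hq
    rw [fderivWithin_patch hε₀ hε hV hq] at h4
    exact max_le (h3.trans (by linarith)) (h4.trans (by linarith))
  · obtain ⟨h3, h4⟩ := h2 q hq q' hq'
    rw [fderivWithin_patch hε₀ hε hV hq, fderivWithin_patch hε₀ hε hV hq'] at h4
    refine max_le h3 (h4.trans ?_)
    gcongr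
    linarith

theorem EstimateOn.mono {A : AdaptedMetrics K} {U : Set (ℝ × Eu 2)} {B B' : ℝ}
    (h : EstimateOn H i A α U B) (hB : B ≤ B') : EstimateOn H i A α U B' := by
  intro ε hε V₀ V hV₀ hV n₀ n₁ hn₀ hn₁ hBn
  have hpos : ∀ q ∈ H.patch ε i, 0 ≤ n₀ ∧ 0 ≤ n₁ := fun q hq =>
    ⟨(norm_nonneg _).trans (hn₀.bound q hq), (norm_nonneg _).trans (hn₁.bound q hq)⟩
  have hle : ∀ q ∈ H.patch ε i, B * n₀ < 1 ∧ B * n₀ * n₁ ≤ B' * n₀ * n₁ := by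
    intro q hq
    obtain ⟨h0, h1⟩ := hpos q hq
    have h2 := mul_le_mul_of_nonneg_right hB h0
    exact ⟨h2.trans_lt hBn, mul_le_mul_of_nonneg_right h2 h1⟩
  refine ⟨fun q hq => ?_, fun q hq q' hq' => ?_⟩
  · obtain ⟨h1, h2⟩ := hle q hq.2
    obtain ⟨e1, e2, e3, e4⟩ := (h ε hε V₀ V hV₀ hV n₀ n₁ hn₀ hn₁ h1).1 q hq
    exact ⟨e1, e2, e3, e4.trans h2⟩
  · obtain ⟨h1, h2⟩ := hle q hq.2
    exact ((h ε hε V₀ V hV₀ hV n₀ n₁ hn₀ hn₁ h1).2 q hq q' hq').trans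
      (mul_le_mul_of_nonneg_right h2 (by positivity))

/-- The estimate on a patch. Points at a distance less than a Lebesgue number lie in a common
neighbourhood where the local estimate holds; for the others the supremum bound suffices. -/
theorem exists_patch_estimate [T2Space M] (hε₀ : 0 < ε₀) (A : AdaptedMetrics K) (hα : α ≤ 1)
    (i : Fin H.num) : ∃ B > 0, EstimateOn H i A α univ B := by
  have h : ∀ q₀ ∈ H.patch ε₀ i, ∃ U ∈ 𝓝 q₀, ∃ B > 0, EstimateOn H i A α U B := fun q₀ hq₀ =>
    exists_local_estimate hε₀ A hα hq₀
  choose! U hU B hB hE using h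
  obtain ⟨t, htK, htcov⟩ := (isCompact_patch (H := H) (ε := ε₀) (i := i)).elim_nhds_subcover
    (fun x => interior (U x)) fun x hx => interior_mem_nhds.2 (hU x hx)
  obtain ⟨ρ, hρ, hleb⟩ := lebesgue_number_lemma_of_metric
    (isCompact_patch (H := H) (ε := ε₀) (i := i)) (c := fun x : t => interior (U x))
    (fun _ => isOpen_interior) fun x hx => by
      obtain ⟨y, hy, hxy⟩ := mem_iUnion₂.1 (htcov hx)
      exact mem_iUnion.2 ⟨⟨y, hy⟩, hxy⟩
  set B₁ := 1 + ∑ x ∈ t, B x with hB₁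
  have hBt : ∀ x ∈ t, B x ≤ B₁ := fun x hx => by
    have := Finset.single_le_sum (fun y hy => (hB y (htK y hy)).le) hx
    linarith
  have hB₁0 : 0 < B₁ := by
    have : 0 ≤ ∑ x ∈ t, B x := Finset.sum_nonneg fun y hy => (hB y (htK y hy)).le
    linarith
  have hρα : 0 < ρ ^ (α : ℝ) := Real.rpow_pos_of_pos hρ _
  have hloc : ∀ x ∈ H.patch ε₀ i, ∃ y, Metric.ball x ρ ⊆ U y ∧ EstimateOn H i A α (U y) B₁ := by
    intro x hx
    obtain ⟨y, hy⟩ := hleb x hx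
    exact ⟨y, hy.trans interior_subset, (hE y (htK y y.2)).mono (hBt y y.2)⟩
  set c := 1 + 2 / ρ ^ (α : ℝ) with hc
  have hc1 : 1 ≤ c := by
    have : 0 ≤ 2 / ρ ^ (α : ℝ) := by positivity
    linarith
  refine ⟨B₁ * c, by positivity, ?_⟩
  have hle : B₁ ≤ B₁ * c := le_mul_of_one_le_right hB₁0.le hc1
  have hlocc : ∀ x ∈ H.patch ε₀ i, ∃ y, Metric.ball x ρ ⊆ U y ∧ EstimateOn H i A α (U y) (B₁ * c) :=
    fun x hx => (hloc x hx).imp fun y hy => ⟨hy.1, hy.2.mono hle⟩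
  intro ε hε V₀ V hV₀ hV n₀ n₁ hn₀ hn₁ hBn
  have hsub : H.patch ε i ⊆ H.patch ε₀ i := prod_mono (Icc_subset_Icc_right hε.2) subset_rfl
  have hpos : ∀ q ∈ H.patch ε i, 0 ≤ n₀ ∧ 0 ≤ n₁ := fun q hq =>
    ⟨(norm_nonneg _).trans (hn₀.bound q hq), (norm_nonneg _).trans (hn₁.bound q hq)⟩
  have hsup : ∀ q ∈ H.patch ε i, ‖H.local_ i (J.F' (A.metric ε) ε V₀ V -
      J.F' (A.metric ε) ε 0 V) q‖ ≤ B₁ * n₀ * n₁ := by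
    intro q hq
    obtain ⟨y, hy, hEy⟩ := hloc q (hsub hq)
    have hBn' : B₁ * n₀ < 1 := (mul_le_mul_of_nonneg_right hle (hpos q hq).1).trans_lt hBn
    exact ((hEy ε hε V₀ V hV₀ hV n₀ n₁ hn₀ hn₁ hBn').1 q
      ⟨hy (Metric.mem_ball_self hρ), hq⟩).2.2.2
  refine ⟨fun q hq => ?_, fun q hq q' hq' => ?_⟩
  · obtain ⟨y, hy, hEy⟩ := hlocc q (hsub hq.2)
    exact (hEy ε hε V₀ V hV₀ hV n₀ n₁ hn₀ hn₁ hBn).1 q ⟨hy (Metric.mem_ball_self hρ), hq.2⟩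
  · obtain ⟨h0, h1⟩ := hpos q hq.2
    rcases lt_or_ge (dist q' q) ρ with hd | hd
    · obtain ⟨y, hy, hEy⟩ := hlocc q (hsub hq.2)
      exact (hEy ε hε V₀ V hV₀ hV n₀ n₁ hn₀ hn₁ hBn).2 q ⟨hy (Metric.mem_ball_self hρ), hq.2⟩ q'
        ⟨hy hd, hq'.2⟩
    · rw [dist_comm] at hd
      have hdα : ρ ^ (α : ℝ) ≤ dist q q' ^ (α : ℝ) := Real.rpow_le_rpow hρ.le hd α.2
      have h2 : 2 ≤ c * dist q q' ^ (α : ℝ) := by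
        have e1 : 2 / ρ ^ (α : ℝ) * ρ ^ (α : ℝ) = 2 := div_mul_cancel₀ _ hρα.ne'
        have e2 : 2 / ρ ^ (α : ℝ) * ρ ^ (α : ℝ) ≤ c * dist q q' ^ (α : ℝ) := by
          gcongr
          linarith
        linarith
      have h3 := (norm_sub_le _ _).trans (add_le_add (hsup q hq.2) (hsup q' hq'.2))
      refine h3.trans ?_
      calc B₁ * n₀ * n₁ + B₁ * n₀ * n₁ = B₁ * n₀ * n₁ * 2 := by ring
        _ ≤ B₁ * n₀ * n₁ * (c * dist q q' ^ (α : ℝ)) := by gcongr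
        _ = B₁ * c * n₀ * n₁ * dist q q' ^ (α : ℝ) := by ring

theorem exists_estimate [T2Space M] (hε₀ : 0 < ε₀) (A : AdaptedMetrics K) (hα : α ≤ 1)
    (H : J.HolderCharts) : ∃ B : ℝ≥0, 0 < B ∧ ∀ i, EstimateOn H i A α univ B := by
  choose B hB hE using fun i => exists_patch_estimate (H := H) hε₀ A hα i
  have h0 : 0 ≤ ∑ j, B j := Finset.sum_nonneg fun j _ => (hB j).le
  refine ⟨Real.toNNReal (1 + ∑ j, B j), Real.toNNReal_pos.2 (by linarith),
    fun i => (hE i).mono ?_⟩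
  have := Finset.single_le_sum (fun j _ => (hB j).le) (Finset.mem_univ i)
  rw [Real.coe_toNNReal _ (by linarith)]
  linarith

end HolomorphicCurve.HolderCharts

end GlobalEstimates

end ThinInstanton

end

open ThinInstanton in
theorem proposition4
    {M : Type*} [TopologicalSpace M] [T2Space M] [ChartedSpace (Eu 7) M]
    [IsManifold 𝓘(ℝ, Eu 7) ∞ M]
    {C : Type*} [TopologicalSpace C] [CompactSpace C] [T2Space C] [ChartedSpace (Eu 4) C]
    [IsManifold 𝓘(ℝ, Eu 4) ∞ C]
    {S : Type*} [TopologicalSpace S] [CompactSpace S] [T2Space S] [ChartedSpace (Eu 2) S]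
    [IsManifold 𝓘(ℝ, Eu 2) ∞ S]
    (G : G2Structure M) {ε₀ : ℝ} (hε₀ : 0 < ε₀) (K : CoassociativeFamily G C ε₀)
    (J : HolomorphicCurve K S) (A : AdaptedMetrics K) (H : J.HolderCharts)
    (α : ℝ≥0) (hα₀ : 0 < α) (hα₁ : α < 1) :
    ∃ δ₀ : ℝ≥0, 0 < δ₀ ∧ ∃ B : ℝ≥0, ∀ ε ∈ Ioc 0 ε₀, ∀ V₀ V : J.Field,
      H.IsSection α ε V₀ → H.IsSection α ε V → H.normOne α ε V₀ < δ₀ →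
        J.InDomain (A.metric ε) ε V₀ ∧
        (∀ p ∈ (Icc 0 ε ×ˢ univ : Set (ℝ × S)),
          DifferentiableAt ℝ (fun r : ℝ => J.F (A.metric ε) ε (V₀ + r • V) p) 0) ∧
        H.norm α ε (J.F' (A.metric ε) ε V₀ V - J.F' (A.metric ε) ε 0 V) ≤
          B * H.normOne α ε V₀ * H.normOne α ε V := by
  obtain ⟨B, hB, hE⟩ := HolomorphicCurve.HolderCharts.exists_estimate hε₀ A hα₁.le H
  refine ⟨(2 * B)⁻¹, by positivity, 8 * B, fun ε hε V₀ V hV₀ hV hδ => ?_⟩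
  obtain ⟨N₀, hN₀⟩ : ∃ N₀ : ℝ≥0, (N₀ : ℝ≥0∞) = H.normOne α ε V₀ :=
    ⟨_, ENNReal.coe_toNNReal hV₀.2.2.ne⟩
  obtain ⟨N, hN⟩ : ∃ N : ℝ≥0, (N : ℝ≥0∞) = H.normOne α ε V :=
    ⟨_, ENNReal.coe_toNNReal hV.2.2.ne⟩
  have hC₀ : H.IsC1Section ε V₀ := ⟨hV₀.1, hV₀.2.1⟩
  have hC : H.IsC1Section ε V := ⟨hV.1, hV.2.1⟩
  rw [← hN₀, ENNReal.coe_lt_coe] at hδ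
  have hsmall : (B : ℝ) * (2 * N₀) < 1 := by
    have h1 : 2 * B * N₀ < 1 := by
      have h2 : 0 < 2 * B := by positivity
      calc 2 * B * N₀ < 2 * B * (2 * B)⁻¹ := by gcongr
        _ = 1 := mul_inv_cancel₀ h2.ne'
    have h2 : ((2 * B * N₀ : ℝ≥0) : ℝ) < 1 := h1
    push_cast at h2
    linarith
  have hall : ∀ i, _ := fun i => hE i ε hε V₀ V hC₀ hC _ _
    (HolomorphicCurve.HolderCharts.jetBound_of_normOne_le hε₀ hε hα₁.le hC₀ hN₀.ge)
    (HolomorphicCurve.HolderCharts.jetBound_of_normOne_le hε₀ hε hα₁.le hC hN.ge) hsmall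
  have hpt : ∀ p ∈ (Icc 0 ε ×ˢ univ : Set (ℝ × S)), ExpDefined (A.metric ε) (J.thin p) (V₀ p) ∧
      MDifferentiableWithinAt (modelR 2) 𝓘(ℝ, Eu 7) (J.deform (A.metric ε) V₀)
        (Icc 0 ε ×ˢ univ) p ∧
      DifferentiableAt ℝ (fun r : ℝ => J.F (A.metric ε) ε (V₀ + r • V) p) 0 := by
    intro p hp
    obtain ⟨j, hj, hpj, -⟩ := HolomorphicCurve.HolderCharts.exists_patch (H := H) p hp
    obtain ⟨h1, h2, h3, -⟩ := (hall j).1 _ ⟨trivial, hpj⟩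
    rw [stripPt_stripCoord hj] at h1 h2 h3
    exact ⟨h1, h2, h3⟩
  refine ⟨⟨fun p hp => (hpt p hp).1, fun p hp => (hpt p hp).2.1⟩, fun p hp => (hpt p hp).2.2, ?_⟩
  refine iSup_le fun i => ?_
  have h := holderNorm_le (N := B * (2 * N₀) * (2 * N))
    (fun q hq => ((hall i).1 q ⟨trivial, hq⟩).2.2.2)
    (fun q hq q' hq' => (hall i).2 q ⟨trivial, hq⟩ q' ⟨trivial, hq'⟩)
  refine h.trans ?_
  rw [← hN₀, ← hN, ← ENNReal.coe_add, ← ENNReal.coe_mul, ← ENNReal.coe_mul, ENNReal.coe_le_coe]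
  exact le_of_eq (by ring)
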